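/- Let $K$ be a field, $H$ an additive abelian group, and $A=\bigoplus_{h\in H}A_h$ an $H$-graded associative (not necessarily unital) $K$-algebra with enough idempotents, i.e. there is a family of nonzero orthogonal idempotents of degree $0$, $(e_i)_{i\in I}$, with $\bigoplus_{i}Ae_i=A=\bigoplus_i e_iA$ (a distinguished family). Let $J=J^{gr}(A)$ be its graded Jacobson radical, i.e. the intersection of all maximal graded left ideals (equivalently, of all maximal graded right ideals). Denote by $A\text{-}Gr$ and $Gr\text{-}A$ the categories of unital ($AM=M$, resp. $MA=M$) $H$-graded left and right $A$-modules with homomorphisms of degree $0$, and by $M[k]$ the shift $M[k]_h=M_{k+h}$. The graded socle $\mathrm{Soc}_{gr}(M)$ is the sum of the graded-simple graded submodules of $M$; a graded submodule of $M$ is essential if it meets every nonzero graded submodule of $M$ nontrivially; $M$ is finitely cogenerated if $\mathrm{Soc}_{gr}(M)$ is finitely generated and essential in $M$. Assume that $(e_i)_{i\in I}$ is a weakly basic distinguished family: every $e_iA_he_j$ is finite dimensional over $K$, every ring $e_iA_0e_i$ is local, and $e_iAe_j\subseteq J$ whenever $i\neq j$. Call $A$ locally Noetherian if every $Ae_i$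 and every $e_iA$ satisfies the ascending chain condition on graded submodules. Then the following assertions are equivalent. (1) $A$ is locally Noetherian and: (a) for each $i\in I$, $Ae_i$ and $e_iA$ have a simple essential graded socle in $A\text{-}Gr$ and $Gr\text{-}A$, respectively; and (b) there are bijections $\nu,\nu':I\to I$ such that, for each $i\in I$, $\mathrm{Soc}_{gr}(e_iA)\cong \frac{e_{\nu(i)}A}{e_{\nu(i)}J}[h_i]$ in $Gr\text{-}A$ and $\mathrm{Soc}_{gr}(Ae_i)\cong\frac{Ae_{\nu'(i)}}{Je_{\nu'(i)}}[h'_i]$ in $A\text{-}Gr$ for some $h_i,h_i'\in H$. (2) $A$ is locally Noetherian and graded pseudo-Frobenius. Here graded pseudo-Frobenius may be taken in either of the following two senses, and (2) is equivalent to the other assertions in each of them: (2') in $A\text{-}Gr$ and in $Gr\text{-}A$, the finitely generated projective objects are exactly the finitely cogenerated injective objects; (2'') $A$ admits a graded Nakayama form, i.e. a bilinear form $(-,-):A\times A\to K$ such that $(ab,c)=(a,bc)$ for all $a,b,c\in A$; there is a bijection $\sigma:I\to I$ such that, for each $i$, $\sigma(i)$ is the unique index with $(e_iA,Ae_{\sigma(i)})\neq0$;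 and there is a map $i\mapsto d_i$, $I\to H$, such that for all $i,j\in I$ the restriction $e_iAe_j\times e_jAe_{\sigma(i)}\to K$ is of degree $d_i$ (homogeneous elements of degrees $s,t$ pair to $0$ unless $s+t=d_i$) and nondegenerate (it induces bijections of each factor onto the graded dual of the other, where the graded dual of $V=\bigoplus_h V_h$ consists of the linear forms vanishing on all but finitely many $V_h$). (3) $A$ is graded Quasi-Frobenius: $A\text{-}Gr$ and $Gr\text{-}A$ are Frobenius categories, i.e. they have enough projectives and enough injectives, and their projective objects coincide with their injective objects. -/

import Mathlib

open CategoryTheory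

universe u

namespace GrAlg

/-! ### Projections of an internal direct sum -/

section Aux

variable {K : Type*} [Field K] {ι V W : Type*} [AddCommGroup V] [Module K V]
  [AddCommGroup W] [Module K W]

open scoped Classical in
/-- `V` is the (internal) direct sum of the family of subspaces `G`. -/
def IsDirectSum (G : ι → Submodule K V) : Prop := DirectSum.IsInternal G

open scoped Classical in
/-- The isomorphism with the external direct sum. -/
noncomputable def IsDirectSum.equiv {G : ι → Submodule K V} (hG : IsDirectSum G) :
    DirectSum ι (fun i => G i) ≃ₗ[K] V :=
  LinearEquiv.ofBijective (DirectSum.coeLinearMap G) (id hG : DirectSum.IsInternal G)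

open scoped Classical in
/-- The projection of `V = ⨁ G i` onto its `i`-th homogeneous component, as an endomorphism. -/
noncomputable def proj {G : ι → Submodule K V} (hG : IsDirectSum G) (i : ι) : V →ₗ[K] V :=
  (G i).subtype ∘ₗ DirectSum.component K ι (fun i => G i) i ∘ₗ hG.equiv.symm.toLinearMap

open scoped Classical in
theorem proj_symm_apply {G : ι → Submodule K V} (hG : IsDirectSum G) {i : ι} {x : V}
    (hx : x ∈ G i) : hG.equiv.symm x = DirectSum.lof K ι (fun i => G i) i ⟨x, hx⟩ := by
  rw [LinearEquiv.symm_apply_eq]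
  exact (DirectSum.coeLinearMap_of G i ⟨x, hx⟩).symm

theorem proj_same {G : ι → Submodule K V} (hG : IsDirectSum G) {i : ι} {x : V}
    (hx : x ∈ G i) : proj hG i x = x := by
  classical
  simp only [proj, LinearMap.comp_apply, LinearEquiv.coe_coe, proj_symm_apply hG hx]
  rw [DirectSum.component.lof_self]
  rfl

theorem proj_ne {G : ι → Submodule K V} (hG : IsDirectSum G) {i j : ι} (h : j ≠ i) {x : V}
    (hx : x ∈ G j) : proj hG i x = 0 := by
  classical
  simp only [proj, LinearMap.comp_apply, LinearEquiv.coe_coe, proj_symm_apply hG hx]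
  rw [DirectSum.component.of, dif_neg h]
  rfl

theorem proj_mem {G : ι → Submodule K V} (hG : IsDirectSum G) (i : ι) (x : V) :
    proj hG i x ∈ G i := by
  simp [proj]

theorem iSup_eq_top_of_isInternal {G : ι → Submodule K V} (hG : IsDirectSum G) :
    ⨆ i, G i = ⊤ := by
  classical
  exact DirectSum.IsInternal.submodule_iSup_eq_top hG

/-- A linear map preserving two gradings commutes with the projections. -/
theorem proj_comm {G : ι → Submodule K V} (hG : IsDirectSum G)
    {G' : ι → Submodule K W} (hG' : IsDirectSum G') (f : V →ₗ[K] W)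
    (hf : ∀ i, ∀ x ∈ G i, f x ∈ G' i) (i : ι) (x : V) : proj hG' i (f x) = f (proj hG i x) := by
  have hx : x ∈ ⨆ i, G i := by rw [iSup_eq_top_of_isInternal hG]; trivial
  induction hx using Submodule.iSup_induction' with
  | mem j x hx =>
    by_cases h : j = i
    · subst h
      rw [proj_same hG hx, proj_same hG' (hf _ _ hx)]
    · rw [proj_ne hG h hx, proj_ne hG' h (hf _ _ hx), map_zero]
  | zero => simp
  | add x y _ _ hx hy => simp only [map_add, hx, hy]

/-- A spanning family of subspaces that is separated by linear maps is an internal direct sum. -/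
theorem isInternal_of_proj {G : ι → Submodule K V} (p : ι → V →ₗ[K] V)
    (h1 : ∀ i, ∀ x ∈ G i, p i x = x) (h0 : ∀ i j, j ≠ i → ∀ x ∈ G j, p i x = 0)
    (ht : ∀ x, x ∈ ⨆ i, G i) : IsDirectSum G := by
  classical
  refine DirectSum.isInternal_submodule_of_iSupIndep_of_iSup_eq_top ?_
    (eq_top_iff.2 fun x _ => ht x)
  rw [iSupIndep_def]
  intro i
  rw [Submodule.disjoint_def]
  intro x hx hx'
  rw [← h1 i x hx]
  have : (⨆ j, ⨆ (_ : j ≠ i), G j) ≤ LinearMap.ker (p i) :=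
    iSup_le fun j => iSup_le fun hj => fun y hy => h0 i j hj y hy
  exact this hx'

theorem isInternal_map_equiv {G : ι → Submodule K V} (hG : IsDirectSum G)
    (f : V ≃ₗ[K] W) : IsDirectSum fun i => (G i).map f.toLinearMap := by
  refine isInternal_of_proj (fun i => f.toLinearMap ∘ₗ proj hG i ∘ₗ f.symm.toLinearMap) ?_ ?_ ?_
  · rintro i _ ⟨x, hx, rfl⟩
    simp [proj_same hG hx]
  · rintro i j hij _ ⟨x, hx, rfl⟩
    simp [proj_ne hG hij hx]
  · intro y
    rw [← Submodule.map_iSup, iSup_eq_top_of_isInternal hG]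
    exact ⟨f.symm y, trivial, by simp⟩

/-- In a graded space, each vector of a subspace closed under the projections is a sum of
homogeneous vectors of that subspace. -/
theorem mem_iSup_of_proj_mem {G : ι → Submodule K V} (hG : IsDirectSum G)
    (N : Submodule K V) (hN : ∀ x ∈ N, ∀ i, proj hG i x ∈ N) {x : V} (hx : x ∈ N) :
    x ∈ ⨆ i, N ⊓ G i := by
  classical
  have key : x = ∑ i ∈ (hG.equiv.symm x).support, proj hG i x := by
    have h1 : hG.equiv (hG.equiv.symm x) =
        DFinsupp.sum (hG.equiv.symm x) fun i => (fun x : G i => (x : V)) :=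
      DirectSum.coeLinearMap_eq_dfinsuppSum G _
    rw [LinearEquiv.apply_symm_apply] at h1
    exact h1
  rw [key]
  exact Submodule.sum_mem _ fun i _ =>
    Submodule.mem_iSup_of_mem i ⟨hN x hx i, proj_mem hG i x⟩

end Aux

/-! ### Graded algebras with enough idempotents -/

section Algebra

variable {K H A I : Type u} [Field K] [AddCommGroup H] [NonUnitalRing A] [Module K A]
  [IsScalarTower K A A] [SMulCommClass K A A]

/-- A distinguished family for the `H`-graded (possibly non-unital) `K`-algebra
`A = ⨁ h, 𝒜 h`: nonzero orthogonal idempotents `e i`, homogeneous of degree `0`, such that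
`⨁ i, A e_i = A = ⨁ i, e_i A`. -/
structure IsDistinguishedFamily (𝒜 : H → Submodule K A) (e : I → A) : Prop where
  ne_zero : ∀ i, e i ≠ 0
  idem : ∀ i, IsIdempotentElem (e i)
  ortho : ∀ i j, i ≠ j → e i * e j = 0
  deg_zero : ∀ i, e i ∈ 𝒜 0
  internal_left :
    IsDirectSum fun i => LinearMap.range (LinearMap.mulRight K (e i))
  internal_right :
    IsDirectSum fun i => LinearMap.range (LinearMap.mulLeft K (e i))

/-- `A = ⨁ h, 𝒜 h` is an `H`-graded algebra with enough idempotents. -/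
class GradedAlgebraEI (𝒜 : H → Submodule K A) : Prop where
  internal : IsDirectSum 𝒜
  mul_mem : ∀ {h k : H} {a b : A}, a ∈ 𝒜 h → b ∈ 𝒜 k → a * b ∈ 𝒜 (h + k)
  exists_family : ∃ (I : Type u) (e : I → A), IsDistinguishedFamily 𝒜 e

/-- Every element of a graded algebra with enough idempotents has a local left unit. -/
theorem exists_left_unit (𝒜 : H → Submodule K A) [GradedAlgebraEI 𝒜] (s : Finset A) :
    ∃ f : A, ∀ a ∈ s, f * a = a := by
  classical
  obtain ⟨I, e, he⟩ := GradedAlgebraEI.exists_family (𝒜 := 𝒜)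
  have hfin : ∀ F : Finset I, ∀ i ∈ F, ∀ x : A, (∑ j ∈ F, e j) * (e i * x) = e i * x := by
    intro F i hi x
    rw [← mul_assoc, Finset.sum_mul, Finset.sum_eq_single i, (he.idem i).eq]
    · intro j _ hj
      exact he.ortho j i hj
    · exact fun h => absurd hi h
  have hone : ∀ a : A, ∃ F : Finset I, ∀ F', F ⊆ F' → (∑ j ∈ F', e j) * a = a := by
    intro a
    have ha : a ∈ ⨆ i, LinearMap.range (LinearMap.mulLeft K (e i)) := by
      rw [iSup_eq_top_of_isInternal he.internal_right]; trivial
    induction ha using Submodule.iSup_induction' with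
    | mem i x hx =>
      obtain ⟨y, rfl⟩ := hx
      exact ⟨{i}, fun F' hF' => hfin F' i (hF' (by simp)) y⟩
    | zero => exact ⟨∅, fun _ _ => mul_zero _⟩
    | add x y _ _ hx hy =>
      obtain ⟨F, hF⟩ := hx
      obtain ⟨F₂, hF₂⟩ := hy
      refine ⟨F ∪ F₂, fun F' h => ?_⟩
      rw [mul_add, hF F' (Finset.union_subset_left h), hF₂ F' (Finset.union_subset_right h)]
  choose F hF using hone
  exact ⟨∑ j ∈ s.biUnion F, e j, fun a ha => hF a _ (Finset.subset_biUnion_of_mem F ha)⟩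

/-! ### The opposite algebra

A right `A`-module is a left module over the opposite algebra, so all notions below are
defined on the left, and the right-hand versions are those of the opposite algebra. As `H` is
abelian, the opposite algebra is `H`-graded by the same homogeneous components. -/

instance : IsScalarTower K Aᵐᵒᵖ Aᵐᵒᵖ :=
  ⟨fun c x y => MulOpposite.unop_injective (mul_smul_comm c y.unop x.unop)⟩

instance : SMulCommClass K Aᵐᵒᵖ Aᵐᵒᵖ :=
  ⟨fun c x y => MulOpposite.unop_injective (smul_mul_assoc c y.unop x.unop).symm⟩

/-- The grading of the opposite algebra. -/
def opGr (𝒜 : H → Submodule K A) : H → Submodule K Aᵐᵒᵖ := fun h =>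
  (𝒜 h).map (MulOpposite.opLinearEquiv K).toLinearMap

theorem op_mem_opGr {𝒜 : H → Submodule K A} {h : H} {a : A} (ha : a ∈ 𝒜 h) :
    MulOpposite.op a ∈ opGr 𝒜 h := ⟨a, ha, rfl⟩

theorem IsDistinguishedFamily.op {𝒜 : H → Submodule K A} {e : I → A}
    (he : IsDistinguishedFamily 𝒜 e) :
    IsDistinguishedFamily (opGr 𝒜) (fun i => MulOpposite.op (e i)) where
  ne_zero i := by simpa using he.ne_zero i
  idem i := congrArg MulOpposite.op (he.idem i)
  ortho i j h := congrArg MulOpposite.op (he.ortho j i h.symm)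
  deg_zero i := op_mem_opGr (he.deg_zero i)
  internal_left := by
    have h := isInternal_map_equiv he.internal_right (MulOpposite.opLinearEquiv K)
    suffices hG : (fun i => LinearMap.range (LinearMap.mulRight K (MulOpposite.op (e i)))) =
        fun i => (LinearMap.range (LinearMap.mulLeft K (e i))).map
          (MulOpposite.opLinearEquiv K).toLinearMap by
      rw [hG]
      exact h
    funext i
    ext x
    constructor
    · rintro ⟨y, rfl⟩
      exact ⟨e i * y.unop, ⟨y.unop, rfl⟩, rfl⟩
    · rintro ⟨_, ⟨y, rfl⟩, rfl⟩
      exact ⟨MulOpposite.op y, rfl⟩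
  internal_right := by
    have h := isInternal_map_equiv he.internal_left (MulOpposite.opLinearEquiv K)
    suffices hG : (fun i => LinearMap.range (LinearMap.mulLeft K (MulOpposite.op (e i)))) =
        fun i => (LinearMap.range (LinearMap.mulRight K (e i))).map
          (MulOpposite.opLinearEquiv K).toLinearMap by
      rw [hG]
      exact h
    funext i
    ext x
    constructor
    · rintro ⟨y, rfl⟩
      exact ⟨y.unop * e i, ⟨y.unop, rfl⟩, rfl⟩
    · rintro ⟨_, ⟨y, rfl⟩, rfl⟩
      exact ⟨MulOpposite.op y, rfl⟩

instance (𝒜 : H → Submodule K A) [GradedAlgebraEI 𝒜] : GradedAlgebraEI (opGr 𝒜) where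
  internal := isInternal_map_equiv (GradedAlgebraEI.internal (𝒜 := 𝒜)) (MulOpposite.opLinearEquiv K)
  mul_mem := by
    rintro h k _ _ ⟨a, ha, rfl⟩ ⟨b, hb, rfl⟩
    exact ⟨b * a, add_comm k h ▸ GradedAlgebraEI.mul_mem hb ha, rfl⟩
  exists_family := by
    obtain ⟨I, e, he⟩ := GradedAlgebraEI.exists_family (𝒜 := 𝒜)
    exact ⟨I, _, he.op⟩

/-! ### The category of graded modules -/

/-- A unital graded left `A`-module `M = ⨁ h, M_h`; unital means `A M = M`. -/
structure GrMod (𝒜 : H → Submodule K A) where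
  carrier : Type u
  [addCommGroup : AddCommGroup carrier]
  [module : Module K carrier]
  /-- the multiplication `A × M → M` -/
  act : A →ₗ[K] carrier →ₗ[K] carrier
  mul_act : ∀ (a b : A) (m : carrier), act (a * b) m = act a (act b m)
  unital : Submodule.span K {x | ∃ (a : A) (m : carrier), act a m = x} = ⊤
  /-- the homogeneous components -/
  gr : H → Submodule K carrier
  internal : IsDirectSum gr
  act_mem : ∀ {h k : H} {a : A} {m : carrier}, a ∈ 𝒜 h → m ∈ gr k → act a m ∈ gr (h + k)

attribute [instance] GrMod.addCommGroup GrMod.module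

namespace GrMod

variable {𝒜 : H → Submodule K A}

/-- Morphisms of `A-Gr`: homomorphisms of `A`-modules, homogeneous of degree `0`. -/
@[ext]
structure Hom (M N : GrMod 𝒜) where
  toLin : M.carrier →ₗ[K] N.carrier
  map_act : ∀ (a : A) (m : M.carrier), toLin (M.act a m) = N.act a (toLin m)
  map_gr : ∀ (h : H), ∀ m ∈ M.gr h, toLin m ∈ N.gr h

/-- The category `A-Gr`. For right modules, `Gr-A` is `GrMod (opGr 𝒜)`. -/
instance : Category.{u} (GrMod 𝒜) where
  Hom := Hom
  id M := ⟨LinearMap.id, fun _ _ => rfl, fun _ _ hm => hm⟩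
  comp f g := ⟨g.toLin ∘ₗ f.toLin, fun a m => by simp [f.map_act, g.map_act],
    fun h m hm => g.map_gr h _ (f.map_gr h m hm)⟩

theorem exists_act_eq [GradedAlgebraEI 𝒜] (M : GrMod 𝒜) (m : M.carrier) : ∃ f : A, M.act f m = m := by
  classical
  suffices h : ∃ s : Finset A, ∀ f : A, (∀ a ∈ s, f * a = a) → M.act f m = m by
    obtain ⟨s, hs⟩ := h
    obtain ⟨f, hf⟩ := exists_left_unit 𝒜 s
    exact ⟨f, hs f hf⟩
  have hm : m ∈ Submodule.span K {x | ∃ (a : A) (m : M.carrier), M.act a m = x} := by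
    rw [M.unital]; trivial
  induction hm using Submodule.span_induction with
  | mem x hx =>
    obtain ⟨a, y, rfl⟩ := hx
    exact ⟨{a}, fun f hf => by rw [← M.mul_act, hf a (by simp)]⟩
  | zero => exact ⟨∅, fun _ _ => map_zero _⟩
  | add x y _ _ hx hy =>
    obtain ⟨s, hs⟩ := hx
    obtain ⟨t, ht⟩ := hy
    refine ⟨s ∪ t, fun f hf => ?_⟩
    rw [map_add, hs f fun a ha => hf a (Finset.mem_union_left _ ha),
      ht f fun a ha => hf a (Finset.mem_union_right _ ha)]
  | smul c x _ hx =>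
    obtain ⟨s, hs⟩ := hx
    exact ⟨s, fun f hf => by rw [map_smul, hs f hf]⟩

/-- The shifted module `M[k]`, with `M[k]_h = M_{k+h}`. -/
def shift (M : GrMod 𝒜) (k : H) : GrMod 𝒜 where
  carrier := M.carrier
  act := M.act
  mul_act := M.mul_act
  unital := M.unital
  gr h := M.gr (k + h)
  internal := by
    refine isInternal_of_proj (fun h => proj M.internal (k + h)) ?_ ?_ ?_
    · exact fun i x hx => proj_same _ hx
    · exact fun i j hij x hx => proj_ne M.internal (fun h => hij (add_left_cancel h)) hx
    · intro x
      have hx : x ∈ ⨆ h, M.gr h := by rw [iSup_eq_top_of_isInternal M.internal]; trivial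
      have hle : (⨆ h, M.gr h) ≤ ⨆ h, M.gr (k + h) := iSup_le fun h => by
        have := le_iSup (fun h => M.gr (k + h)) (-k + h)
        simpa using this
      exact hle hx
  act_mem := by
    intro h l a m ha hm
    have := M.act_mem ha hm
    rwa [add_left_comm] at this

/-- A graded submodule of `M`: a submodule containing the homogeneous components of each of
its elements. -/
@[ext]
structure GrSub (M : GrMod 𝒜) where
  sub : Submodule K M.carrier
  act_mem : ∀ (a : A), ∀ m ∈ sub, M.act a m ∈ sub
  homogeneous : ∀ m ∈ sub, ∀ h : H, proj M.internal h m ∈ sub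

instance (M : GrMod 𝒜) : PartialOrder (GrSub M) :=
  PartialOrder.lift GrSub.sub fun _ _ h => GrSub.ext h

/-- A graded submodule as an object of `A-Gr`. -/
def GrSub.toGrMod [GradedAlgebraEI 𝒜] {M : GrMod 𝒜} (N : GrSub M) : GrMod 𝒜 where
  carrier := N.sub
  act := LinearMap.mk₂ K (fun a m => (⟨M.act a m, N.act_mem a m m.2⟩ : N.sub))
    (fun a b m => Subtype.ext (by simp)) (fun c a m => Subtype.ext (by simp))
    (fun a m m' => Subtype.ext (by simp)) (fun c a m => Subtype.ext (by simp))
  mul_act a b m := Subtype.ext (M.mul_act a b m)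
  unital := by
    refine eq_top_iff.2 fun m _ => Submodule.subset_span ?_
    obtain ⟨f, hf⟩ := M.exists_act_eq (m : M.carrier)
    exact ⟨f, m, Subtype.ext hf⟩
  gr h := (M.gr h).comap N.sub.subtype
  internal := by
    refine isInternal_of_proj
      (fun h => (proj M.internal h).restrict fun m hm => N.homogeneous m hm h) ?_ ?_ ?_
    · exact fun i x hx => Subtype.ext (proj_same M.internal hx)
    · exact fun i j hij x hx => Subtype.ext (proj_ne M.internal hij hx)
    · intro x
      have hx := mem_iSup_of_proj_mem M.internal N.sub N.homogeneous x.2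
      have hle : (⨆ h, N.sub ⊓ M.gr h) ≤
          (⨆ h, (M.gr h).comap N.sub.subtype).map N.sub.subtype := by
        refine iSup_le fun h y hy => ?_
        exact ⟨⟨y, hy.1⟩, Submodule.mem_iSup_of_mem h hy.2, rfl⟩
      obtain ⟨y, hy, hyx⟩ := hle hx
      have : y = x := Subtype.ext hyx
      exact this ▸ hy
  act_mem := fun ha hm => M.act_mem ha hm

/-- The quotient `M / N` as an object of `A-Gr`. -/
def quot (M : GrMod 𝒜) (N : GrSub M) : GrMod 𝒜 where
  carrier := M.carrier ⧸ N.sub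
  act := LinearMap.mk₂ K
    (fun a x => N.sub.mapQ N.sub (M.act a) (fun m hm => N.act_mem a m hm) x)
    (fun a b x => by obtain ⟨m, rfl⟩ := N.sub.mkQ_surjective x; simp)
    (fun c a x => by obtain ⟨m, rfl⟩ := N.sub.mkQ_surjective x; simp)
    (fun a x y => by simp) (fun c a x => by simp)
  mul_act a b x := by
    obtain ⟨m, rfl⟩ := N.sub.mkQ_surjective x
    simp [M.mul_act]
  unital := by
    refine eq_top_iff.2 fun x _ => ?_
    obtain ⟨m, rfl⟩ := N.sub.mkQ_surjective x
    have hm : m ∈ Submodule.span K {x | ∃ (a : A) (m : M.carrier), M.act a m = x} := by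
      rw [M.unital]; trivial
    have := Submodule.mem_map_of_mem (f := N.sub.mkQ) hm
    rw [Submodule.map_span] at this
    refine Submodule.span_mono ?_ this
    rintro _ ⟨_, ⟨a, y, rfl⟩, rfl⟩
    exact ⟨a, N.sub.mkQ y, by simp⟩
  gr h := (M.gr h).map N.sub.mkQ
  internal := by
    refine isInternal_of_proj
      (fun h => N.sub.mapQ N.sub (proj M.internal h) fun m hm => N.homogeneous m hm h) ?_ ?_ ?_
    · rintro i _ ⟨x, hx, rfl⟩
      simp [proj_same M.internal hx]
    · rintro i j hij _ ⟨x, hx, rfl⟩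
      simp [proj_ne M.internal hij hx]
    · intro x
      obtain ⟨m, rfl⟩ := N.sub.mkQ_surjective x
      rw [← Submodule.map_iSup, iSup_eq_top_of_isInternal M.internal]
      exact ⟨m, trivial, rfl⟩
  act_mem := by
    rintro h k a _ ha ⟨m, hm, rfl⟩
    exact ⟨M.act a m, M.act_mem ha hm, by simp⟩

/-- `M` is graded-simple: nonzero, without graded submodules other than `0` and `M`. -/
def IsGrSimple (M : GrMod 𝒜) : Prop :=
  Nontrivial M.carrier ∧ ∀ N : GrSub M, N.sub = ⊥ ∨ N.sub = ⊤

/-- A sum of graded submodules. -/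
def GrSub.iSup {M : GrMod 𝒜} {ι : Type*} (N : ι → GrSub M) : GrSub M where
  sub := ⨆ i, (N i).sub
  act_mem a m hm := by
    have : (⨆ i, (N i).sub) ≤ (⨆ i, (N i).sub).comap (M.act a) :=
      iSup_le fun i x hx => Submodule.mem_iSup_of_mem i ((N i).act_mem a x hx)
    exact this hm
  homogeneous m hm h := by
    have : (⨆ i, (N i).sub) ≤ (⨆ i, (N i).sub).comap (proj M.internal h) :=
      iSup_le fun i x hx => Submodule.mem_iSup_of_mem i ((N i).homogeneous x hx h)
    exact this hm

/-- An intersection of graded submodules. -/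
def GrSub.iInf {M : GrMod 𝒜} {ι : Type*} (N : ι → GrSub M) : GrSub M where
  sub := ⨅ i, (N i).sub
  act_mem a m hm := by
    rw [Submodule.mem_iInf] at hm ⊢
    exact fun i => (N i).act_mem a m (hm i)
  homogeneous m hm h := by
    rw [Submodule.mem_iInf] at hm ⊢
    exact fun i => (N i).homogeneous m (hm i) h

/-- The graded socle: the sum of all graded-simple graded submodules. -/
def socle [GradedAlgebraEI 𝒜] (M : GrMod 𝒜) : GrSub M :=
  GrSub.iSup fun S : {S : GrSub M // S.toGrMod.IsGrSimple} => S.1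

/-- `N` is essential as a graded submodule of `M`. -/
def GrSub.IsEssential {M : GrMod 𝒜} (N : GrSub M) : Prop :=
  ∀ L : GrSub M, L.sub ≠ ⊥ → L.sub ⊓ N.sub ≠ ⊥

/-- A maximal graded submodule. -/
def GrSub.IsMaximal {M : GrMod 𝒜} (N : GrSub M) : Prop :=
  N.sub ≠ ⊤ ∧ ∀ L : GrSub M, N.sub < L.sub → L.sub = ⊤

/-- `M` is a finitely generated `A`-module. -/
def IsFG (M : GrMod 𝒜) : Prop :=
  ∃ s : Finset M.carrier, ∀ N : Submodule K M.carrier,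
    (∀ (a : A), ∀ m ∈ N, M.act a m ∈ N) → (s : Set M.carrier) ⊆ N → N = ⊤

/-- `M` is finitely cogenerated: its graded socle is finitely generated and essential. -/
def IsFCog [GradedAlgebraEI 𝒜] (M : GrMod 𝒜) : Prop :=
  M.socle.toGrMod.IsFG ∧ M.socle.IsEssential

end GrMod

/-! ### Regular and indecomposable projective modules, the graded Jacobson radical -/

/-- `A` as a graded left module over itself. -/
def regular (𝒜 : H → Submodule K A) [GradedAlgebraEI 𝒜] : GrMod 𝒜 where
  carrier := A
  act := LinearMap.mul K A
  mul_act a b m := by simp [mul_assoc]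
  unital := by
    refine eq_top_iff.2 fun a _ => Submodule.subset_span ?_
    obtain ⟨f, hf⟩ := exists_left_unit 𝒜 {a}
    exact ⟨f, a, hf a (by simp)⟩
  gr := 𝒜
  internal := GradedAlgebraEI.internal
  act_mem := GradedAlgebraEI.mul_mem

/-- The subspace of `A` underlying a graded left ideal. -/
def ideal {𝒜 : H → Submodule K A} [GradedAlgebraEI 𝒜] (L : (regular 𝒜).GrSub) :
    Submodule K A := L.sub

/-- For a graded left ideal `L` and `x` homogeneous of degree `0`, the graded left ideal `L x`. -/
def mulRightSub {𝒜 : H → Submodule K A} [GradedAlgebraEI 𝒜] (L : (regular 𝒜).GrSub)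
    (x : A) (hx : x ∈ 𝒜 0) : (regular 𝒜).GrSub where
  sub := ((ideal L).map (LinearMap.mulRight K x) : Submodule K A)
  act_mem := by
    rintro a _ ⟨y, hy, rfl⟩
    exact ⟨a * y, L.act_mem a y hy, mul_assoc a y x⟩
  homogeneous := by
    rintro _ ⟨y, hy, rfl⟩ h
    have hc : proj (GradedAlgebraEI.internal (𝒜 := 𝒜)) h (LinearMap.mulRight K x y) =
        LinearMap.mulRight K x (proj (GradedAlgebraEI.internal (𝒜 := 𝒜)) h y) := by
      refine proj_comm _ _ (LinearMap.mulRight K x) ?_ h y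
      intro i z hz
      have := GradedAlgebraEI.mul_mem (𝒜 := 𝒜) hz hx
      rwa [add_zero] at this
    exact ⟨_, L.homogeneous y hy h, hc.symm⟩

/-- The graded left ideal `A`. -/
def topSub (𝒜 : H → Submodule K A) [GradedAlgebraEI 𝒜] : (regular 𝒜).GrSub where
  sub := ⊤
  act_mem _ _ _ := trivial
  homogeneous _ _ _ := trivial

/-- The graded Jacobson radical: the intersection of all maximal graded left ideals. It is also
the intersection of all maximal graded right ideals, i.e. it agrees with `grJacobson (opGr 𝒜)`. -/
def grJacobson (𝒜 : H → Submodule K A) [GradedAlgebraEI 𝒜] : (regular 𝒜).GrSub :=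
  GrMod.GrSub.iInf fun L : {L : (regular 𝒜).GrSub // L.IsMaximal} => L.1

/-- The graded left module `A e_i`. -/
def Ae {𝒜 : H → Submodule K A} [GradedAlgebraEI 𝒜] {e : I → A} (he : IsDistinguishedFamily 𝒜 e)
    (i : I) : GrMod 𝒜 :=
  (mulRightSub (topSub 𝒜) (e i) (he.deg_zero i)).toGrMod

/-- `J^{gr}(A) e_i` as a graded submodule of `A e_i`. -/
def Je {𝒜 : H → Submodule K A} [GradedAlgebraEI 𝒜] {e : I → A} (he : IsDistinguishedFamily 𝒜 e)
    (i : I) : (Ae he i).GrSub where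
  sub := (mulRightSub (grJacobson 𝒜) (e i) (he.deg_zero i)).sub.comap
    (mulRightSub (topSub 𝒜) (e i) (he.deg_zero i)).sub.subtype
  act_mem a m hm := (mulRightSub (grJacobson 𝒜) (e i) (he.deg_zero i)).act_mem a _ hm
  homogeneous m hm h := by
    have h1 := (mulRightSub (grJacobson 𝒜) (e i) (he.deg_zero i)).homogeneous _ hm h
    have h2 := proj_comm (Ae he i).internal (regular 𝒜).internal
      (mulRightSub (topSub 𝒜) (e i) (he.deg_zero i)).sub.subtype (fun _ _ hx => hx) h m
    rw [h2] at h1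
    exact h1

/-- The subring `A_0` of the elements of degree `0`. -/
def degZero (𝒜 : H → Submodule K A) [GradedAlgebraEI 𝒜] : NonUnitalSubring A where
  carrier := 𝒜 0
  add_mem' := (𝒜 0).add_mem
  zero_mem' := (𝒜 0).zero_mem
  neg_mem' := (𝒜 0).neg_mem
  mul_mem' ha hb := by
    have := GradedAlgebraEI.mul_mem (𝒜 := 𝒜) ha hb
    rwa [add_zero] at this

theorem IsDistinguishedFamily.idem_degZero {𝒜 : H → Submodule K A} [GradedAlgebraEI 𝒜] {e : I → A}
    (he : IsDistinguishedFamily 𝒜 e) (i : I) :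
    IsIdempotentElem (⟨e i, he.deg_zero i⟩ : degZero 𝒜) := Subtype.ext (he.idem i)

/-- `(e i)` is a weakly basic distinguished family of the locally finite dimensional algebra `A`:
all `e_i A_h e_j` are finite dimensional, each ring `e_i A_0 e_i` is local, and
`e_i A e_j ⊆ J^{gr}(A)` for `i ≠ j`. -/
structure IsWeaklyBasicFamily (𝒜 : H → Submodule K A) [GradedAlgebraEI 𝒜] (e : I → A) : Prop
    extends IsDistinguishedFamily 𝒜 e where
  locally_fd : ∀ (i j : I) (h : H), FiniteDimensional K
    ((𝒜 h).map (LinearMap.mulLeft K (e i) ∘ₗ LinearMap.mulRight K (e j)))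
  isLocal : ∀ i, IsLocalRing (toIsDistinguishedFamily.idem_degZero i).Corner
  mem_jacobson : ∀ i j, i ≠ j → ∀ a : A, e i * a * e j ∈ ideal (grJacobson 𝒜)

/-! ### The conditions of the theorem -/

/-- `A` is left locally Noetherian: each `A e_i` satisfies ACC on graded submodules. -/
def IsLeftLocallyNoetherian {𝒜 : H → Submodule K A} [GradedAlgebraEI 𝒜] {e : I → A}
    (he : IsDistinguishedFamily 𝒜 e) : Prop :=
  ∀ i, WellFoundedGT (Ae he i).GrSub

/-- `A` is (left and right) locally Noetherian. -/
def IsLocallyNoetherian {𝒜 : H → Submodule K A} [GradedAlgebraEI 𝒜] {e : I → A}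
    (he : IsDistinguishedFamily 𝒜 e) : Prop :=
  IsLeftLocallyNoetherian he ∧ IsLeftLocallyNoetherian he.op

/-- Each `A e_i` has a simple essential graded socle. -/
def HasSimpleEssentialSocles {𝒜 : H → Submodule K A} [GradedAlgebraEI 𝒜] {e : I → A}
    (he : IsDistinguishedFamily 𝒜 e) : Prop :=
  ∀ i, (Ae he i).socle.toGrMod.IsGrSimple ∧ (Ae he i).socle.IsEssential

/-- There is a bijection `ν` of `I` such that `Soc_gr (A e_i)` is isomorphic in `A-Gr` to a shift
of `A e_{ν i} / J^{gr}(A) e_{ν i}`, for each `i`. -/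
def HasSoclePermutation {𝒜 : H → Submodule K A} [GradedAlgebraEI 𝒜] {e : I → A}
    (he : IsDistinguishedFamily 𝒜 e) : Prop :=
  ∃ ν : Equiv.Perm I, ∀ i, ∃ h : H,
    Nonempty ((Ae he i).socle.toGrMod ≅ ((Ae he (ν i)).quot (Je he (ν i))).shift h)

/-- An (abelian) category is Frobenius: it has enough projectives and enough injectives, and
the projective and the injective objects are the same. -/
def IsFrobeniusCategory (C : Type*) [Category C] : Prop :=
  EnoughProjectives C ∧ EnoughInjectives C ∧ ∀ X : C, Projective X ↔ Injective X

/-- `A` is graded Quasi-Frobenius: `A-Gr` and `Gr-A` are Frobenius categories. -/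
def IsGradedQuasiFrobenius (𝒜 : H → Submodule K A) : Prop :=
  IsFrobeniusCategory (GrMod 𝒜) ∧ IsFrobeniusCategory (GrMod (opGr 𝒜))

/-- `A` is graded pseudo-Frobenius: in `A-Gr` and in `Gr-A` the finitely generated projective
objects are exactly the finitely cogenerated injective objects. -/
def IsGradedPseudoFrobenius (𝒜 : H → Submodule K A) [GradedAlgebraEI 𝒜] : Prop :=
  (∀ M : GrMod 𝒜, (Projective M ∧ M.IsFG) ↔ (Injective M ∧ M.IsFCog)) ∧
  (∀ M : GrMod (opGr 𝒜), (Projective M ∧ M.IsFG) ↔ (Injective M ∧ M.IsFCog))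

/-- The restriction to `V × W` of the bilinear form `B` is graded of degree `d`. -/
def IsFormOfDegree (𝒜 : H → Submodule K A) (B : A →ₗ[K] A →ₗ[K] K) (V W : Submodule K A)
    (d : H) : Prop :=
  ∀ s t : H, ∀ a ∈ V ⊓ 𝒜 s, ∀ b ∈ W ⊓ 𝒜 t, B a b ≠ 0 → s + t = d

/-- A linear form on the graded space `V = ⨁ h, V ∩ A_h` belongs to the graded dual
`D(V) = ⨁ h, Hom_K(V_h, K)`: it vanishes on all but finitely many homogeneous components. -/
def InGradedDual (𝒜 : H → Submodule K A) (V : Submodule K A) (f : V →ₗ[K] K) : Prop :=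
  {h : H | ∃ v : V, (v : A) ∈ 𝒜 h ∧ f v ≠ 0}.Finite

/-- The restriction to `V × W` of the bilinear form `B` is nondegenerate: it induces bijections
`W → D(V)`, `w ↦ B(-, w)`, and `V → D(W)`, `v ↦ B(v, -)`. -/
def IsNondegenerateOn (𝒜 : H → Submodule K A) (B : A →ₗ[K] A →ₗ[K] K)
    (V W : Submodule K A) : Prop :=
  Set.BijOn (fun w : W => (B.flip (w : A)).domRestrict V) Set.univ {f | InGradedDual 𝒜 V f} ∧
  Set.BijOn (fun v : V => (B (v : A)).domRestrict W) Set.univ {f | InGradedDual 𝒜 W f}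

/-- The subspace `e_i A e_j`. -/
def Peirce (K : Type*) [Field K] {A : Type*} [NonUnitalRing A] [Module K A] [IsScalarTower K A A]
    [SMulCommClass K A A] {I : Type*} (e : I → A) (i j : I) : Submodule K A :=
  LinearMap.range (LinearMap.mulLeft K (e i) ∘ₗ LinearMap.mulRight K (e j))

/-- `B` is a graded Nakayama form with Nakayama permutation `ν` and degree map `d`. -/
structure IsGradedNakayamaForm (𝒜 : H → Submodule K A) (e : I → A) (B : A →ₗ[K] A →ₗ[K] K)
    (ν : Equiv.Perm I) (d : I → H) : Prop where
  assoc : ∀ a b c, B (a * b) c = B a (b * c)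
  perm : ∀ i j, (∃ a b, B (e i * a) (b * e j) ≠ 0) ↔ j = ν i
  degree : ∀ i j, IsFormOfDegree 𝒜 B (Peirce K e i j) (Peirce K e j (ν i)) (d i)
  nondeg : ∀ i j, IsNondegenerateOn 𝒜 B (Peirce K e i j) (Peirce K e j (ν i))

/-- `A` admits a graded Nakayama form. -/
def HasGradedNakayamaForm (𝒜 : H → Submodule K A) (e : I → A) : Prop :=
  ∃ (B : A →ₗ[K] A →ₗ[K] K) (ν : Equiv.Perm I) (d : I → H), IsGradedNakayamaForm 𝒜 e B ν d

end Algebra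

end GrAlg

set_option linter.unusedSectionVars false

/-! All the conditions are compared with the existence of perfect pairings. A linear form `f` on
`e_i A e_j`, homogeneous of degree `d`, is perfect (`IsPerfect`) if `(a, b) ↦ f (a * b)` is
nondegenerate between `e_i A` and `A e_j`. Since the pieces `e_i A_h e_j` are finite dimensional,
this identifies a shift of `A e_j` with the graded dual `D(e_i A)` (`IsPerfect.exists_equiv`). A
graded Nakayama form is the same as a permutation `ν` with a perfect form on each `e_i A e_{ν i}`
(`hasGradedNakayamaForm_of_perfect`, `IsGradedNakayamaForm.isPerfect`), so "locally Noetherian with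
a Nakayama form" serves as the hub of the equivalence.

Three routes lead to perfect pairings. The module `D(e_i A)` is injective, and by locality of `e_i
A_0 e_i` it has a simple essential socle (`Dmod.exists_socle`). So it is projective if `A` is
pseudo-Frobenius or Quasi-Frobenius, and being uniform it is then a shift of one `A e_j`
(`exists_perfect_of_projective`). Under the socle conditions, generators of the left and right
socles are shown to be compatible, and a linear form not vanishing on them is perfect
(`exists_perfect_of_socles`). In the Quasi-Frobenius case the chain condition follows from Bass's
argument, because direct sums of injectives are injective (`isLeftLocallyNoetherian_of_frobenius`).

Conversely, perfect pairings move the simple essential socle of `D(e_i A)` to `A e_j`, which gives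
the socle conditions. Taking orthogonals turns the ascending chain condition on one side into the
descending one on the other (`IsPerfect.isArtinian`). Then every graded module has essential socle
and embeds into a direct sum of duals (`GrMod.exists_embedding`), which is injective by Baer's
criterion and projective because each dual is a shift of some `A e_j`. Splitting such embeddings and
the free covers shows that projective and injective objects coincide, and the finiteness conditions
match as well.

To use ordinary module theory, a graded module is regarded as a module over the free algebra
`OpRing` on multiplications and degree projections: its submodules are the graded submodules, and
its linear maps are the homomorphisms of degree `0`. Right-hand statements are left-hand ones for
the opposite algebra. -/

namespace GrAlg

/-! ### Homogeneous components in a direct sum -/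

section ProjAux

variable {K : Type*} [Field K] {ι V : Type*} [AddCommGroup V] [Module K V]
  {G : ι → Submodule K V}

theorem exists_eq_sum_proj (hG : IsDirectSum G) (x : V) :
    ∃ F : Finset ι, x = ∑ i ∈ F, proj hG i x := by
  classical
  refine ⟨(hG.equiv.symm x).support, ?_⟩
  have h1 : hG.equiv (hG.equiv.symm x) =
      DFinsupp.sum (hG.equiv.symm x) fun i => (fun x : G i => (x : V)) :=
    DirectSum.coeLinearMap_eq_dfinsuppSum G _
  rw [LinearEquiv.apply_symm_apply] at h1
  exact h1

theorem eq_zero_of_proj (hG : IsDirectSum G) {x : V} (h : ∀ i, proj hG i x = 0) : x = 0 := by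
  obtain ⟨F, hF⟩ := exists_eq_sum_proj hG x
  rw [hF, Finset.sum_eq_zero fun i _ => h i]

theorem mem_iSup_gr (hG : IsDirectSum G) (x : V) : x ∈ ⨆ i, G i := by
  rw [iSup_eq_top_of_isInternal hG]; trivial

theorem proj_eq_of (hG : IsDirectSum G) (i : ι) (p : V →ₗ[K] V) (h1 : ∀ x ∈ G i, p x = x)
    (h0 : ∀ j, j ≠ i → ∀ x ∈ G j, p x = 0) : proj hG i = p := by
  ext x
  have hx := mem_iSup_gr hG x
  induction hx using Submodule.iSup_induction' with
  | mem j x hx =>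
    by_cases h : j = i
    · subst h
      rw [proj_same hG hx, h1 x hx]
    · rw [proj_ne hG h hx, h0 j h x hx]
  | zero => simp
  | add x y _ _ hx hy => simp only [map_add, hx, hy]

end ProjAux

/-! ### Graded modules as modules over a ring of operations -/

section Framework

variable {K H A I : Type u} [Field K] [AddCommGroup H] [NonUnitalRing A] [Module K A]
  [IsScalarTower K A A] [SMulCommClass K A A]

/-- The free algebra on the operations of a graded module: multiplication by elements of `A`
and projections onto homogeneous components. -/
abbrev OpRing (K H A : Type u) [Field K] : Type u := FreeAlgebra K (A ⊕ H)

namespace GrMod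

variable {𝒜 : H → Submodule K A}

/-- The operations of a graded module, as an algebra homomorphism. -/
noncomputable def opHom (M : GrMod 𝒜) : OpRing K H A →ₐ[K] Module.End K M.carrier :=
  FreeAlgebra.lift K (Sum.elim (fun a => M.act a) fun h => proj M.internal h)

noncomputable instance moduleOp (M : GrMod 𝒜) : Module (OpRing K H A) M.carrier :=
  Module.compHom M.carrier M.opHom.toRingHom

theorem op_smul_def (M : GrMod 𝒜) (r : OpRing K H A) (m : M.carrier) : r • m = M.opHom r m := rfl

instance towerOp (M : GrMod 𝒜) : IsScalarTower K (OpRing K H A) M.carrier :=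
  ⟨fun c r m => by simp [op_smul_def]⟩

/-- The operation of multiplication by `a`. -/
def opA (K H : Type u) {A : Type u} [Field K] (a : A) : OpRing K H A := FreeAlgebra.ι K (Sum.inl a)

/-- The operation of projection onto the component of degree `h`. -/
def opH (K A : Type u) {H : Type u} [Field K] (h : H) : OpRing K H A := FreeAlgebra.ι K (Sum.inr h)

theorem opA_smul (M : GrMod 𝒜) (a : A) (m : M.carrier) : opA K H a • m = M.act a m := by
  simp [op_smul_def, opHom, opA]

theorem opH_smul (M : GrMod 𝒜) (h : H) (m : M.carrier) :
    opH K A h • m = proj M.internal h m := by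
  simp [op_smul_def, opHom, opH]

/-- A subspace closed under multiplication by `A` and under projections is a submodule over the
ring of operations. -/
noncomputable def opSubmodule (M : GrMod 𝒜) (N : Submodule K M.carrier)
    (h1 : ∀ (a : A), ∀ m ∈ N, M.act a m ∈ N)
    (h2 : ∀ m ∈ N, ∀ h : H, proj M.internal h m ∈ N) : Submodule (OpRing K H A) M.carrier where
  carrier := N
  add_mem' := N.add_mem
  zero_mem' := N.zero_mem
  smul_mem' r m hm := by
    induction r using FreeAlgebra.induction generalizing m with
    | grade0 c => rw [algebraMap_smul]; exact N.smul_mem c hm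
    | grade1 x =>
      rcases x with a | h
      · have := opA_smul M a m
        rw [opA] at this
        rw [this]
        exact h1 a m hm
      · have := opH_smul M h m
        rw [opH] at this
        rw [this]
        exact h2 m hm h
    | mul r s hr hs => rw [mul_smul]; exact hr _ (hs _ hm)
    | add r s hr hs => rw [add_smul]; exact N.add_mem (hr _ hm) (hs _ hm)

theorem _root_.Submodule.act_mem {M : GrMod 𝒜} (N : Submodule (OpRing K H A) M.carrier) (a : A)
    {m : M.carrier} (hm : m ∈ N) : M.act a m ∈ N := by
  rw [← opA_smul]; exact N.smul_mem _ hm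

theorem _root_.Submodule.proj_mem {M : GrMod 𝒜} (N : Submodule (OpRing K H A) M.carrier) (h : H)
    {m : M.carrier} (hm : m ∈ N) : proj M.internal h m ∈ N := by
  rw [← opH_smul]; exact N.smul_mem _ hm

/-- Graded submodules are the submodules over the ring of operations. -/
noncomputable def subEquiv (M : GrMod 𝒜) : GrSub M ≃o Submodule (OpRing K H A) M.carrier where
  toFun N := M.opSubmodule N.sub N.act_mem N.homogeneous
  invFun N := ⟨N.restrictScalars K, fun a _ hm => N.act_mem a hm, fun _ hm h => N.proj_mem h hm⟩
  left_inv _ := rfl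
  right_inv _ := rfl
  map_rel_iff' := Iff.rfl

/-- A linear map compatible with the operations. -/
noncomputable def opLin {M : GrMod 𝒜} {X : Type*} [AddCommGroup X] [Module K X]
    [Module (OpRing K H A) X]
    [IsScalarTower K (OpRing K H A) X] (f : M.carrier →ₗ[K] X)
    (h1 : ∀ (a : A) m, f (M.act a m) = opA K H a • f m)
    (h2 : ∀ (h : H) m, f (proj M.internal h m) = opH K A h • f m) :
    M.carrier →ₗ[OpRing K H A] X where
  toFun := f
  map_add' := f.map_add
  map_smul' r m := by
    induction r using FreeAlgebra.induction generalizing m with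
    | grade0 c => simp only [algebraMap_smul, map_smul, RingHom.id_apply]
    | grade1 x =>
      rcases x with a | h
      · have := h1 a m
        rwa [← opA_smul] at this
      · have := h2 h m
        rwa [← opH_smul] at this
    | mul r s hr hs => rw [mul_smul, hr, hs]; exact (mul_smul _ _ _).symm
    | add r s hr hs => rw [add_smul, map_add, hr, hs]; exact (add_smul _ _ _).symm

/-- A degree preserving `A`-linear map as a map linear over the ring of operations. -/
noncomputable def linOf {M N : GrMod 𝒜} (f : M.carrier →ₗ[K] N.carrier)
    (h1 : ∀ (a : A) m, f (M.act a m) = N.act a (f m)) (h2 : ∀ h, ∀ m ∈ M.gr h, f m ∈ N.gr h) :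
    M.carrier →ₗ[OpRing K H A] N.carrier :=
  opLin f (fun a m => by rw [h1, opA_smul]) fun h m => by
    rw [opH_smul, proj_comm M.internal N.internal f h2]

theorem lin_act {M N : GrMod 𝒜} (f : M.carrier →ₗ[OpRing K H A] N.carrier) (a : A)
    (m : M.carrier) : f (M.act a m) = N.act a (f m) := by
  rw [← opA_smul, map_smul, opA_smul]

theorem lin_proj {M N : GrMod 𝒜} (f : M.carrier →ₗ[OpRing K H A] N.carrier) (h : H)
    (m : M.carrier) : f (proj M.internal h m) = proj N.internal h (f m) := by
  rw [← opH_smul, map_smul, opH_smul]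

theorem lin_gr {M N : GrMod 𝒜} (f : M.carrier →ₗ[OpRing K H A] N.carrier) {h : H}
    {m : M.carrier} (hm : m ∈ M.gr h) : f m ∈ N.gr h := by
  rw [← proj_same M.internal hm, lin_proj]
  exact GrAlg.proj_mem _ _ _

/-- The morphism of graded modules given by a map linear over the ring of operations. -/
noncomputable def homOf {M N : GrMod 𝒜} (f : M.carrier →ₗ[OpRing K H A] N.carrier) : M ⟶ N :=
  Hom.mk (f.restrictScalars K) (lin_act f) fun _ _ hm => lin_gr f hm

/-- A morphism of graded modules as a map linear over the ring of operations. -/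
noncomputable def Hom.lin {M N : GrMod 𝒜} (f : M ⟶ N) : M.carrier →ₗ[OpRing K H A] N.carrier :=
  linOf (Hom.toLin f) (Hom.map_act f) (Hom.map_gr f)

theorem hom_ext' {M N : GrMod 𝒜} {f g : M ⟶ N} (h : ∀ m, Hom.lin f m = Hom.lin g m) : f = g :=
  Hom.ext (LinearMap.ext h)

@[simp] theorem homOf_lin {M N : GrMod 𝒜} (f : M.carrier →ₗ[OpRing K H A] N.carrier) (m) :
    Hom.lin (homOf f) m = f m := rfl

@[simp] theorem comp_lin {M N L : GrMod 𝒜} (f : M ⟶ N) (g : N ⟶ L) (m : M.carrier) :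
    Hom.lin (f ≫ g) m = Hom.lin g (Hom.lin f m) := rfl

@[simp] theorem id_lin {M : GrMod 𝒜} (m : M.carrier) : Hom.lin (𝟙 M) m = m := rfl

/-- An isomorphism from a bijective map. -/
noncomputable def isoOf {M N : GrMod 𝒜} (f : M.carrier ≃ₗ[OpRing K H A] N.carrier) : M ≅ N where
  hom := homOf f.toLinearMap
  inv := homOf f.symm.toLinearMap
  hom_inv_id := hom_ext' fun m => by simp
  inv_hom_id := hom_ext' fun m => by simp

noncomputable def linEquivOf {M N : GrMod 𝒜} (f : M ≅ N) :
    M.carrier ≃ₗ[OpRing K H A] N.carrier :=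
  LinearEquiv.ofLinearMap (Hom.lin f.hom) (Hom.lin f.inv)
    (LinearMap.ext fun m => by
      rw [LinearMap.comp_apply, ← comp_lin, f.inv_hom_id]; rfl)
    (LinearMap.ext fun m => by
      rw [LinearMap.comp_apply, ← comp_lin, f.hom_inv_id]; rfl)

/-- The inclusion of a graded submodule. -/
noncomputable def GrSub.incl [GradedAlgebraEI 𝒜] {M : GrMod 𝒜} (N : GrSub M) :
    N.toGrMod.carrier →ₗ[OpRing K H A] M.carrier :=
  linOf (M := N.toGrMod) N.sub.subtype (fun _ _ => rfl) fun _ _ hm => hm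

theorem GrSub.incl_injective [GradedAlgebraEI 𝒜] {M : GrMod 𝒜} (N : GrSub M) :
    Function.Injective N.incl := Subtype.val_injective

/-- The projection onto a quotient. -/
noncomputable def quotMk (M : GrMod 𝒜) (N : GrSub M) :
    M.carrier →ₗ[OpRing K H A] (M.quot N).carrier :=
  linOf (N := M.quot N) N.sub.mkQ (fun _ _ => rfl) fun _ m hm => ⟨m, hm, rfl⟩

theorem quotMk_eq_zero (M : GrMod 𝒜) (N : GrSub M) (m : M.carrier) :
    M.quotMk N m = 0 ↔ m ∈ N.sub := Submodule.Quotient.mk_eq_zero _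

/-- The kernel is a graded submodule, and its inclusion and the zero map have the same composite
with `f`. -/
theorem injective_of_mono [GradedAlgebraEI 𝒜] {M N : GrMod 𝒜} (f : M ⟶ N) [Mono f] :
    Function.Injective (Hom.lin f) := by
  rw [← LinearMap.ker_eq_bot, eq_bot_iff]
  intro m hm
  let L := M.subEquiv.symm (LinearMap.ker (Hom.lin f))
  have : homOf L.incl ≫ f = homOf 0 ≫ f := hom_ext' fun x => by
    simp only [comp_lin, homOf_lin, LinearMap.zero_apply, map_zero]
    exact x.2
  have h2 := congrArg (fun g => Hom.lin g (⟨m, hm⟩ : L.sub)) ((cancel_mono f).1 this)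
  exact h2

theorem mono_of_injective {M N : GrMod 𝒜} (f : M ⟶ N) (hf : Function.Injective (Hom.lin f)) :
    Mono f :=
  ⟨fun g h e => hom_ext' fun x => hf (by rw [← comp_lin, ← comp_lin, e])⟩

/-- The quotient map by the image and the zero map agree after `f`. -/
theorem surjective_of_epi {M N : GrMod 𝒜} (f : M ⟶ N) [Epi f] :
    Function.Surjective (Hom.lin f) := by
  intro y
  let L := N.subEquiv.symm (LinearMap.range (Hom.lin f))
  have : f ≫ homOf (N.quotMk L) = f ≫ homOf 0 := hom_ext' fun x => by
    simp only [comp_lin, homOf_lin, LinearMap.zero_apply]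
    exact (quotMk_eq_zero _ _ _).2 ⟨x, rfl⟩
  have h2 := congrArg (fun g => Hom.lin g y) ((cancel_epi f).1 this)
  exact (quotMk_eq_zero _ _ _).1 h2

theorem epi_of_surjective {M N : GrMod 𝒜} (f : M ⟶ N) (hf : Function.Surjective (Hom.lin f)) :
    Epi f :=
  ⟨fun g h e => hom_ext' fun x => by
    obtain ⟨y, rfl⟩ := hf x
    rw [← comp_lin, ← comp_lin, e]⟩

/-- Together with `projective_iff`, this removes the category theory: lifting problems are solved
with linear maps over the ring of operations. -/
theorem injective_iff [GradedAlgebraEI 𝒜] (E : GrMod 𝒜) : Injective E ↔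
    ∀ (X Y : GrMod 𝒜) (f : X.carrier →ₗ[OpRing K H A] Y.carrier)
      (g : X.carrier →ₗ[OpRing K H A] E.carrier), Function.Injective f →
      ∃ k : Y.carrier →ₗ[OpRing K H A] E.carrier, ∀ x, k (f x) = g x := by
  constructor
  · intro hE X Y f g hf
    have : Mono (homOf f) := mono_of_injective _ hf
    obtain ⟨k, hk⟩ := hE.factors (homOf g) (homOf f)
    exact ⟨Hom.lin k, fun x => congrArg (fun q => Hom.lin q x) hk⟩
  · intro h
    refine ⟨fun {X Y} g f _ => ?_⟩
    obtain ⟨k, hk⟩ := h X Y (Hom.lin f) (Hom.lin g) (injective_of_mono f)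
    exact ⟨homOf k, hom_ext' hk⟩

theorem projective_iff (P : GrMod 𝒜) : Projective P ↔
    ∀ (X Y : GrMod 𝒜) (f : X.carrier →ₗ[OpRing K H A] Y.carrier)
      (g : P.carrier →ₗ[OpRing K H A] Y.carrier), Function.Surjective f →
      ∃ k : P.carrier →ₗ[OpRing K H A] X.carrier, ∀ x, f (k x) = g x := by
  constructor
  · intro hP X Y f g hf
    have : Epi (homOf f) := epi_of_surjective _ hf
    obtain ⟨k, hk⟩ := hP.factors (homOf g) (homOf f)
    exact ⟨Hom.lin k, fun x => congrArg (fun q => Hom.lin q x) hk⟩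
  · intro h
    refine ⟨fun {X Y} g f _ => ?_⟩
    obtain ⟨k, hk⟩ := h _ _ (Hom.lin f) (Hom.lin g) (surjective_of_epi f)
    exact ⟨homOf k, hom_ext' hk⟩

theorem injective_of_retract [GradedAlgebraEI 𝒜] {E M : GrMod 𝒜} (hE : Injective E)
    (s : M.carrier →ₗ[OpRing K H A] E.carrier) (r : E.carrier →ₗ[OpRing K H A] M.carrier)
    (hrs : ∀ m, r (s m) = m) : Injective M := by
  rw [injective_iff] at hE ⊢
  intro X Y f g hf
  obtain ⟨k, hk⟩ := hE X Y f (s ∘ₗ g) hf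
  exact ⟨r ∘ₗ k, fun x => by simp [hk, hrs]⟩

theorem projective_of_retract {E M : GrMod 𝒜} (hE : Projective E)
    (s : M.carrier →ₗ[OpRing K H A] E.carrier) (r : E.carrier →ₗ[OpRing K H A] M.carrier)
    (hrs : ∀ m, r (s m) = m) : Projective M := by
  rw [projective_iff] at hE ⊢
  intro X Y f g hf
  obtain ⟨k, hk⟩ := hE X Y f (g ∘ₗ r) hf
  exact ⟨k ∘ₗ s, fun x => by simp [hk, hrs]⟩

/-! ### Direct sums of graded modules -/

/-- The finitely supported families in a family of graded modules. -/
def finSupp {Λ : Type u} (M : Λ → GrMod 𝒜) : Submodule K (∀ l, (M l).carrier) where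
  carrier := {x | {l | x l ≠ 0}.Finite}
  add_mem' {x y} hx hy := (Set.Finite.union hx hy).subset fun l hl => by
    by_contra h
    simp only [Set.mem_union, Set.mem_ofPred_eq, not_or, not_not] at h
    exact hl (by simp [h.1, h.2])
  zero_mem' := by simp
  smul_mem' c x hx := Set.Finite.subset hx fun l hl h => hl (by simp [h])

open scoped Classical in
theorem single_mem_finSupp {Λ : Type u} (M : Λ → GrMod 𝒜) (l : Λ) (m : (M l).carrier) :
    Pi.single l m ∈ finSupp M :=
  (Set.finite_singleton l).subset fun l' h => by
    by_contra h'
    exact h (Pi.single_eq_of_ne (M := fun l => (M l).carrier) h' m)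

open scoped Classical in
/-- The inclusion of a summand, as a map over the ground field. -/
noncomputable def finSuppSingle {Λ : Type u} (M : Λ → GrMod 𝒜) (l : Λ) :
    (M l).carrier →ₗ[K] finSupp M :=
  (LinearMap.single K (fun l => (M l).carrier) l).codRestrict _ (single_mem_finSupp M l)

theorem finSuppSingle_same {Λ : Type u} (M : Λ → GrMod 𝒜) (l : Λ) (m : (M l).carrier) :
    (finSuppSingle M l m).1 l = m := by
  classical exact Pi.single_eq_same (M := fun l => (M l).carrier) l m

theorem finSuppSingle_ne {Λ : Type u} (M : Λ → GrMod 𝒜) {l l' : Λ} (h : l ≠ l')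
    (m : (M l).carrier) : (finSuppSingle M l m).1 l' = 0 := by
  classical exact Pi.single_eq_of_ne (M := fun l => (M l).carrier) h.symm m

theorem eq_sum_finSuppSingle {Λ : Type u} (M : Λ → GrMod 𝒜) (x : finSupp M) (F : Finset Λ)
    (hF : ∀ l, l ∉ F → x.1 l = 0) : x = ∑ l ∈ F, finSuppSingle M l (x.1 l) := by
  refine Subtype.ext (funext fun l => ?_)
  have h1 : (∑ l ∈ F, finSuppSingle M l (x.1 l)).1 l =
      ∑ l' ∈ F, (finSuppSingle M l' (x.1 l')).1 l := by
    rw [← Finset.sum_apply, Submodule.coe_sum]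
  rw [h1]
  by_cases hl : l ∈ F
  · rw [Finset.sum_eq_single l, finSuppSingle_same]
    · exact fun l' _ h => finSuppSingle_ne M h _
    · exact fun h => absurd hl h
  · rw [hF l hl, Finset.sum_eq_zero]
    exact fun l' hl' => finSuppSingle_ne M (ne_of_mem_of_not_mem hl' hl) _

theorem finSupp_mem {Λ : Type u} (M : Λ → GrMod 𝒜) (x : finSupp M)
    (N : Submodule K (finSupp M)) (hN : ∀ l m, finSuppSingle M l m ∈ N) : x ∈ N := by
  rw [eq_sum_finSuppSingle M x (Set.Finite.toFinset x.2) fun l hl => by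
    by_contra h
    exact hl ((Set.Finite.mem_toFinset x.2).2 h)]
  exact Submodule.sum_mem _ fun l _ => hN l _

theorem finSuppSingle_gr {Λ : Type u} (M : Λ → GrMod 𝒜) {l : Λ} {h : H} {m : (M l).carrier}
    (hm : m ∈ (M l).gr h) (l' : Λ) : (finSuppSingle M l m).1 l' ∈ (M l').gr h := by
  rcases eq_or_ne l l' with rfl | hl
  · rwa [finSuppSingle_same]
  · rw [finSuppSingle_ne M hl]; exact zero_mem _

/-- A family of endomorphisms acting on finitely supported families. -/
def finSuppMap {Λ : Type u} (M : Λ → GrMod 𝒜) (f : ∀ l, (M l).carrier →ₗ[K] (M l).carrier) :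
    finSupp M →ₗ[K] finSupp M where
  toFun x := ⟨fun l => f l (x.1 l), Set.Finite.subset x.2 fun l hl h => hl (by simp [h])⟩
  map_add' x y := Subtype.ext (funext fun l => (f l).map_add _ _)
  map_smul' c x := Subtype.ext (funext fun l => (f l).map_smul _ _)

theorem finSuppMap_single {Λ : Type u} (M : Λ → GrMod 𝒜)
    (f : ∀ l, (M l).carrier →ₗ[K] (M l).carrier) (l : Λ) (m : (M l).carrier) :
    finSuppMap M f (finSuppSingle M l m) = finSuppSingle M l (f l m) := by
  refine Subtype.ext (funext fun l' => ?_)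
  change f l' ((finSuppSingle M l m).1 l') = _
  rcases eq_or_ne l l' with rfl | hl
  · rw [finSuppSingle_same, finSuppSingle_same]
  · rw [finSuppSingle_ne M hl, finSuppSingle_ne M hl, map_zero]

/-- The direct sum of a family of graded modules. -/
noncomputable def dsum {Λ : Type u} (M : Λ → GrMod 𝒜) : GrMod 𝒜 where
  carrier := finSupp M
  act := LinearMap.mk₂ K
    (fun a x => finSuppMap M (fun l => (M l).act a) x)
    (fun a b x => Subtype.ext (funext fun l => by simp [finSuppMap]))
    (fun c a x => Subtype.ext (funext fun l => by simp [finSuppMap]))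
    (fun a x y => map_add _ _ _) (fun c a x => map_smul _ _ _)
  mul_act a b x := Subtype.ext (funext fun l => (M l).mul_act a b _)
  unital := by
    refine eq_top_iff.2 fun x _ => finSupp_mem M x _ fun l m => ?_
    have hm : m ∈ Submodule.span K {x | ∃ (a : A) (m : (M l).carrier), (M l).act a m = x} := by
      rw [(M l).unital]; trivial
    induction hm using Submodule.span_induction with
    | mem x hx =>
      obtain ⟨a, y, rfl⟩ := hx
      exact Submodule.subset_span ⟨a, finSuppSingle M l y, finSuppMap_single M _ l y⟩
    | zero => rw [map_zero]; exact zero_mem _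
    | add x y _ _ hx hy => rw [map_add]; exact add_mem hx hy
    | smul c x _ hx => rw [map_smul]; exact Submodule.smul_mem _ c hx
  gr h :=
    { carrier := {x | ∀ l, x.1 l ∈ (M l).gr h}
      add_mem' := fun hx hy l => add_mem (hx l) (hy l)
      zero_mem' := fun l => zero_mem _
      smul_mem' := fun c x hx l => Submodule.smul_mem _ c (hx l) }
  internal := by
    refine isInternal_of_proj (fun h => finSuppMap M fun l => proj (M l).internal h) ?_ ?_ ?_
    · exact fun h x hx => Subtype.ext (funext fun l => proj_same (M l).internal (hx l))
    · exact fun h k hk x hx => Subtype.ext (funext fun l => proj_ne (M l).internal hk (hx l))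
    · refine fun x => finSupp_mem M x _ fun l m => ?_
      have hm := mem_iSup_gr (M l).internal m
      induction hm using Submodule.iSup_induction' with
      | mem h x hx =>
        exact Submodule.mem_iSup_of_mem h (finSuppSingle_gr M hx)
      | zero => rw [map_zero]; exact zero_mem _
      | add x y _ _ hx hy => rw [map_add]; exact add_mem hx hy
  act_mem := fun ha hx l => (M l).act_mem ha (hx l)

section dsum

variable {Λ : Type u} (M : Λ → GrMod 𝒜)

/-- The inclusion of a summand. -/
noncomputable def dsumι (l : Λ) : (M l).carrier →ₗ[OpRing K H A] (dsum M).carrier :=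
  linOf (N := dsum M) (finSuppSingle M l)
    (fun a m => (finSuppMap_single M (fun l => (M l).act a) l m).symm)
    (fun _ _ hm => finSuppSingle_gr M hm)

/-- The projection onto a summand. -/
noncomputable def dsumπ (l : Λ) : (dsum M).carrier →ₗ[OpRing K H A] (M l).carrier :=
  linOf (M := dsum M) (LinearMap.proj l ∘ₗ (finSupp M).subtype)
    (fun _ _ => rfl) (fun _ _ hm => hm l)

variable {M}

theorem dsum_ext {x y : (dsum M).carrier} (h : ∀ l, dsumπ M l x = dsumπ M l y) : x = y :=
  Subtype.ext (funext h)

theorem dsumπ_ι_same (l : Λ) (m : (M l).carrier) : dsumπ M l (dsumι M l m) = m :=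
  finSuppSingle_same M l m

theorem dsumπ_ι_ne {l l' : Λ} (h : l ≠ l') (m : (M l).carrier) :
    dsumπ M l' (dsumι M l m) = 0 :=
  finSuppSingle_ne M h m

theorem finite_dsumπ_ne_zero (x : (dsum M).carrier) : {l | dsumπ M l x ≠ 0}.Finite :=
  Subtype.property (p := fun y => y ∈ finSupp M) x

/-- A map into a direct sum. -/
theorem exists_dsum_lift {X : Type*} [AddCommGroup X] [Module (OpRing K H A) X]
    (f : ∀ l, X →ₗ[OpRing K H A] (M l).carrier) (hf : ∀ x, {l | f l x ≠ 0}.Finite) :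
    ∃ g : X →ₗ[OpRing K H A] (dsum M).carrier, ∀ l x, dsumπ M l (g x) = f l x := by
  have hg : ∀ x, ∃ y : (dsum M).carrier, ∀ l, dsumπ M l y = f l x := fun x =>
    ⟨(⟨fun l => f l x, hf x⟩ : finSupp M), fun l => rfl⟩
  choose g hg using hg
  exact ⟨{ toFun := g
           map_add' := fun x y => dsum_ext fun l => by simp [hg]
           map_smul' := fun r x => dsum_ext fun l => by simp [hg] }, fun l x => hg x l⟩

theorem eq_sum_dsumι (x : (dsum M).carrier) (F : Finset Λ) (hF : ∀ l, l ∉ F → dsumπ M l x = 0) :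
    x = ∑ l ∈ F, dsumι M l (dsumπ M l x) :=
  eq_sum_finSuppSingle M x F hF

theorem exists_dsum_desc {N : GrMod 𝒜} (f : ∀ l, (M l).carrier →ₗ[OpRing K H A] N.carrier) :
    ∃ g : (dsum M).carrier →ₗ[OpRing K H A] N.carrier, ∀ l m, g (dsumι M l m) = f l m := by
  have hfin : ∀ x : (dsum M).carrier, {l | f l (dsumπ M l x) ≠ 0}.Finite := fun x =>
    (finite_dsumπ_ne_zero x).subset fun l hl h => hl (by rw [h, map_zero])
  refine ⟨{ toFun := fun x => ∑ᶠ l, f l (dsumπ M l x)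
            map_add' := fun x y => ?_
            map_smul' := fun r x => ?_ }, fun l m => ?_⟩
  · simp only [map_add]
    exact finsum_add_distrib (hfin x) (hfin y)
  · simp only [map_smul, RingHom.id_apply]
    exact (smul_finsum' r (hfin x)).symm
  · change ∑ᶠ l', f l' (dsumπ M l' (dsumι M l m)) = _
    rw [finsum_eq_single _ l, dsumπ_ι_same]
    exact fun l' h => by rw [dsumπ_ι_ne h.symm, map_zero]

theorem projective_dsum (h : ∀ l, Projective (M l)) : Projective (dsum M) := by
  rw [projective_iff]
  intro X Y f g hf
  choose k hk using fun l => (projective_iff (M l)).1 (h l) X Y f (g ∘ₗ dsumι M l) hf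
  obtain ⟨q, hq⟩ := exists_dsum_desc k
  refine ⟨q, fun x => ?_⟩
  rw [eq_sum_dsumι x (finite_dsumπ_ne_zero x).toFinset fun l hl => by simpa using hl]
  simp only [map_sum, hq, hk, LinearMap.comp_apply]

end dsum

end GrMod

end Framework

/-! ### Peirce components of algebras and modules -/

section Peirce

variable {K H A I : Type u} [Field K] [AddCommGroup H] [NonUnitalRing A] [Module K A]
  [IsScalarTower K A A] [SMulCommClass K A A] {𝒜 : H → Submodule K A} {e : I → A}

theorem GrMod.proj_act (M : GrMod 𝒜) {h k : H} {a : A} (ha : a ∈ 𝒜 h) (m : M.carrier) :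
    proj M.internal (h + k) (M.act a m) = M.act a (proj M.internal k m) := by
  have hm := mem_iSup_gr M.internal m
  induction hm using Submodule.iSup_induction' with
  | mem l m hm =>
    by_cases hl : l = k
    · subst hl
      rw [proj_same _ hm, proj_same _ (M.act_mem ha hm)]
    · rw [proj_ne _ hl hm, proj_ne _ (fun h' => hl (add_left_cancel h')) (M.act_mem ha hm),
        map_zero]
  | zero => simp
  | add x y _ _ hx hy => simp only [map_add, hx, hy]

theorem GrMod.proj_act_zero (M : GrMod 𝒜) {k : H} {a : A} (ha : a ∈ 𝒜 0) (m : M.carrier) :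
    proj M.internal k (M.act a m) = M.act a (proj M.internal k m) := by
  have := M.proj_act (k := k) ha m
  rwa [zero_add] at this

/-- The homogeneous vectors of degree `h` in `e_i M`. -/
def GrMod.pc (M : GrMod 𝒜) (e : I → A) (i : I) (h : H) : Submodule K M.carrier where
  carrier := {m | m ∈ M.gr h ∧ M.act (e i) m = m}
  add_mem' hx hy := ⟨add_mem hx.1 hy.1, by rw [map_add, hx.2, hy.2]⟩
  zero_mem' := ⟨zero_mem _, map_zero _⟩
  smul_mem' c x hx := ⟨Submodule.smul_mem _ c hx.1, by rw [map_smul, hx.2]⟩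

variable (𝒜 e) in
/-- The homogeneous elements of degree `h` in `e_i A e_j`. -/
def peirce (i j : I) (h : H) : Submodule K A where
  carrier := {x | x ∈ 𝒜 h ∧ e i * x = x ∧ x * e j = x}
  add_mem' hx hy := ⟨add_mem hx.1 hy.1, by rw [mul_add, hx.2.1, hy.2.1],
    by rw [add_mul, hx.2.2, hy.2.2]⟩
  zero_mem' := ⟨zero_mem _, mul_zero _, zero_mul _⟩
  smul_mem' c x hx := ⟨Submodule.smul_mem _ c hx.1, by rw [mul_smul_comm, hx.2.1],
    by rw [smul_mul_assoc, hx.2.2]⟩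

variable [GradedAlgebraEI 𝒜]

theorem peirce_mul {i j k : I} {h l : H} {x y : A} (hx : x ∈ peirce 𝒜 e i j h)
    (hy : y ∈ peirce 𝒜 e j k l) : x * y ∈ peirce 𝒜 e i k (h + l) :=
  ⟨GradedAlgebraEI.mul_mem hx.1 hy.1, by rw [← mul_assoc, hx.2.1], by rw [mul_assoc, hy.2.2]⟩

theorem peirce_mul' {i j k : I} {h l t : H} {x y : A} (hx : x ∈ peirce 𝒜 e i j h)
    (hy : y ∈ peirce 𝒜 e j k l) (ht : h + l = t) : x * y ∈ peirce 𝒜 e i k t :=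
  ht ▸ peirce_mul hx hy

theorem pc_act {M : GrMod 𝒜} {i j : I} {h l : H} {x : A} {m : M.carrier}
    (hx : x ∈ peirce 𝒜 e i j h) (hm : m ∈ M.gr l) : M.act x m ∈ M.pc e i (h + l) :=
  ⟨M.act_mem hx.1 hm, by rw [← M.mul_act, hx.2.1]⟩

variable (𝒜) in
/-- The projection of `A` onto the component of degree `h`. -/
noncomputable def prj (h : H) : A →ₗ[K] A := proj (GradedAlgebraEI.internal (𝒜 := 𝒜)) h

theorem prj_mem (h : H) (x : A) : prj 𝒜 h x ∈ 𝒜 h := proj_mem _ _ _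

theorem prj_same {h : H} {x : A} (hx : x ∈ 𝒜 h) : prj 𝒜 h x = x := proj_same _ hx

theorem prj_ne {h k : H} (hk : k ≠ h) {x : A} (hx : x ∈ 𝒜 k) : prj 𝒜 h x = 0 := proj_ne _ hk hx

theorem prj_mul_left {h k : H} {a : A} (ha : a ∈ 𝒜 h) (x : A) :
    prj 𝒜 (h + k) (a * x) = a * prj 𝒜 k x :=
  (regular 𝒜).proj_act ha x

theorem prj_mul_right {h k : H} {a : A} (ha : a ∈ 𝒜 h) (x : A) :
    prj 𝒜 (k + h) (x * a) = prj 𝒜 k x * a := by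
  have hm := mem_iSup_gr (GradedAlgebraEI.internal (𝒜 := 𝒜)) x
  induction hm using Submodule.iSup_induction' with
  | mem l m hm =>
    by_cases hl : l = k
    · subst hl
      rw [prj_same hm, prj_same (GradedAlgebraEI.mul_mem hm ha)]
    · rw [prj_ne hl hm, prj_ne (fun h' => hl (add_right_cancel h')) (GradedAlgebraEI.mul_mem hm ha),
        zero_mul]
  | zero => simp
  | add x y _ _ hx hy => simp only [map_add, hx, hy, add_mul]

theorem prj_mul_left_zero {k : H} {a : A} (ha : a ∈ 𝒜 0) (x : A) :
    prj 𝒜 k (a * x) = a * prj 𝒜 k x := by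
  have := prj_mul_left (k := k) ha x
  rwa [zero_add] at this

theorem prj_mul_right_zero {k : H} {a : A} (ha : a ∈ 𝒜 0) (x : A) :
    prj 𝒜 k (x * a) = prj 𝒜 k x * a := by
  have := prj_mul_right (k := k) ha x
  rwa [add_zero] at this

namespace IsDistinguishedFamily

variable (he : IsDistinguishedFamily 𝒜 e)
include he

theorem idem_mem (i : I) : e i ∈ peirce 𝒜 e i i 0 :=
  ⟨he.deg_zero i, (he.idem i).eq, (he.idem i).eq⟩

theorem mul_ne {i j k l : I} {s t : H} {x y : A} (hx : x ∈ peirce 𝒜 e i j s)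
    (hy : y ∈ peirce 𝒜 e k l t) (hjk : j ≠ k) : x * y = 0 := by
  rw [← hx.2.2, ← hy.2.1, mul_assoc, ← mul_assoc (e j), he.ortho j k hjk, zero_mul, mul_zero]

/-- The component in `e_i A_h e_j`. -/
theorem comp_mem (i j : I) (h : H) (x : A) : e i * prj 𝒜 h x * e j ∈ peirce 𝒜 e i j h := by
  refine ⟨?_, by rw [← mul_assoc, ← mul_assoc, (he.idem i).eq], by rw [mul_assoc, (he.idem j).eq]⟩
  have := GradedAlgebraEI.mul_mem (𝒜 := 𝒜)
    (GradedAlgebraEI.mul_mem (he.deg_zero i) (prj_mem (𝒜 := 𝒜) h x)) (he.deg_zero j)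
  rwa [add_zero, zero_add] at this

theorem pc_comp_mem {M : GrMod 𝒜} (i : I) (h : H) (m : M.carrier) :
    M.act (e i) (proj M.internal h m) ∈ M.pc e i h := by
  refine ⟨?_, by rw [← M.mul_act, (he.idem i).eq]⟩
  have := M.act_mem (he.deg_zero i) (proj_mem M.internal h m)
  rwa [zero_add] at this

/-- The elements of `e_i A_h e_j` span `A`. -/
theorem peirce_induction (N : Submodule K A) (hN : ∀ i j h, peirce 𝒜 e i j h ≤ N) (x : A) :
    x ∈ N := by
  have hx := mem_iSup_gr he.internal_left x
  induction hx using Submodule.iSup_induction' with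
  | zero => exact zero_mem _
  | add x y _ _ hx hy => exact add_mem hx hy
  | mem j x hx =>
    obtain ⟨y, rfl⟩ := hx
    change y * e j ∈ N
    have hy := mem_iSup_gr he.internal_right y
    induction hy using Submodule.iSup_induction' with
    | zero => rw [zero_mul]; exact zero_mem _
    | add x y _ _ hx hy => rw [add_mul]; exact add_mem hx hy
    | mem i x hx =>
      obtain ⟨y, rfl⟩ := hx
      change e i * y * e j ∈ N
      have hy := mem_iSup_gr (GradedAlgebraEI.internal (𝒜 := 𝒜)) y
      induction hy using Submodule.iSup_induction' with
      | zero => rw [mul_zero, zero_mul]; exact zero_mem _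
      | add x y _ _ hx hy => rw [mul_add, add_mul]; exact add_mem hx hy
      | mem h y hy =>
        rw [← prj_same hy]
        exact hN _ _ _ (he.comp_mem i j h y)

/-- The homogeneous elements of the `e_i M` span `M`. -/
theorem pc_induction {M : GrMod 𝒜} (N : Submodule K M.carrier) (hN : ∀ i h, M.pc e i h ≤ N)
    (m : M.carrier) : m ∈ N := by
  obtain ⟨f, hf⟩ := M.exists_act_eq m
  rw [← hf]
  clear hf
  refine he.peirce_induction (N.comap (M.act.flip m)) (fun i j h x hx => ?_) f
  change M.act x m ∈ N
  have hm := mem_iSup_gr M.internal m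
  induction hm using Submodule.iSup_induction' with
  | zero => rw [map_zero]; exact zero_mem _
  | add x y _ _ hx hy => rw [map_add]; exact add_mem hx hy
  | mem l m hm => exact hN _ _ (pc_act hx hm)

theorem eq_of_peirce {X : Type*} [AddCommGroup X] [Module K X]
    {f g : A →ₗ[K] X} (h : ∀ i j h, ∀ m ∈ peirce 𝒜 e i j h, f m = g m) : f = g :=
  LinearMap.ext fun m =>
    he.peirce_induction (LinearMap.eqLocus f g) (fun i j k m hm => h i j k m hm) m

/-- Each homogeneous component of `m` is fixed by some element of `A`. That element is a combination
of elements `x = x * e j`, and these kill the component because `e j` does. -/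
theorem eq_zero_of_comp {M : GrMod 𝒜} {m : M.carrier}
    (h : ∀ i h, M.act (e i) (proj M.internal h m) = 0) : m = 0 := by
  refine eq_zero_of_proj M.internal fun k => ?_
  obtain ⟨f, hf⟩ := M.exists_act_eq (proj M.internal k m)
  rw [← hf]
  refine he.peirce_induction (LinearMap.ker (M.act.flip (proj M.internal k m)))
    (fun i j l x hx => ?_) f
  change M.act x _ = 0
  rw [← hx.2.2, M.mul_act, h, map_zero]

/-- A nonzero graded submodule contains a nonzero homogeneous element of some `e_i M`. -/
theorem exists_pc {M : GrMod 𝒜} {N : Submodule (OpRing K H A) M.carrier} (hN : N ≠ ⊥) :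
    ∃ i h, ∃ m ∈ N, m ∈ M.pc e i h ∧ m ≠ 0 := by
  obtain ⟨m, hm, hm0⟩ := N.exists_mem_ne_zero_of_ne_bot hN
  by_contra! hc
  refine hm0 (he.eq_zero_of_comp fun i h => ?_)
  exact hc i h _ (N.act_mem _ (N.proj_mem h hm)) (he.pc_comp_mem i h m)

/-- The graded submodule generated by a homogeneous element. -/
theorem mem_span_singleton {M : GrMod 𝒜} {i : I} {h : H} {z m : M.carrier} (hz : z ∈ M.pc e i h) :
    m ∈ Submodule.span (OpRing K H A) {z} ↔ ∃ a : A, M.act a z = m := by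
  constructor
  · intro hm
    let N := M.opSubmodule (LinearMap.range (M.act.flip z))
      (by rintro a _ ⟨b, rfl⟩; exact ⟨a * b, M.mul_act a b z⟩)
      (by
        rintro _ ⟨b, rfl⟩ k
        -- As `z` has degree `h`, the component of `b z` in degree `k` comes from the component of
        -- `b` in degree `k - h`.
        refine ⟨prj 𝒜 (k - h) b, ?_⟩
        change M.act _ z = proj M.internal k (M.act b z)
        have hb := mem_iSup_gr (GradedAlgebraEI.internal (𝒜 := 𝒜)) b
        induction hb using Submodule.iSup_induction' with
        | zero => simp
        | add x y _ _ hx hy => simp only [map_add, LinearMap.add_apply, hx, hy]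
        | mem l b hb =>
          by_cases hl : l = k - h
          · subst hl
            rw [prj_same hb, proj_same]
            have := M.act_mem hb hz.1
            rwa [sub_add_cancel] at this
          · rw [prj_ne hl hb, proj_ne _ (fun h' => hl (eq_sub_of_add_eq h')) (M.act_mem hb hz.1)]
            simp)
    have hle : Submodule.span (OpRing K H A) {z} ≤ N :=
      Submodule.span_le.2 (Set.singleton_subset_iff.2 ⟨e i, hz.2⟩)
    exact hle hm
  · rintro ⟨a, rfl⟩
    exact Submodule.act_mem _ a (Submodule.mem_span_singleton_self z)

end IsDistinguishedFamily

variable (𝒜 e) in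
/-- A distinguished family for a locally finite dimensional algebra such that the rings
`e_i A_0 e_i` are local and distinct `A e_i` are not isomorphic up to shift. -/
structure IsLocalFamily : Prop extends IsDistinguishedFamily 𝒜 e where
  fd : ∀ i j h, FiniteDimensional K (peirce 𝒜 e i j h)
  loc : ∀ i, ∀ x ∈ peirce 𝒜 e i i 0, (∃ y ∈ peirce 𝒜 e i i 0, y * x = e i ∧ x * y = e i) ∨
    ∃ y ∈ peirce 𝒜 e i i 0, y * (e i - x) = e i ∧ (e i - x) * y = e i
  rad : ∀ i j h, i ≠ j → ∀ x ∈ peirce 𝒜 e i j h, ∀ y ∈ peirce 𝒜 e j i (-h), x * y ≠ e i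

/-! ### Local corners, maximal graded left ideals and the graded Jacobson radical -/

/-- Locality of the rings `e_i A_0 e_i`. -/
def HasLocalCorners (𝒜 : H → Submodule K A) (e : I → A) : Prop :=
  ∀ i, ∀ x ∈ peirce 𝒜 e i i 0, (∃ y ∈ peirce 𝒜 e i i 0, y * x = e i ∧ x * y = e i) ∨
    ∃ y ∈ peirce 𝒜 e i i 0, y * (e i - x) = e i ∧ (e i - x) * y = e i

namespace HasLocalCorners

variable (he : IsDistinguishedFamily 𝒜 e) (hl : HasLocalCorners 𝒜 e)
include he hl

/-- One of `p` and `e i - p` is invertible, and it can be cancelled in `p * p = p` or in `(e i - p)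
* p = 0`. -/
theorem eq_zero_or_one {i : I} {p : A} (hp : p ∈ peirce 𝒜 e i i 0) (hpp : p * p = p) :
    p = 0 ∨ p = e i := by
  rcases hl i p hp with ⟨q, hq, h1, -⟩ | ⟨q, hq, h1, -⟩
  · right
    rw [← hp.2.1, ← h1, mul_assoc, hpp]
  · left
    rw [← hp.2.1, ← h1, mul_assoc, sub_mul, hp.2.1, hpp, sub_self, mul_zero]

/-- The product `x * y` is idempotent, and it is nonzero because `y * (x * y) * x = e i`; a local
ring has no other idempotent than `1` to offer. -/
theorem mul_comm_one {i : I} {x y : A} (hx : x ∈ peirce 𝒜 e i i 0) (hy : y ∈ peirce 𝒜 e i i 0)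
    (hyx : y * x = e i) : x * y = e i := by
  have hp : x * y ∈ peirce 𝒜 e i i 0 := peirce_mul' hx hy (add_zero 0)
  have hpp : x * y * (x * y) = x * y := by
    rw [mul_assoc, ← mul_assoc y, hyx, hy.2.1]
  rcases hl.eq_zero_or_one he hp hpp with h | h
  · refine absurd ?_ (he.ne_zero i)
    rw [← (he.idem i).eq]
    nth_rw 1 [← hyx]
    rw [← hyx, mul_assoc, ← mul_assoc x, h, zero_mul, mul_zero]
  · exact h

/-- The maximal ideal of `e_i A_0 e_i`. -/
def nonunits (i : I) : Submodule K A where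
  carrier := {x | x ∈ peirce 𝒜 e i i 0 ∧ ∀ y ∈ peirce 𝒜 e i i 0, y * x ≠ e i}
  zero_mem' := ⟨zero_mem _, fun y _ h => he.ne_zero i (by rw [← h, mul_zero])⟩
  add_mem' := by
    rintro x x' hx hx'
    refine ⟨add_mem hx.1 hx'.1, fun y hy h => ?_⟩
    have hyx : y * x ∈ peirce 𝒜 e i i 0 := peirce_mul' hy hx.1 (add_zero 0)
    have hyx' : y * x' = e i - y * x := by rw [← h, mul_add, add_sub_cancel_left]
    -- Here `y * x` and `y * x'` add up to `e i`, so by locality one of them is invertible.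
    rcases hl i _ hyx with ⟨q, hq, h1, -⟩ | ⟨q, hq, h1, -⟩
    · exact hx.2 _ (peirce_mul' hq hy (add_zero 0)) (by rw [mul_assoc, h1])
    · exact hx'.2 _ (peirce_mul' hq hy (add_zero 0)) (by rw [mul_assoc, hyx', h1])
  smul_mem' c x hx := ⟨Submodule.smul_mem _ c hx.1, fun y hy h =>
    hx.2 (c • y) (Submodule.smul_mem _ c hy) (by rw [smul_mul_assoc, ← mul_smul_comm, h])⟩

theorem one_notMem_nonunits (i : I) : e i ∉ nonunits he hl i := fun h =>
  h.2 _ (he.idem_mem i) (he.idem i).eq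

theorem exists_inv_of_notMem {i : I} {x : A} (hx : x ∈ peirce 𝒜 e i i 0)
    (h : x ∉ nonunits he hl i) : ∃ y ∈ peirce 𝒜 e i i 0, y * x = e i := by
  by_contra! h'
  exact h ⟨hx, h'⟩

theorem exists_inv_sub {i : I} {x : A} (hx : x ∈ nonunits he hl i) :
    ∃ y ∈ peirce 𝒜 e i i 0, y * (e i - x) = e i := by
  rcases hl i x hx.1 with ⟨q, hq, h1, -⟩ | ⟨q, hq, h1, -⟩
  · exact absurd h1 (hx.2 q hq)
  · exact ⟨q, hq, h1⟩

/-- The subspace underlying the graded left ideal `maxIdeal`. -/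
noncomputable def maxIdealSub (i : I) : Submodule K A where
  carrier := {a : A | ∀ y : A, e i * prj 𝒜 0 (y * a) * e i ∈ nonunits he hl i}
  zero_mem' := fun y => by simp
  add_mem' := fun {a b} ha hb y => by
    rw [mul_add, map_add, mul_add, add_mul]
    exact add_mem (ha y) (hb y)
  smul_mem' := fun c a ha y => by
    rw [mul_smul_comm, map_smul, mul_smul_comm, smul_mul_assoc]
    exact Submodule.smul_mem _ c (ha y)

/-- The graded left ideal of the `a` such that `A a e_i` is a proper submodule of `A e_i`. -/
noncomputable def maxIdeal (i : I) : (regular 𝒜).GrSub where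
  sub := (maxIdealSub he hl i : Submodule K A)
  act_mem := by
    intro b (a : A) ha y
    change e i * prj 𝒜 0 (y * (b * a)) * e i ∈ _
    rw [← mul_assoc]
    exact ha _
  homogeneous := by
    intro (a : A) ha h y
    change e i * prj 𝒜 0 (y * prj 𝒜 h a) * e i ∈ _
    have hy := mem_iSup_gr (GradedAlgebraEI.internal (𝒜 := 𝒜)) y
    induction hy using Submodule.iSup_induction' with
    | zero => simp
    | add x y _ _ hx hy => rw [add_mul, map_add, mul_add, add_mul]; exact add_mem hx hy
    | mem t y hy =>
      by_cases ht : t + h = 0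
      · have h1 := prj_mul_left (k := h) hy a
        rw [ht] at h1
        rw [← h1, prj_same (prj_mem 0 _)]
        exact ha y
      · rw [prj_ne ht (GradedAlgebraEI.mul_mem hy (prj_mem h a))]
        simp

theorem mem_maxIdeal {i : I} {a : A} : a ∈ ideal (maxIdeal he hl i) ↔
    ∀ y : A, e i * prj 𝒜 0 (y * a) * e i ∈ nonunits he hl i := Iff.rfl

/-- The ideal contains every `a - a * e i`, so a larger `L` is everything once `e i ∈ L`. An element
outside the ideal produces a left invertible element of `e_i A_0 e_i` inside `L`. -/
theorem maxIdeal_isMaximal (i : I) : (maxIdeal he hl i).IsMaximal := by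
  constructor
  · intro h
    have : e i ∈ ideal (maxIdeal he hl i) := by rw [ideal, h]; trivial
    rw [mem_maxIdeal] at this
    have h1 := this (e i)
    rw [(he.idem i).eq, prj_same (he.deg_zero i), (he.idem i).eq, (he.idem i).eq] at h1
    exact one_notMem_nonunits he hl i h1
  · intro L hL
    obtain ⟨x, hxL, hx⟩ := Set.exists_of_ssubset hL
    change A at x
    have hx' : ¬ ∀ y : A, e i * prj 𝒜 0 (y * x) * e i ∈ nonunits he hl i := hx
    push Not at hx'
    obtain ⟨y, hy⟩ := hx'
    have hmem : ∀ a : A, a - a * e i ∈ ideal L := fun a => by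
      refine hL.1 ((mem_maxIdeal he hl).2 fun y => ?_)
      rw [mul_assoc, ← prj_mul_right_zero (he.deg_zero i), mul_assoc, sub_mul, mul_assoc,
        (he.idem i).eq, sub_self]
      simp
    have hL1 : ∀ (a : A), ∀ b ∈ ideal L, a * b ∈ ideal L := L.act_mem
    have hL2 : ∀ b ∈ ideal L, ∀ h, prj 𝒜 h b ∈ ideal L := L.homogeneous
    have hxe : x * e i ∈ ideal L := by
      have := sub_mem (show x ∈ ideal L from hxL) (hmem x)
      rwa [sub_sub_cancel] at this
    have hu : e i * prj 𝒜 0 (y * x) * e i ∈ ideal L := by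
      rw [mul_assoc, ← prj_mul_right_zero (he.deg_zero i), mul_assoc]
      exact hL1 _ _ (hL2 _ (hL1 _ _ hxe) 0)
    obtain ⟨w, hw, hwe⟩ := exists_inv_of_notMem he hl (he.comp_mem i i 0 _) hy
    have hei : e i ∈ ideal L := hwe ▸ hL1 _ _ hu
    refine eq_top_iff.2 fun a _ => ?_
    change A at a
    have := add_mem (hmem a) (hL1 a _ hei)
    rwa [sub_add_cancel] at this

theorem mem_maxIdeal_of_mem_jacobson {i : I} {a : A} (ha : a ∈ ideal (grJacobson 𝒜)) :
    a ∈ ideal (maxIdeal he hl i) :=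
  (Submodule.mem_iInf fun L : {L : (regular 𝒜).GrSub // L.IsMaximal} => L.1.sub).1 ha
    ⟨maxIdeal he hl i, maxIdeal_isMaximal he hl i⟩

/-- If a maximal `L` missed `a`, then `e i = l + m * e i` with `l ∈ L` and `m` in `maxIdeal`. The
degree `0` part of `e i * l` is then `e i` minus a nonunit, hence left invertible, so `e i ∈ L` and
`a = a * e i ∈ L`. -/
theorem mem_jacobson {i : I} {a : A} (ha : a ∈ ideal (maxIdeal he hl i)) (hae : a * e i = a) :
    a ∈ ideal (grJacobson 𝒜) := by
  refine (Submodule.mem_iInf fun L : {L : (regular 𝒜).GrSub // L.IsMaximal} => L.1.sub).2 ?_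
  rintro ⟨L, hL⟩
  by_contra haL
  let N : Submodule (OpRing K H A) (regular 𝒜).carrier := (regular 𝒜).subEquiv L ⊔
    (regular 𝒜).subEquiv (mulRightSub (maxIdeal he hl i) (e i) (he.deg_zero i))
  have haN : a ∈ (mulRightSub (maxIdeal he hl i) (e i) (he.deg_zero i)).sub := ⟨a, ha, hae⟩
  have htop := hL.2 ((regular 𝒜).subEquiv.symm N) <| by
    refine lt_of_le_of_ne (fun x hx => Submodule.mem_sup_left hx) fun h => haL ?_
    rw [h]
    exact Submodule.mem_sup_right haN
  have hei : e i ∈ ((regular 𝒜).subEquiv.symm N).sub := by rw [htop]; trivial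
  obtain ⟨l, hl', m, ⟨m, hm, rfl⟩, hlm⟩ := (Submodule.mem_sup (p := (regular 𝒜).subEquiv L)).1 hei
  change A at l
  change A at m
  have hlm : l + m * e i = e i := hlm
  have hl'' : l ∈ ideal L := hl'
  have hL1 : ∀ (a : A), ∀ b ∈ ideal L, a * b ∈ ideal L := L.act_mem
  have hL2 : ∀ b ∈ ideal L, ∀ h, prj 𝒜 h b ∈ ideal L := L.homogeneous
  have h1 : e i * prj 𝒜 0 l = e i - e i * prj 𝒜 0 (e i * m) * e i := by
    rw [eq_sub_iff_add_eq, prj_mul_left_zero (he.deg_zero i), ← mul_assoc (e i), (he.idem i).eq,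
      mul_assoc, ← prj_mul_right_zero (he.deg_zero i), ← mul_add, ← map_add, hlm,
      prj_same (he.deg_zero i), (he.idem i).eq]
  obtain ⟨w, hw, hwe⟩ := exists_inv_sub he hl ((mem_maxIdeal he hl).1 hm (e i))
  rw [← h1] at hwe
  have : e i ∈ ideal L := hwe ▸ hL1 _ _ (hL1 _ _ (hL2 _ hl'' 0))
  exact haL (by rw [← hae]; exact hL1 _ _ this)

/-- This replaces the radical by an explicit condition, so that the top `A e_i / J e_i` can be
computed through the local ring `e_i A_0 e_i`. -/
theorem mem_Je {i : I} {b : (Ae he i).carrier} :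
    b ∈ (Je he i).sub ↔ b.1 ∈ ideal (maxIdeal he hl i) := by
  obtain ⟨_, b, -, rfl⟩ := b
  change A at b
  change b * e i ∈ (ideal (grJacobson 𝒜)).map (LinearMap.mulRight K (e i)) ↔ b * e i ∈ _
  have hbe : b * e i * e i = b * e i := by rw [mul_assoc, (he.idem i).eq]
  constructor
  · rintro ⟨c, hc, hcb⟩
    have hcb : c * e i = b * e i := hcb
    rw [← hcb, mem_maxIdeal]
    intro y
    have := (mem_maxIdeal he hl (i := i)).1 (mem_maxIdeal_of_mem_jacobson he hl hc) y
    rwa [← mul_assoc, prj_mul_right_zero (he.deg_zero i), ← mul_assoc, mul_assoc, (he.idem i).eq]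
  · intro h
    exact ⟨b * e i, mem_jacobson he hl h hbe, hbe⟩

end HasLocalCorners

theorem IsWeaklyBasicFamily.hasLocalCorners (he : IsWeaklyBasicFamily 𝒜 e) :
    HasLocalCorners 𝒜 e := by
  intro i x hx
  have := he.isLocal i
  have key : ∀ z ∈ peirce 𝒜 e i i 0, ∃ c : (he.idem_degZero i).Corner, c.1.1 = z :=
    fun z hz => ⟨⟨⟨z, hz.1⟩, ⟨⟨z, hz.1⟩, Subtype.ext (by
      change e i * z * e i = z
      rw [hz.2.1, hz.2.2])⟩⟩, rfl⟩
  have key2 : ∀ c : (he.idem_degZero i).Corner, c.1.1 ∈ peirce 𝒜 e i i 0 := fun c =>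
    have h := (Subsemigroup.mem_corner_iff (he.idem_degZero i)).1 c.2
    ⟨c.1.2, congrArg Subtype.val h.1, congrArg Subtype.val h.2⟩
  have key3 : ∀ c : (he.idem_degZero i).Corner, IsUnit c →
      ∃ y ∈ peirce 𝒜 e i i 0, y * c.1.1 = e i ∧ c.1.1 * y = e i := by
    rintro _ ⟨u, rfl⟩
    refine ⟨(u⁻¹).1.1.1, key2 _, ?_, ?_⟩
    · exact congrArg (fun c : (he.idem_degZero i).Corner => c.1.1) u.inv_mul
    · exact congrArg (fun c : (he.idem_degZero i).Corner => c.1.1) u.mul_inv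
  obtain ⟨c, rfl⟩ := key x hx
  rcases IsLocalRing.isUnit_or_isUnit_of_add_one (add_sub_cancel c 1) with h | h
  · exact Or.inl (key3 c h)
  · exact Or.inr (key3 _ h)

theorem IsWeaklyBasicFamily.isLocalFamily (he : IsWeaklyBasicFamily 𝒜 e) :
    IsLocalFamily 𝒜 e where
  toIsDistinguishedFamily := he.toIsDistinguishedFamily
  loc := he.hasLocalCorners
  fd i j h := by
    have := he.locally_fd i j h
    refine Submodule.finiteDimensional_of_le
      (S₂ := (𝒜 h).map (LinearMap.mulLeft K (e i) ∘ₗ LinearMap.mulRight K (e j))) fun x hx => ?_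
    refine ⟨x, hx.1, ?_⟩
    change e i * (x * e j) = x
    rw [hx.2.2, hx.2.1]
  rad i j h hij x hx y hy hxy := by
    -- Since `y` lies in the radical, it lies in `maxIdeal` at `i`, and `x * y = e i` would make `e
    -- i` a nonunit.
    have h1 := he.mem_jacobson j i hij.symm y
    rw [hy.2.1, hy.2.2] at h1
    have h2 := (HasLocalCorners.mem_maxIdeal he.toIsDistinguishedFamily he.hasLocalCorners).1
      (HasLocalCorners.mem_maxIdeal_of_mem_jacobson _ he.hasLocalCorners (i := i) h1) x
    rw [hxy, prj_same (he.deg_zero i), (he.idem i).eq, (he.idem i).eq] at h2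
    exact HasLocalCorners.one_notMem_nonunits _ _ i h2

theorem mem_peirce_op {i j : I} {h : H} {x : Aᵐᵒᵖ} :
    x ∈ peirce (opGr 𝒜) (fun i => MulOpposite.op (e i)) i j h ↔ x.unop ∈ peirce 𝒜 e j i h := by
  constructor
  · rintro ⟨⟨a, ha, rfl⟩, h1, h2⟩
    exact ⟨ha, MulOpposite.op_injective h2, MulOpposite.op_injective h1⟩
  · rintro ⟨h0, h1, h2⟩
    exact ⟨⟨_, h0, rfl⟩, MulOpposite.unop_injective h2, MulOpposite.unop_injective h1⟩

theorem IsLocalFamily.op (he : IsLocalFamily 𝒜 e) :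
    IsLocalFamily (opGr 𝒜) (fun i => MulOpposite.op (e i)) where
  toIsDistinguishedFamily := he.toIsDistinguishedFamily.op
  fd i j h := by
    have := he.fd j i h
    refine Submodule.finiteDimensional_of_le
      (S₂ := (peirce 𝒜 e j i h).map (MulOpposite.opLinearEquiv K).toLinearMap) fun x hx => ?_
    exact ⟨x.unop, mem_peirce_op.1 hx, rfl⟩
  loc i x hx := by
    rcases he.loc i _ (mem_peirce_op.1 hx) with ⟨y, hy, h1, h2⟩ | ⟨y, hy, h1, h2⟩
    · exact Or.inl ⟨MulOpposite.op y, mem_peirce_op.2 hy, MulOpposite.unop_injective h2,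
        MulOpposite.unop_injective h1⟩
    · exact Or.inr ⟨MulOpposite.op y, mem_peirce_op.2 hy, MulOpposite.unop_injective h2,
        MulOpposite.unop_injective h1⟩
  rad i j h hij x hx y hy hxy :=
    he.rad i j (-h) hij _ (mem_peirce_op.1 hy) _ (by rw [neg_neg]; exact mem_peirce_op.1 hx)
      (MulOpposite.op_injective hxy)

end Peirce

/-! ### Linear forms and bilinear forms -/

section LinearAlgebra

variable {K V W : Type*} [Field K] [AddCommGroup V] [Module K V] [AddCommGroup W] [Module K W]

/-- A linear form vanishing on the left kernel of a bilinear form with finite dimensional second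
argument is represented by a vector. -/
theorem exists_represent [FiniteDimensional K W] (B : V →ₗ[K] W →ₗ[K] K) (f : V →ₗ[K] K)
    (hf : ∀ v, B v = 0 → f v = 0) : ∃ w, ∀ v, f v = B v w := by
  -- The forms vanishing on the kernel of `B` are the image of the bidual of `W`, which is `W`
  -- itself in finite dimension.
  have h1 : f ∈ LinearMap.range B.dualMap := by
    rw [LinearMap.range_dualMap_eq_dualAnnihilator_ker, Submodule.mem_dualAnnihilator]
    exact hf
  obtain ⟨φ, hφ⟩ := h1
  obtain ⟨w, hw⟩ := (Module.evalEquiv K W).surjective φ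
  refine ⟨w, fun v => ?_⟩
  rw [← hφ, ← hw]
  rfl

/-- A linear form on a subspace vanishing on a smaller subspace but not on a given vector. -/
theorem exists_form (N : Submodule K V) {v : V} (hv : v ∉ N) :
    ∃ f : V →ₗ[K] K, f v = 1 ∧ ∀ x ∈ N, f x = 0 := by
  obtain ⟨f, hf, hN⟩ := Submodule.exists_le_ker_of_notMem hv
  refine ⟨(f v)⁻¹ • f, by simp [hf], fun x hx => ?_⟩
  have : f x = 0 := hN hx
  simp [this]

end LinearAlgebra

/-! ### The projective modules `A e_i [k]` and the injective duals of `e_i A` -/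

section Modules

variable {K H A I : Type u} [Field K] [AddCommGroup H] [NonUnitalRing A] [Module K A]
  [IsScalarTower K A A] [SMulCommClass K A A] {𝒜 : H → Submodule K A} {e : I → A}

theorem GrMod.shift_proj (M : GrMod 𝒜) (k h : H) :
    proj (M.shift k).internal h = proj M.internal (k + h) :=
  proj_eq_of (M.shift k).internal h (proj M.internal (k + h))
    (fun _ hx => proj_same M.internal hx)
    fun _ hj _ hx => proj_ne M.internal (fun h' => hj (add_left_cancel h')) hx

/-- The graded submodules of a shifted module. -/
noncomputable def GrMod.shiftSub (M : GrMod 𝒜) (k : H) : M.GrSub ≃o (M.shift k).GrSub where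
  toFun N := ⟨N.sub, N.act_mem, fun m hm h => by
    rw [M.shift_proj]
    exact N.homogeneous m hm (k + h)⟩
  invFun N := ⟨N.sub, N.act_mem, fun m hm h => by
    have := N.homogeneous m hm (-k + h)
    rwa [M.shift_proj, add_neg_cancel_left] at this⟩
  left_inv _ := rfl
  right_inv _ := rfl
  map_rel_iff' := Iff.rfl

variable [GradedAlgebraEI 𝒜] (he : IsDistinguishedFamily 𝒜 e)

/-- The shifted module `A e_i [k]`. -/
noncomputable def Ps (i : I) (k : H) : GrMod 𝒜 := (Ae he i).shift k

namespace Ps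

/-- The underlying element of `A`. -/
noncomputable def val (i : I) (k : H) : (Ps he i k).carrier →ₗ[K] A :=
  Submodule.subtype (mulRightSub (topSub 𝒜) (e i) (he.deg_zero i)).sub

variable {he} {i : I} {k : H}

theorem val_injective : Function.Injective (val he i k) := Subtype.val_injective

theorem val_act (a : A) (b : (Ps he i k).carrier) :
    val he i k ((Ps he i k).act a b) = a * val he i k b := rfl

theorem val_mul (b : (Ps he i k).carrier) : val he i k b * e i = val he i k b := by
  obtain ⟨_, b, -, rfl⟩ := b
  change (b : A) * e i * e i = b * e i
  rw [mul_assoc, (he.idem i).eq]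

theorem mem_gr {b : (Ps he i k).carrier} {h : H} :
    b ∈ (Ps he i k).gr h ↔ val he i k b ∈ 𝒜 (k + h) := Iff.rfl

theorem exists_val {x : A} (hx : x * e i = x) : ∃ b, val he i k b = x :=
  ⟨⟨x, x, trivial, hx⟩, rfl⟩

theorem mem_pc {b : (Ps he i k).carrier} {h : H} {l : I} :
    b ∈ (Ps he i k).pc e l h ↔ val he i k b ∈ peirce 𝒜 e l i (k + h) := by
  constructor
  · rintro ⟨h1, h2⟩
    exact ⟨h1, congrArg (val he i k) h2, val_mul b⟩
  · rintro ⟨h1, h2, -⟩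
    exact ⟨h1, val_injective h2⟩

variable (he i k) in
/-- The generator. -/
noncomputable def gen : (Ps he i k).carrier := ⟨e i, e i, trivial, he.idem i⟩

@[simp] theorem val_gen : val he i k (gen he i k) = e i := rfl

theorem gen_mem : gen he i k ∈ (Ps he i k).pc e i (-k) :=
  mem_pc.2 (by rw [val_gen, add_neg_cancel]; exact he.idem_mem i)

theorem act_gen (b : (Ps he i k).carrier) : (Ps he i k).act (val he i k b) (gen he i k) = b :=
  val_injective (val_mul b)

theorem lin_eq {M : GrMod 𝒜} (f : (Ps he i k).carrier →ₗ[OpRing K H A] M.carrier) (b) :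
    f b = M.act (val he i k b) (f (gen he i k)) := by
  rw [← GrMod.lin_act, act_gen]

theorem lin_gen {M : GrMod 𝒜} (f : (Ps he i k).carrier →ₗ[OpRing K H A] M.carrier) :
    f (gen he i k) ∈ M.pc e i (-k) :=
  ⟨GrMod.lin_gr f gen_mem.1, by rw [← GrMod.lin_act, gen_mem.2]⟩

/-- The homomorphism from `A e_i [k]` given by an element of `e_i M_{-k}`. -/
theorem exists_lift {M : GrMod 𝒜} {m : M.carrier} (hm : m ∈ M.pc e i (-k)) :
    ∃ f : (Ps he i k).carrier →ₗ[OpRing K H A] M.carrier,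
      ∀ b, f b = M.act (val he i k b) m :=
  ⟨GrMod.linOf (M.act.flip m ∘ₗ val he i k)
    (fun a b => by
      simp only [LinearMap.comp_apply, LinearMap.flip_apply, val_act]
      exact M.mul_act _ _ _)
    (fun h b hb => by
      have := M.act_mem (mem_gr.1 hb) hm.1
      rwa [add_neg_cancel_comm] at this), fun _ => rfl⟩

variable (he i k) in
theorem projective : Projective (Ps he i k) := by
  rw [GrMod.projective_iff]
  intro X Y f g hf
  obtain ⟨x, hx⟩ := hf (g (gen he i k))
  -- The preimage `x` need not be homogeneous or fixed by `e i`; its component in `e_i X_{-k}` is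
  -- still a preimage.
  obtain ⟨q, hq⟩ := exists_lift (he := he) (he.pc_comp_mem i (-k) x)
  refine ⟨q, fun b => ?_⟩
  have hg := lin_gen g
  rw [hq, GrMod.lin_act, GrMod.lin_act, GrMod.lin_proj, hx, proj_same _ hg.1, hg.2, ← lin_eq]

theorem isNoetherian (h : WellFoundedGT (Ae he i).GrSub) :
    IsNoetherian (OpRing K H A) (Ps he i k).carrier := by
  rw [isNoetherian_iff']
  exact (((Ae he i).shiftSub k).trans (GrMod.subEquiv _)).symm.strictMono.wellFoundedGT

end Ps

/-- Every graded module is a quotient of a direct sum of shifts of the `A e_i`. -/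
theorem exists_cover (M : GrMod 𝒜) : ∃ (Λ : Type u) (i : Λ → I) (k : Λ → H)
    (g : (GrMod.dsum fun l => Ps he (i l) (k l)).carrier →ₗ[OpRing K H A] M.carrier),
    Function.Surjective g := by
  let Λ := (p : I × H) × M.pc e p.1 p.2
  choose f hf using fun l : Λ => Ps.exists_lift (he := he) (i := l.1.1) (k := -l.1.2)
    (m := l.2.1) (by rw [neg_neg]; exact l.2.2)
  obtain ⟨g, hg⟩ := GrMod.exists_dsum_desc f
  refine ⟨Λ, fun l => l.1.1, fun l => -l.1.2, g, fun m => ?_⟩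
  refine he.pc_induction ((LinearMap.range g).restrictScalars K) (fun i h m hm => ?_) m
  let l : Λ := ⟨(i, h), m, hm⟩
  exact ⟨GrMod.dsumι _ l (Ps.gen he i (-h)), by rw [hg, hf, Ps.val_gen]; exact hm.2⟩

variable (𝒜 e) in
/-- The linear forms on `e_i A` supported on `e_i A_{k-h} e_l`. -/
def Dpc (i : I) (k : H) (l : I) (h : H) : Submodule K (A →ₗ[K] K) where
  carrier := {f | (∀ x, f (e i * x * e l) = f x) ∧ ∀ t, t ≠ k - h → ∀ x ∈ 𝒜 t, f x = 0}
  add_mem' hf hg := ⟨fun x => by simp [hf.1, hg.1], fun t ht x hx => by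
    simp [hf.2 t ht x hx, hg.2 t ht x hx]⟩
  zero_mem' := ⟨fun _ => rfl, fun _ _ _ _ => rfl⟩
  smul_mem' c f hf := ⟨fun x => by simp [hf.1], fun t ht x hx => by simp [hf.2 t ht x hx]⟩

variable (𝒜 e) in
/-- The shifted graded dual of `e_i A`. -/
def DSub (i : I) (k : H) : Submodule K (A →ₗ[K] K) := ⨆ p : I × H, Dpc 𝒜 e i k p.1 p.2

theorem Dpc_le_DSub {i : I} {k : H} {l : I} {h : H} : Dpc 𝒜 e i k l h ≤ DSub 𝒜 e i k :=
  le_iSup (fun p : I × H => Dpc 𝒜 e i k p.1 p.2) (l, h)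

/-- The action of `A` on linear forms. -/
noncomputable def dact : A →ₗ[K] (A →ₗ[K] K) →ₗ[K] (A →ₗ[K] K) :=
  LinearMap.mk₂ K (fun a f => f ∘ₗ LinearMap.mulRight K a)
    (fun a b f => by ext; simp [mul_add]) (fun c a f => by ext; simp [mul_smul_comm])
    (fun a f g => by ext; simp) (fun c a f => by ext; simp)

@[simp] theorem dact_apply (a : A) (f : A →ₗ[K] K) (x : A) : dact a f x = f (x * a) := rfl

theorem Dpc_eq {i l : I} {k h : H} {f : A →ₗ[K] K} (hf : f ∈ Dpc 𝒜 e i k l h) (x : A) :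
    f x = f (e i * prj 𝒜 (k - h) x * e l) := by
  have hx := mem_iSup_gr (GradedAlgebraEI.internal (𝒜 := 𝒜)) x
  rw [hf.1]
  induction hx using Submodule.iSup_induction' with
  | zero => simp
  | add x y _ _ hx hy => simp only [map_add, hx, hy]
  | mem t x hx =>
    by_cases ht : t = k - h
    · subst ht
      rw [prj_same hx]
    · rw [prj_ne ht hx, map_zero, hf.2 t ht x hx]

include he in
theorem dact_mem_Dpc {i l m : I} {k h t : H} {f : A →ₗ[K] K} (hf : f ∈ Dpc 𝒜 e i k m h) {a : A}
    (ha : a ∈ peirce 𝒜 e l m t) : dact a f ∈ Dpc 𝒜 e i k l (t + h) := by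
  refine ⟨fun x => ?_, fun s hs x hx => ?_⟩
  · rw [dact_apply, dact_apply, ← hf.1 (x * a), mul_assoc (e i * x), ha.2.1, ← mul_assoc,
      mul_assoc _ a, ha.2.2]
  · rw [dact_apply]
    refine hf.2 (s + t) (fun h' => hs ?_) _ (GradedAlgebraEI.mul_mem hx ha.1)
    rw [eq_sub_of_add_eq h']
    abel

include he in
theorem dact_mem_DSub {i : I} {k : H} {f : A →ₗ[K] K} (hf : f ∈ DSub 𝒜 e i k) (a : A) :
    dact a f ∈ DSub 𝒜 e i k := by
  refine he.peirce_induction ((DSub 𝒜 e i k).comap ((dact (K := K) (A := A)).flip f))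
    (fun l m t a ha => ?_) a
  change dact a f ∈ DSub 𝒜 e i k
  induction hf using Submodule.iSup_induction' with
  | zero => rw [map_zero]; exact zero_mem _
  | add f g _ _ hf hg => rw [map_add]; exact add_mem hf hg
  | mem p f hf =>
    by_cases h : m = p.1
    · subst h
      exact Dpc_le_DSub (dact_mem_Dpc he hf ha)
    · have : dact (K := K) a f = 0 := by
        ext x
        rw [dact_apply, ← hf.1, ← ha.2.2, mul_assoc (e i), mul_assoc x, mul_assoc a, he.ortho _ _ h]
        simp
      rw [this]
      exact zero_mem _

theorem comp_prj_mem_DSub {i : I} {k : H} {f : A →ₗ[K] K} (hf : f ∈ DSub 𝒜 e i k) (h : H) :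
    f ∘ₗ prj 𝒜 (k - h) ∈ DSub 𝒜 e i k := by
  induction hf using Submodule.iSup_induction' with
  | zero => rw [LinearMap.zero_comp]; exact zero_mem _
  | add f g _ _ hf hg => rw [LinearMap.add_comp]; exact add_mem hf hg
  | mem p f hf =>
    by_cases hp : p.2 = h
    · subst hp
      have : f ∘ₗ prj 𝒜 (k - p.2) = f := by
        ext x
        have h1 := Dpc_eq hf x
        have h2 := Dpc_eq hf (prj 𝒜 (k - p.2) x)
        rw [prj_same (prj_mem _ _)] at h2
        rw [LinearMap.comp_apply, h1, h2]
      rw [this]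
      exact Dpc_le_DSub hf
    · have : f ∘ₗ prj 𝒜 (k - h) = 0 := by
        ext x
        exact hf.2 _ (fun h' => hp (sub_right_injective h').symm) _ (prj_mem _ _)
      rw [this]
      exact zero_mem _

variable (𝒜) in
/-- The linear forms supported on the component of degree `d`. -/
def Dgr (d : H) : Submodule K (A →ₗ[K] K) where
  carrier := {f | ∀ t, t ≠ d → ∀ x ∈ 𝒜 t, f x = 0}
  add_mem' := fun hf hg t ht x hx => by simp [hf t ht x hx, hg t ht x hx]
  zero_mem' := fun _ _ _ _ => rfl
  smul_mem' := fun c f hf t ht x hx => by simp [hf t ht x hx]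

/-- The shifted graded dual of `e_i A`, as a graded left module. -/
noncomputable def Dmod (i : I) (k : H) : GrMod 𝒜 where
  carrier := DSub 𝒜 e i k
  act := LinearMap.mk₂ K (fun a f => (⟨dact a f.1, dact_mem_DSub he f.2 a⟩ : DSub 𝒜 e i k))
    (fun a b f => Subtype.ext (by simp)) (fun c a f => Subtype.ext (by simp))
    (fun a f g => Subtype.ext (by simp)) (fun c a f => Subtype.ext (by simp))
  mul_act a b f := Subtype.ext (by ext x; simp [mul_assoc])
  unital := by
    refine eq_top_iff.2 fun f h => ?_
    clear h
    obtain ⟨f, hf⟩ := f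
    induction hf using Submodule.iSup_induction' with
    | zero => exact zero_mem _
    | add f g _ _ hf hg => exact add_mem hf hg
    | mem p f hf =>
      refine Submodule.subset_span ⟨e p.1, ⟨f, Dpc_le_DSub hf⟩, Subtype.ext ?_⟩
      ext x
      change f (x * e p.1) = f x
      rw [← hf.1, ← hf.1 x, mul_assoc, mul_assoc, (he.idem _).eq, mul_assoc]
  gr h := (Dgr 𝒜 (k - h)).comap (DSub 𝒜 e i k).subtype
  internal := by
    refine isInternal_of_proj (fun h =>
      { toFun := fun f => ⟨f.1 ∘ₗ prj 𝒜 (k - h), comp_prj_mem_DSub f.2 h⟩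
        map_add' := fun f g => Subtype.ext (LinearMap.add_comp _ _ _)
        map_smul' := fun c f => Subtype.ext (LinearMap.smul_comp _ _ _) }) ?_ ?_ ?_
    · intro h f hf
      refine Subtype.ext (LinearMap.ext fun x => ?_)
      change f.1 (prj 𝒜 (k - h) x) = f.1 x
      have hx := mem_iSup_gr (GradedAlgebraEI.internal (𝒜 := 𝒜)) x
      induction hx using Submodule.iSup_induction' with
      | zero => simp
      | add x y _ _ hx hy => simp only [map_add, hx, hy]
      | mem t x hx =>
        by_cases ht : t = k - h
        · subst ht
          rw [prj_same hx]
        · rw [prj_ne ht hx, map_zero]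
          exact (hf t ht x hx).symm
    · intro h l hl f hf
      refine Subtype.ext (LinearMap.ext fun x => ?_)
      exact hf (k - h) (fun h' => hl (sub_right_injective h').symm) _ (prj_mem _ _)
    · rintro ⟨f, hf⟩
      induction hf using Submodule.iSup_induction' with
      | zero => exact zero_mem _
      | add f g _ _ hf hg => exact add_mem hf hg
      | mem p f hf => exact Submodule.mem_iSup_of_mem p.2 hf.2
  act_mem := by
    intro h l a f ha hf t ht x hx
    change f.1 (x * a) = 0
    refine hf (t + h) (fun h' => ht ?_) _ (GradedAlgebraEI.mul_mem hx ha)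
    rw [eq_sub_of_add_eq h']
    abel

namespace Dmod

/-- The underlying linear form. -/
noncomputable def val (i : I) (k : H) : (Dmod he i k).carrier →ₗ[K] A →ₗ[K] K :=
  Submodule.subtype (DSub 𝒜 e i k)

variable {he} {i : I} {k : H}

theorem val_injective : Function.Injective (val he i k) := Subtype.val_injective

theorem val_mem (f : (Dmod he i k).carrier) : val he i k f ∈ DSub 𝒜 e i k :=
  Subtype.property (p := fun f => f ∈ DSub 𝒜 e i k) f

theorem exists_val {f : A →ₗ[K] K} (hf : f ∈ DSub 𝒜 e i k) : ∃ g, val he i k g = f :=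
  ⟨(⟨f, hf⟩ : DSub 𝒜 e i k), rfl⟩

theorem val_act (a : A) (f : (Dmod he i k).carrier) :
    val he i k ((Dmod he i k).act a f) = dact a (val he i k f) := rfl

theorem mem_gr {f : (Dmod he i k).carrier} {h : H} :
    f ∈ (Dmod he i k).gr h ↔ ∀ t, t ≠ k - h → ∀ x ∈ 𝒜 t, val he i k f x = 0 := Iff.rfl

theorem val_left (f : (Dmod he i k).carrier) (x : A) :
    val he i k f (e i * x) = val he i k f x := by
  have hf := val_mem f
  generalize val he i k f = f at hf
  induction hf using Submodule.iSup_induction' with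
  | zero => rfl
  | add f g _ _ hf hg => simp only [LinearMap.add_apply, hf, hg]
  | mem p f hf => rw [← hf.1, ← mul_assoc, (he.idem i).eq, hf.1]

theorem mem_pc {f : (Dmod he i k).carrier} {l : I} {h : H} :
    f ∈ (Dmod he i k).pc e l h ↔ val he i k f ∈ Dpc 𝒜 e i k l h := by
  constructor
  · rintro ⟨h1, h2⟩
    refine ⟨fun x => ?_, h1⟩
    conv_rhs => rw [← h2, val_act, dact_apply]
    rw [mul_assoc, val_left]
  · rintro ⟨h1, h2⟩
    refine ⟨h2, val_injective (LinearMap.ext fun x => ?_)⟩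
    rw [val_act, dact_apply, ← h1, ← h1 x, mul_assoc, mul_assoc, (he.idem l).eq, mul_assoc]

variable (he i k) in
/-- A linear form on `M` induces a homomorphism from `M` to the dual of `e_i A`. -/
theorem exists_lift {M : GrMod 𝒜} (ψ : M.carrier →ₗ[K] K) :
    ∃ g : M.carrier →ₗ[OpRing K H A] (Dmod he i k).carrier,
      ∀ m x, val he i k (g m) x = ψ (proj M.internal k (M.act (e i) (M.act x m))) := by
  -- A homomorphism into the dual is determined by evaluating its values at `e i`, and this
  -- evaluation only sees degree `k`. Hence `m` is sent to the form taking `x` to `ψ` of the degree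
  -- `k` part of `e_i x m`.
  let β : M.carrier →ₗ[K] A →ₗ[K] K :=
    M.act.flip.compr₂ (ψ ∘ₗ proj M.internal k ∘ₗ M.act (e i))
  have hβ : ∀ m x, β m x = ψ (proj M.internal k (M.act (e i) (M.act x m))) := fun m x => rfl
  have hdeg : ∀ h, ∀ m ∈ M.gr h, ∀ t, t ≠ k - h → ∀ x ∈ 𝒜 t, β m x = 0 := by
    intro h m hm t ht x hx
    have h1 := M.act_mem (he.deg_zero i) (M.act_mem hx hm)
    rw [zero_add] at h1
    rw [hβ, proj_ne _ (fun h' => ht (eq_sub_of_add_eq h')) h1, map_zero]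
  have hmem : ∀ m, β m ∈ DSub 𝒜 e i k := by
    refine he.pc_induction ((DSub 𝒜 e i k).comap β) fun l h m hm => ?_
    refine Dpc_le_DSub (l := l) (h := h) ⟨fun x => ?_, hdeg h m hm.1⟩
    rw [hβ, hβ, M.mul_act, M.mul_act, hm.2, ← M.mul_act (e i) (e i), (he.idem i).eq]
  refine ⟨GrMod.linOf (N := Dmod he i k) (β.codRestrict _ hmem) ?_ hdeg, hβ⟩
  intro a m
  refine Subtype.ext (LinearMap.ext fun x => ?_)
  change β (M.act a m) x = β m (x * a)
  rw [hβ, hβ, M.mul_act]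

variable (he i k) in
-- By `exists_lift`, extending a homomorphism into the dual amounts to extending a linear form over
-- the field `K`, and a `K`-linear left inverse of `f` does this.
theorem injective : Injective (Dmod he i k) := by
  rw [GrMod.injective_iff]
  intro X Y f g hf
  obtain ⟨l, hl⟩ := (f.restrictScalars K).exists_leftInverse_of_injective
    (LinearMap.ker_eq_bot.2 hf)
  obtain ⟨q, hq⟩ := exists_lift he i k (((val he i k).flip (e i)) ∘ₗ g.restrictScalars K ∘ₗ l)
  refine ⟨q, fun x => val_injective (LinearMap.ext fun a => ?_)⟩
  have hl' : ∀ x, l (f x) = x := fun x => congrArg (fun q => q x) hl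
  rw [hq, ← GrMod.lin_act, ← GrMod.lin_act, ← GrMod.lin_proj]
  simp only [LinearMap.comp_apply, hl', LinearMap.flip_apply, LinearMap.restrictScalars_apply]
  rw [GrMod.proj_act_zero _ (he.deg_zero i), GrMod.lin_act, val_act, dact_apply, (he.idem i).eq]
  rw [GrMod.lin_proj, GrMod.lin_act]
  -- Because `e i` has degree `0`, a homogeneous form of degree other than `k` vanishes at `e i`.
  have key : ∀ f : (Dmod he i k).carrier, val he i k (proj (Dmod he i k).internal k f) (e i) =
      val he i k f (e i) := by
    intro f
    have hf := mem_iSup_gr (Dmod he i k).internal f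
    induction hf using Submodule.iSup_induction' with
    | zero => simp
    | add x y _ _ hx hy => simp only [map_add, LinearMap.add_apply, hx, hy]
    | mem h f hf =>
      by_cases hh : h = k
      · subst hh
        rw [proj_same _ hf]
      · rw [proj_ne _ hh hf, map_zero, LinearMap.zero_apply,
          mem_gr.1 hf 0 (fun h' => hh (sub_eq_zero.1 h'.symm).symm) _ (he.deg_zero i)]
  rw [key, val_act, dact_apply, val_left]

/-- The linear forms in the dual separate the elements of `e_i A`. -/
theorem separates {a : A} (ha : e i * a = a)
    (h : ∀ f : (Dmod he i k).carrier, val he i k f a = 0) : a = 0 := by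
  have h1 : ∀ l t, prj 𝒜 t a * e l = 0 := by
    intro l t
    by_contra hne
    obtain ⟨f, hf, -⟩ := exists_form (K := K) (⊥ : Submodule K A) hne
    let g : A →ₗ[K] K := f ∘ₗ LinearMap.mulLeft K (e i) ∘ₗ LinearMap.mulRight K (e l) ∘ₗ prj 𝒜 t
    have hg : ∀ x, g x = f (e i * (prj 𝒜 t x * e l)) := fun _ => rfl
    have hgm : g ∈ Dpc 𝒜 e i k l (k - t) := by
      refine ⟨fun x => ?_, fun s hs x hx => ?_⟩
      · rw [hg, hg, prj_mul_right_zero (he.deg_zero l), prj_mul_left_zero (he.deg_zero i),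
          ← mul_assoc, ← mul_assoc, ← mul_assoc, (he.idem i).eq, mul_assoc _ (e l), (he.idem l).eq,
          ← mul_assoc]
      · rw [hg, prj_ne (fun h' => hs (by rw [h']; abel)) hx]
        simp
    obtain ⟨q, hq⟩ := exists_val (he := he) (Dpc_le_DSub hgm)
    have h2 := h q
    rw [hq, hg, ← mul_assoc, ← prj_mul_left_zero (he.deg_zero i), ha, hf] at h2
    exact one_ne_zero h2
  refine eq_zero_of_proj (GradedAlgebraEI.internal (𝒜 := 𝒜)) fun t => ?_
  have h2 : (LinearMap.mulLeft K (prj 𝒜 t a)) = 0 := by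
    refine he.eq_of_peirce fun l m h x hx => ?_
    change prj 𝒜 t a * x = 0
    rw [← hx.2.1, ← mul_assoc, h1, zero_mul]
  -- A left unit in the opposite algebra is a right unit `u` for the component of `a`; that
  -- component annihilates everything on its right, in particular `u`.
  obtain ⟨u, hu⟩ := exists_left_unit (opGr 𝒜) {MulOpposite.op (prj 𝒜 t a)}
  have h3 := congrArg MulOpposite.unop (hu _ (Finset.mem_singleton_self _))
  change prj 𝒜 t a * u.unop = prj 𝒜 t a at h3
  change prj 𝒜 t a = 0
  rw [← h3]
  exact congrArg (fun q => q u.unop) h2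

/-- The generator of the socle of the dual of `e_i A`. -/
theorem exists_socle (hl : HasLocalCorners 𝒜 e) (hfd : FiniteDimensional K (peirce 𝒜 e i i 0)) :
    ∃ z ∈ (Dmod he i k).pc e i k, z ≠ 0 ∧
      (∀ b ∈ ideal (hl.maxIdeal he i), (Dmod he i k).act b z = 0) ∧
      ∀ N : Submodule (OpRing K H A) (Dmod he i k).carrier, N ≠ ⊥ → z ∈ N := by
  -- The socle is generated by a form factoring through `e_i A_0 e_i` modulo its maximal ideal.
  obtain ⟨ζ, hζ1, hζ0⟩ := exists_form _ (HasLocalCorners.one_notMem_nonunits he hl i)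
  let ω : A →ₗ[K] K := ζ ∘ₗ LinearMap.mulRight K (e i) ∘ₗ LinearMap.mulLeft K (e i) ∘ₗ prj 𝒜 0
  have hω : ∀ x, ω x = ζ (e i * prj 𝒜 0 x * e i) := fun _ => rfl
  have hωm : ω ∈ Dpc 𝒜 e i k i k := by
    refine ⟨fun x => ?_, fun t ht x hx => ?_⟩
    · rw [hω, hω, prj_mul_right_zero (he.deg_zero i), prj_mul_left_zero (he.deg_zero i),
        ← mul_assoc, ← mul_assoc, (he.idem i).eq, mul_assoc _ (e i), (he.idem i).eq]
    · rw [sub_self] at ht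
      rw [hω, prj_ne ht hx]
      simp
  have hω1 : ω (e i) = 1 := by
    rw [hω, prj_same (he.deg_zero i), (he.idem i).eq, (he.idem i).eq, hζ1]
  obtain ⟨z, hz⟩ := exists_val (he := he) (Dpc_le_DSub hωm)
  refine ⟨z, mem_pc.2 (by rwa [hz]), fun h => ?_, fun b hb => ?_, fun N hN => ?_⟩
  · rw [h, map_zero] at hz
    rw [← hz] at hω1
    exact zero_ne_one hω1
  · refine val_injective (LinearMap.ext fun x => ?_)
    rw [val_act, dact_apply, hz, hω, map_zero]
    exact hζ0 _ ((HasLocalCorners.mem_maxIdeal he hl).1 hb x)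
  · obtain ⟨l, h, f, hfN, hf, hf0⟩ := he.exists_pc hN
    have hf' := mem_pc.1 hf
    obtain ⟨x, hx⟩ : ∃ x, val he i k f x ≠ 0 := by
      by_contra! h0
      exact hf0 (val_injective (LinearMap.ext h0))
    rw [Dpc_eq hf'] at hx
    -- Multiplication by `y` moves `f` to a form `g ∈ N` supported on `e_i A_0 e_i` with `g (e i) ≠
    -- 0`.
    set y := e i * prj 𝒜 (k - h) x * e l with hy
    have hym : y ∈ peirce 𝒜 e i l (k - h) := he.comp_mem _ _ _ _
    set g := (Dmod he i k).act y f with hg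
    have hgm : val he i k g ∈ Dpc 𝒜 e i k i k := by
      have := dact_mem_Dpc he hf' hym
      rwa [sub_add_cancel] at this
    have hg1 : val he i k g (e i) ≠ 0 := by rwa [hg, val_act, dact_apply, hym.2.1]
    have hgN : g ∈ N := N.act_mem y hfN
    -- The form `ζ` is obtained from `g` by multiplying with an element `c` of the corner. It
    -- vanishes on the left kernel of `(x, c) ↦ g (x * c)`: a unit in that kernel would force `g (e
    -- i) = 0`.
    let B : peirce 𝒜 e i i 0 →ₗ[K] peirce 𝒜 e i i 0 →ₗ[K] K :=
      LinearMap.compl₁₂ ((LinearMap.mul K A).compr₂ (val he i k g)) (Submodule.subtype _)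
        (Submodule.subtype _)
    have hB : ∀ x c, B x c = val he i k g (x.1 * c.1) := fun _ _ => rfl
    obtain ⟨c, hc⟩ := exists_represent B (ζ ∘ₗ Submodule.subtype _) fun x hx => by
      refine hζ0 _ ?_
      by_contra hxn
      obtain ⟨w, hw, hwx⟩ := HasLocalCorners.exists_inv_of_notMem he hl x.2 hxn
      have h1 := HasLocalCorners.mul_comm_one he hl x.2 hw hwx
      refine hg1 ?_
      rw [← h1]
      exact congrArg (fun q => q ⟨w, hw⟩) hx
    have hzc : z = (Dmod he i k).act c.1 g := by
      refine val_injective (LinearMap.ext fun x => ?_)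
      have h1 : val he i k ((Dmod he i k).act c.1 g) ∈ Dpc 𝒜 e i k i k := by
        have := dact_mem_Dpc he hgm c.2
        rwa [zero_add] at this
      rw [hz, Dpc_eq hωm, Dpc_eq h1, sub_self]
      have h2 := hc ⟨_, he.comp_mem i i 0 x⟩
      rw [hB] at h2
      rw [val_act, dact_apply, ← h2, hω, prj_same (he.comp_mem i i 0 x).1]
      have h3 := he.comp_mem i i 0 x
      rw [h3.2.1, h3.2.2]
      rfl
    rw [hzc]
    exact N.act_mem _ hgN

end Dmod

end Modules

/-! ### Perfect pairings between `e_i A` and `A e_j` -/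

section Perfect

variable {K H A I : Type u} [Field K] [AddCommGroup H] [NonUnitalRing A] [Module K A]
  [IsScalarTower K A A] [SMulCommClass K A A] {𝒜 : H → Submodule K A} {e : I → A}

variable (𝒜 e) in
/-- The linear form `f` on `e_i A e_j`, homogeneous of degree `d`, induces a nondegenerate pairing
between `e_i A` and `A e_j`. -/
structure IsPerfect (i j : I) (d : H) (f : A →ₗ[K] K) : Prop where
  left : ∀ x, f (e i * x) = f x
  right : ∀ x, f (x * e j) = f x
  deg : ∀ t, t ≠ d → ∀ x ∈ 𝒜 t, f x = 0
  nondeg_left : ∀ b, b * e j = b → (∀ x, f (x * b) = 0) → b = 0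
  nondeg_right : ∀ a, e i * a = a → (∀ x, f (a * x) = 0) → a = 0

/-- A linear form on the opposite algebra. -/
noncomputable def opForm (f : A →ₗ[K] K) : Aᵐᵒᵖ →ₗ[K] K :=
  f ∘ₗ (MulOpposite.opLinearEquiv K).symm.toLinearMap

theorem IsPerfect.op {i j : I} {d : H} {f : A →ₗ[K] K} (hf : IsPerfect 𝒜 e i j d f) :
    IsPerfect (opGr 𝒜) (fun i => MulOpposite.op (e i)) j i d (opForm f) where
  left x := hf.right x.unop
  right x := hf.left x.unop
  deg t ht x hx := by
    obtain ⟨x, hx, rfl⟩ := hx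
    exact hf.deg t ht x hx
  nondeg_left b hb h := MulOpposite.unop_injective
    (hf.nondeg_right b.unop (MulOpposite.op_injective hb) fun x => h (MulOpposite.op x))
  nondeg_right b hb h := MulOpposite.unop_injective
    (hf.nondeg_left b.unop (MulOpposite.op_injective hb) fun x => h (MulOpposite.op x))

theorem IsPerfect.of_op {i j : I} {d : H} {f : Aᵐᵒᵖ →ₗ[K] K}
    (hf : IsPerfect (opGr 𝒜) (fun i => MulOpposite.op (e i)) j i d f) :
    IsPerfect 𝒜 e i j d (f ∘ₗ (MulOpposite.opLinearEquiv K).toLinearMap) where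
  left x := hf.right (MulOpposite.op x)
  right x := hf.left (MulOpposite.op x)
  deg t ht x hx := hf.deg t ht _ ⟨x, hx, rfl⟩
  nondeg_left b hb h := MulOpposite.op_injective
    (hf.nondeg_right (MulOpposite.op b) (MulOpposite.unop_injective hb) fun x => h x.unop)
  nondeg_right b hb h := MulOpposite.op_injective
    (hf.nondeg_left (MulOpposite.op b) (MulOpposite.unop_injective hb) fun x => h x.unop)

variable [GradedAlgebraEI 𝒜]

theorem IsDistinguishedFamily.eq_zero_of_left (he : IsDistinguishedFamily 𝒜 e) {b : A}
    (h : ∀ l, e l * b = 0) : b = 0 := by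
  obtain ⟨u, hu⟩ := exists_left_unit 𝒜 {b}
  rw [← hu b (Finset.mem_singleton_self _)]
  refine he.peirce_induction (LinearMap.ker (LinearMap.mulRight K b)) (fun i j t x hx => ?_) u
  change x * b = 0
  rw [← hx.2.2, mul_assoc, h, mul_zero]

theorem IsDistinguishedFamily.eq_zero_of_right (he : IsDistinguishedFamily 𝒜 e) {a : A}
    (h : ∀ l, a * e l = 0) : a = 0 :=
  MulOpposite.op_injective (he.op.eq_zero_of_left fun l => MulOpposite.unop_injective (h l))

/-- Two modules `A e_j` and `A e_k` isomorphic up to shift are equal. -/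
theorem IsLocalFamily.eq_of_mul_eq (he : IsLocalFamily 𝒜 e) {i j : I} {s t : H} {x y : A}
    (hx : x ∈ peirce 𝒜 e i j s) (hy : y ∈ peirce 𝒜 e j i t) (hxy : x * y = e i) : i = j := by
  by_contra hij
  refine he.rad i j s hij x hx y ?_ hxy
  rcases eq_or_ne (s + t) 0 with h | h
  · rwa [← eq_neg_of_add_eq_zero_right h]
  · have h1 := prj_ne h (peirce_mul hx hy).1
    rw [hxy, prj_same (he.deg_zero i)] at h1
    exact absurd h1 (he.ne_zero i)

namespace IsPerfect

variable {i j : I} {d : H} {f : A →ₗ[K] K} (hf : IsPerfect 𝒜 e i j d f)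
include hf

theorem mem_Dpc (k : H) : f ∈ Dpc 𝒜 e i k j (k - d) :=
  ⟨fun x => by rw [hf.right, hf.left], by rw [sub_sub_cancel]; exact hf.deg⟩

/-- Right nondegeneracy becomes surjectivity onto each homogeneous piece of the dual, because the
matching piece of `A e_j` is finite dimensional. -/
theorem exists_dual (he : IsLocalFamily 𝒜 e) {k h : H} {l : I} {g : A →ₗ[K] K}
    (hg : g ∈ Dpc 𝒜 e i k l h) : ∃ b ∈ peirce 𝒜 e l j (d - (k - h)), g = dact b f := by
  have := he.fd l j (d - (k - h))
  let B : peirce 𝒜 e i l (k - h) →ₗ[K] peirce 𝒜 e l j (d - (k - h)) →ₗ[K] K :=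
    LinearMap.compl₁₂ ((LinearMap.mul K A).compr₂ f) (Submodule.subtype _) (Submodule.subtype _)
  have hB : ∀ x c, B x c = f (x.1 * c.1) := fun _ _ => rfl
  obtain ⟨b, hb⟩ := exists_represent B (g ∘ₗ Submodule.subtype _) fun x hx => by
    suffices h0 : x.1 = 0 by rw [LinearMap.comp_apply, Submodule.subtype_apply, h0, map_zero]
    -- For reasons of idempotents and degree, `x` can pair nontrivially only with the single piece
    -- `e_l A_{d - (k - h)} e_j`, so being orthogonal to that piece is being orthogonal to
    -- everything.
    refine hf.nondeg_right x.1 x.2.2.1 fun y => ?_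
    refine he.peirce_induction (LinearMap.ker (f ∘ₗ LinearMap.mulLeft K x.1))
      (fun a b t y hy => ?_) y
    change f (x.1 * y) = 0
    by_cases ha : l = a
    swap
    · rw [he.mul_ne x.2 hy ha, map_zero]
    subst ha
    by_cases hb : b = j
    swap
    · rw [← hf.right, mul_assoc, ← hy.2.2, mul_assoc, he.ortho _ _ hb]
      simp
    subst hb
    by_cases ht : k - h + t = d
    swap
    · exact hf.deg _ ht _ (GradedAlgebraEI.mul_mem x.2.1 hy.1)
    · have ht' := eq_sub_of_add_eq' ht
      subst ht'
      exact congrArg (fun q => q ⟨y, hy⟩) hx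
  refine ⟨b.1, b.2, LinearMap.ext fun x => ?_⟩
  have h1 : dact b.1 f ∈ Dpc 𝒜 e i k l (d - (k - h) + (k - d)) :=
    dact_mem_Dpc he.toIsDistinguishedFamily (hf.mem_Dpc k) b.2
  rw [show d - (k - h) + (k - d) = h by abel] at h1
  rw [Dpc_eq hg, Dpc_eq h1]
  exact hb ⟨_, he.comp_mem i l (k - h) x⟩

/-- Both forms generate the dual of `e_i A`, so `f x = f (x * (b * c))` for suitable `b` and `c`.
Left nondegeneracy gives `b * c = e j`, and then the two indices agree. -/
theorem unique (he : IsLocalFamily 𝒜 e) {j' : I} {d' : H} {f' : A →ₗ[K] K}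
    (hf' : IsPerfect 𝒜 e i j' d' f') : j = j' := by
  obtain ⟨b, hb, hfb⟩ := hf'.exists_dual he (hf.mem_Dpc 0)
  obtain ⟨c, hc, hfc⟩ := hf.exists_dual he (hf'.mem_Dpc 0)
  refine he.eq_of_mul_eq hb hc (sub_eq_zero.1 (hf.nondeg_left _ ?_ fun x => ?_))
  · rw [sub_mul, mul_assoc, hc.2.2, (he.idem j).eq]
  · have h1 : f x = f (x * (b * c)) := by
      conv_lhs => rw [hfb, dact_apply, hfc, dact_apply, mul_assoc]
    rw [mul_sub, map_sub, hf.right, ← h1, sub_self]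

/-- The isomorphism between a shift of `A e_j` and the graded dual of `e_i A`. -/
theorem exists_equiv (he : IsLocalFamily 𝒜 e) (k : H) :
    Nonempty ((Ps he.toIsDistinguishedFamily j (d - k)).carrier ≃ₗ[OpRing K H A]
      (Dmod he.toIsDistinguishedFamily i k).carrier) := by
  have hd := he.toIsDistinguishedFamily
  obtain ⟨φ, hφ⟩ := Dmod.exists_val (he := hd) (Dpc_le_DSub (hf.mem_Dpc k))
  have hφm : φ ∈ (Dmod hd i k).pc e j (-(d - k)) := by
    rw [Dmod.mem_pc, hφ, neg_sub]
    exact hf.mem_Dpc k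
  obtain ⟨q, hq⟩ := Ps.exists_lift (he := hd) hφm
  have hqv : ∀ b, Dmod.val hd i k (q b) = dact (Ps.val hd j (d - k) b) f := fun b => by
    rw [hq, Dmod.val_act, hφ]
  -- Injectivity is left nondegeneracy, and surjectivity is `exists_dual`.
  refine ⟨LinearEquiv.ofBijective q ⟨?_, ?_⟩⟩
  · rw [← LinearMap.ker_eq_bot, eq_bot_iff]
    intro b hb
    refine Ps.val_injective (hf.nondeg_left _ (Ps.val_mul b) fun x => ?_)
    have := hqv b
    rw [show q b = 0 from hb, map_zero] at this
    exact (congrArg (fun g => g x) this).symm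
  · intro g
    refine hd.pc_induction ((LinearMap.range q).restrictScalars K) (fun l h g hg => ?_) g
    obtain ⟨b, hb, hgb⟩ := hf.exists_dual he (Dmod.mem_pc.1 hg)
    obtain ⟨c, hc⟩ := Ps.exists_val (he := hd) (k := d - k) hb.2.2
    exact ⟨c, Dmod.val_injective (by rw [hqv, hc, hgb])⟩

/-- Only components whose degrees add up to `d` contribute to `f (a * x)`. It follows that
orthogonals of graded submodules are graded. -/
theorem prj_mul (h : H) (a x : A) : f (prj 𝒜 h a * x) = f (a * prj 𝒜 (d - h) x) := by
  have ha := mem_iSup_gr (GradedAlgebraEI.internal (𝒜 := 𝒜)) a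
  induction ha using Submodule.iSup_induction' with
  | zero => simp
  | add x y _ _ hx hy => simp only [map_add, add_mul, hx, hy]
  | mem s a ha =>
    have hx := mem_iSup_gr (GradedAlgebraEI.internal (𝒜 := 𝒜)) x
    induction hx using Submodule.iSup_induction' with
    | zero => simp
    | add x y _ _ hx hy => simp only [map_add, mul_add, hx, hy]
    | mem t x hx =>
      by_cases hst : s + t = d
      · subst hst
        by_cases hs : s = h
        · subst hs
          rw [prj_same ha, add_sub_cancel_left, prj_same hx]
        · rw [prj_ne hs ha, prj_ne (fun h' => hs ?_) hx]
          · simp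
          · rw [eq_sub_iff_add_eq, add_comm] at h'
            exact (add_right_cancel h').symm
      · by_cases hs : s = h
        · subst hs
          rw [prj_same ha, prj_ne (fun h' => hst ?_) hx,
            hf.deg _ hst _ (GradedAlgebraEI.mul_mem ha hx)]
          · simp
          · rw [h', add_sub_cancel]
        · by_cases ht : t = d - h
          · rw [prj_ne hs ha, show prj 𝒜 (d - h) x = x from ht ▸ prj_same hx,
              hf.deg _ hst _ (GradedAlgebraEI.mul_mem ha hx)]
            simp
          · rw [prj_ne hs ha, prj_ne ht hx]
            simp

end IsPerfect

/-- This is `eq_zero_of_comp` in the quotient by `N`. -/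
theorem mem_of_comp {M : GrMod 𝒜} (he : IsDistinguishedFamily 𝒜 e)
    {N : Submodule (OpRing K H A) M.carrier} {m : M.carrier}
    (h : ∀ i h, M.act (e i) (proj M.internal h m) ∈ N) : m ∈ N := by
  let L := M.subEquiv.symm N
  refine (M.quotMk_eq_zero L m).1 (he.eq_zero_of_comp fun i k => ?_)
  rw [← GrMod.lin_proj, ← GrMod.lin_act]
  exact (M.quotMk_eq_zero L _).2 (h i k)

/-! ### Orthogonals: from ascending to descending chains -/

section Duality

variable {B : Type u} [NonUnitalRing B] [Module K B] [IsScalarTower K B B] [SMulCommClass K B B]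
  {ℬ : H → Submodule K B} {e' : I → B} [GradedAlgebraEI ℬ]

theorem Ps.val_proj {he : IsDistinguishedFamily 𝒜 e} {i : I} {k h : H}
    (b : (Ps he i k).carrier) :
    Ps.val he i k (proj (Ps he i k).internal h b) = prj 𝒜 (k + h) (Ps.val he i k b) := by
  have hb := mem_iSup_gr (Ps he i k).internal b
  induction hb using Submodule.iSup_induction' with
  | zero => simp
  | add x y _ _ hx hy => simp only [map_add, hx, hy]
  | mem t b hb =>
    by_cases ht : t = h
    · subst ht
      rw [proj_same _ hb, prj_same (Ps.mem_gr.1 hb)]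
    · rw [proj_ne _ ht hb, prj_ne (fun h' => ht (add_left_cancel h')) (Ps.mem_gr.1 hb), map_zero]

/-- If `e_i A`, regarded as a left module over an anti-isomorphic algebra `B`, is Noetherian, then
`A e_j` is Artinian, whenever there is a nondegenerate pairing between them. -/
theorem IsPerfect.isArtinian {i j : I} {d k : H} {f : A →ₗ[K] K} (hf : IsPerfect 𝒜 e i j d f)
    (he : IsLocalFamily 𝒜 e) (he' : IsDistinguishedFamily ℬ e') (θ : A ≃ₗ[K] B)
    (hθ : ∀ x y, θ (x * y) = θ y * θ x) (hθg : ∀ h, ∀ x ∈ 𝒜 h, θ x ∈ ℬ h)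
    (hθe : ∀ i, θ (e i) = e' i)
    (hN : IsNoetherian (OpRing K H B) (Ps he' i 0).carrier) :
    IsArtinian (OpRing K H A) (Ps he.toIsDistinguishedFamily j k).carrier := by
  have hd := he.toIsDistinguishedFamily
  have hθs : ∀ x y, θ.symm (x * y) = θ.symm y * θ.symm x := fun x y => by
    rw [LinearEquiv.symm_apply_eq, hθ]
    simp
  have hθp : ∀ h y, θ.symm (prj ℬ h y) = prj 𝒜 h (θ.symm y) := fun h y => by
    rw [LinearEquiv.symm_apply_eq]
    have := proj_comm (GradedAlgebraEI.internal (𝒜 := 𝒜)) (GradedAlgebraEI.internal (𝒜 := ℬ))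
      θ.toLinearMap hθg h (θ.symm y)
    simpa [prj] using this
  -- The map `Φ` sends `N` to its orthogonal in `e_i A`. Being strictly decreasing, it carries
  -- descending chains to ascending ones.
  let Φ : Submodule (OpRing K H A) (Ps hd j k).carrier →
      Submodule (OpRing K H B) (Ps he' i 0).carrier := fun N =>
    (Ps he' i 0).opSubmodule
      { carrier := {y | ∀ n ∈ N, f (θ.symm (Ps.val he' i 0 y) * Ps.val hd j k n) = 0}
        zero_mem' := fun n _ => by simp
        add_mem' := fun {y z} hy hz n hn => by
          rw [map_add, map_add, add_mul, map_add, hy n hn, hz n hn, add_zero]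
        smul_mem' := fun c y hy n hn => by
          rw [map_smul, map_smul, smul_mul_assoc, map_smul, hy n hn, smul_zero] }
      (fun b y hy n hn => by
        rw [Ps.val_act, hθs, mul_assoc, ← Ps.val_act]
        exact hy _ (N.act_mem _ hn))
      (fun y hy h n hn => by
        rw [Ps.val_proj, zero_add, hθp, hf.prj_mul]
        have := hy _ (N.proj_mem (d - h - k) hn)
        rwa [Ps.val_proj, add_sub_cancel] at this)
  have hΦ : ∀ N y, y ∈ Φ N ↔
    ∀ n ∈ N, f (θ.symm (Ps.val he' i 0 y) * Ps.val hd j k n) = 0 := fun _ _ => Iff.rfl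
  have hanti : StrictAnti Φ := by
    intro N N' hNN
    refine lt_of_le_of_ne (fun y hy n hn => hy n (hNN.le hn)) fun hEq => ?_
    obtain ⟨n, hn', hn⟩ := Set.exists_of_ssubset hNN
    obtain ⟨l, h, hlh⟩ : ∃ l h,
        (Ps hd j k).act (e l) (proj (Ps hd j k).internal h n) ∉ N := by
      by_contra! hc
      exact hn (mem_of_comp hd hc)
    set n₀ := (Ps hd j k).act (e l) (proj (Ps hd j k).internal h n) with hn₀
    have hval : ∀ m, Ps.val hd j k ((Ps hd j k).act (e l) (proj (Ps hd j k).internal h m)) =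
        e l * prj 𝒜 (k + h) (Ps.val hd j k m) := fun m => by
      rw [Ps.val_act, Ps.val_proj]
    obtain ⟨g, hg1, hg0⟩ := exists_form (K := K) (N.restrictScalars K) hlh
    obtain ⟨r, hr⟩ := (Ps.val hd j k).exists_leftInverse_of_injective
      (LinearMap.ker_eq_bot.2 Ps.val_injective)
    have hr' : ∀ m, r (Ps.val hd j k m) = m := fun m => congrArg (fun q => q m) hr
    -- The form `g` separates a component `n₀` of `n ∈ N'` from `N`. Composed with a retraction onto
    -- `A e_j` and a homogeneous projection, it becomes an element of the dual of `A e_j`, hence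
    -- equals `f (b * ·)` for some `b ∈ e_i A`. This `b` is orthogonal to `N` but not to `n`.
    let G : A →ₗ[K] K :=
      g ∘ₗ r ∘ₗ LinearMap.mulRight K (e j) ∘ₗ LinearMap.mulLeft K (e l) ∘ₗ prj 𝒜 (k + h)
    have hG : ∀ x, G x = g (r (e l * prj 𝒜 (k + h) x * e j)) := fun _ => rfl
    have hGv : ∀ m, G (Ps.val hd j k m) =
        g ((Ps hd j k).act (e l) (proj (Ps hd j k).internal h m)) := fun m => by
      rw [hG, mul_assoc, ← prj_mul_right_zero (hd.deg_zero j), Ps.val_mul, ← hval, hr']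
    have hGm : opForm G ∈ Dpc (opGr 𝒜) (fun i => MulOpposite.op (e i)) j (k + h) l 0 := by
      refine ⟨fun x => ?_, fun t ht x hx => ?_⟩
      · change G (e l * (x.unop * e j)) = G x.unop
        rw [hG, hG, prj_mul_left_zero (hd.deg_zero l), prj_mul_right_zero (hd.deg_zero j),
          ← mul_assoc, (hd.idem l).eq, mul_assoc, mul_assoc, (hd.idem j).eq, mul_assoc]
      · obtain ⟨x, hx, rfl⟩ := hx
        rw [sub_zero] at ht
        change G x = 0
        rw [hG, prj_ne ht hx]
        simp
    obtain ⟨b, hb, hGb⟩ := hf.op.exists_dual he.op hGm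
    have hGb' : ∀ x, G x = f (b.unop * x) := fun x =>
      congrArg (fun q => q (MulOpposite.op x)) hGb
    have hb' := mem_peirce_op.1 hb
    obtain ⟨y, hy⟩ := Ps.exists_val (he := he') (k := 0) (x := θ b.unop) (i := i) (by
      rw [← hθe, ← hθ, hb'.2.1])
    have h1 : y ∈ Φ N := by
      rw [hΦ]
      intro m hm
      rw [hy, θ.symm_apply_apply, ← hGb', hGv]
      exact hg0 _ (N.act_mem _ (N.proj_mem _ hm))
    rw [← hEq, hΦ] at h1
    have h2 := h1 n hn'
    rw [hy, θ.symm_apply_apply, ← hGb', hGv, ← hn₀, hg1] at h2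
    exact one_ne_zero h2
  rw [isNoetherian_iff'] at hN
  exact hanti.wellFoundedLT

end Duality

/-! ### Nakayama forms -/

/-- In each degree `h`, nondegeneracy and finite dimensionality represent a form on `V_h` by an
element of `W_{d - h}`. An element of the graded dual involves finitely many degrees, so these
representatives can be summed. -/
theorem bijOn_gradedDual {V W : Submodule K A} {B : A →ₗ[K] A →ₗ[K] K} {d : H}
    (hV : ∀ v ∈ V, ∀ h, prj 𝒜 h v ∈ V) (hW : ∀ v ∈ W, ∀ h, prj 𝒜 h v ∈ W)
    (hfd : ∀ h, FiniteDimensional K (W ⊓ 𝒜 h : Submodule K A))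
    (hdeg : ∀ s t, s + t ≠ d → ∀ v ∈ V ⊓ 𝒜 s, ∀ w ∈ W ⊓ 𝒜 t, B v w = 0)
    (hl : ∀ v ∈ V, (∀ w ∈ W, B v w = 0) → v = 0) (hr : ∀ w ∈ W, (∀ v ∈ V, B v w = 0) → w = 0) :
    Set.BijOn (fun w : W => (B.flip (w : A)).domRestrict V) Set.univ
      {f | InGradedDual 𝒜 V f} := by
  have hVi : ∀ v ∈ V, v ∈ ⨆ h, V ⊓ 𝒜 h := fun v hv =>
    mem_iSup_of_proj_mem (GradedAlgebraEI.internal (𝒜 := 𝒜)) V hV hv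
  have hWi : ∀ v ∈ W, v ∈ ⨆ h, W ⊓ 𝒜 h := fun v hv =>
    mem_iSup_of_proj_mem (GradedAlgebraEI.internal (𝒜 := 𝒜)) W hW hv
  refine ⟨fun w _ => ?_, fun w _ w' _ h => ?_, fun f hf => ?_⟩
  · obtain ⟨F, hF⟩ := exists_eq_sum_proj (GradedAlgebraEI.internal (𝒜 := 𝒜)) w.1
    refine (F.finite_toSet.image fun t => d - t).subset ?_
    rintro h ⟨v, hv, hne⟩
    by_contra hh
    refine hne ?_
    change B v.1 w.1 = 0
    rw [hF, map_sum]
    refine Finset.sum_eq_zero fun t ht => hdeg h t (fun h' => hh ?_) v.1 ⟨v.2, hv⟩ _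
      ⟨hW _ w.2 t, proj_mem _ _ _⟩
    exact ⟨t, ht, (eq_sub_of_add_eq h').symm⟩
  · refine Subtype.ext (sub_eq_zero.1 (hr _ (sub_mem w.2 w'.2) fun v hv => ?_))
    rw [map_sub, sub_eq_zero]
    exact congrArg (fun q => q ⟨v, hv⟩) h
  · have hf : InGradedDual 𝒜 V f := hf
    have key : ∀ h, ∃ w ∈ W ⊓ 𝒜 (d - h), ∀ v, ∀ hv : v ∈ V ⊓ 𝒜 h, f ⟨v, hv.1⟩ = B v w := by
      intro h
      have := hfd (d - h)
      let C : (V ⊓ 𝒜 h : Submodule K A) →ₗ[K] (W ⊓ 𝒜 (d - h) : Submodule K A) →ₗ[K] K :=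
        LinearMap.compl₁₂ B (Submodule.subtype _) (Submodule.subtype _)
      obtain ⟨w, hw⟩ := exists_represent C
        (f ∘ₗ Submodule.inclusion (inf_le_left : V ⊓ 𝒜 h ≤ V)) fun v hv => by
          suffices h0 : v.1 = 0 by
            have : v = 0 := Subtype.ext h0
            rw [this, map_zero]
          refine hl v.1 v.2.1 fun w hw => ?_
          have hw' := hWi w hw
          clear hw
          induction hw' using Submodule.iSup_induction' with
          | zero => simp
          | add x y _ _ hx hy => simp only [map_add, hx, hy, add_zero]
          | mem t x hx =>
            by_cases ht : h + t = d
            · have ht' := eq_sub_of_add_eq' ht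
              subst ht'
              exact congrArg (fun q => q ⟨x, hx⟩) hv
            · exact hdeg h t ht v.1 v.2 x hx
      exact ⟨w.1, w.2, fun v hv => hw ⟨v, hv⟩⟩
    choose w hwm hw using key
    refine ⟨⟨∑ h ∈ hf.toFinset, w h, Submodule.sum_mem _ fun h _ => (hwm h).1⟩, trivial, ?_⟩
    refine LinearMap.ext fun ⟨v, hv⟩ => ?_
    change B v (∑ h ∈ hf.toFinset, w h) = f ⟨v, hv⟩
    obtain ⟨g, hg⟩ := LinearMap.exists_extend f
    have hg' : ∀ v, ∀ hv : v ∈ V, g v = f ⟨v, hv⟩ := fun v hv => congrArg (fun q => q ⟨v, hv⟩) hg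
    rw [← hg' v hv]
    have hv' := hVi v hv
    clear hv
    induction hv' using Submodule.iSup_induction' with
    | zero => simp
    | add x y _ _ hx hy => rw [map_add, LinearMap.add_apply, hx, hy, map_add]
    | mem h v hv =>
      rw [map_sum, hg' v hv.1]
      by_cases hh : h ∈ hf.toFinset
      · rw [Finset.sum_eq_single h, hw h v hv]
        · refine fun t _ ht => hdeg h (d - t) (fun h' => ht ?_) v hv _ (hwm t)
          rw [eq_sub_of_add_eq h']
          abel
        · exact fun h' => absurd hh h'
      · have h0 : f ⟨v, hv.1⟩ = 0 := by
          by_contra hne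
          exact hh (hf.mem_toFinset.2 ⟨⟨v, hv.1⟩, hv.2, hne⟩)
        rw [h0]
        refine Finset.sum_eq_zero fun t ht => hdeg h (d - t) (fun h' => hh ?_) v hv _ (hwm t)
        have : h = t := by
          rw [eq_sub_of_add_eq h']
          abel
        rwa [this]

theorem mem_Peirce (he : IsDistinguishedFamily 𝒜 e) {i j : I} {x : A} :
    x ∈ Peirce K e i j ↔ e i * x = x ∧ x * e j = x := by
  constructor
  · rintro ⟨y, rfl⟩
    change e i * (e i * (y * e j)) = e i * (y * e j) ∧ e i * (y * e j) * e j = e i * (y * e j)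
    rw [← mul_assoc, (he.idem i).eq, mul_assoc (e i), mul_assoc y, (he.idem j).eq]
    exact ⟨rfl, rfl⟩
  · rintro ⟨h1, h2⟩
    refine ⟨x, ?_⟩
    change e i * (x * e j) = x
    rw [h2, h1]

theorem finite_mul_ne_zero (he : IsDistinguishedFamily 𝒜 e) (x : A) :
    {i | e i * x ≠ 0}.Finite := by
  refine he.peirce_induction
    { carrier := {x | {i | e i * x ≠ 0}.Finite}
      zero_mem' := by simp
      add_mem' := fun {x y} hx hy => (Set.Finite.union hx hy).subset fun i hi => by
        by_contra h
        simp only [Set.mem_union, Set.mem_ofPred_eq, not_or, not_not] at h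
        exact hi (by rw [mul_add, h.1, h.2, add_zero])
      smul_mem' := fun c x hx => Set.Finite.subset hx fun i hi h => hi (by
        rw [mul_smul_comm, h, smul_zero]) } (fun i j h x hx => ?_) x
  refine (Set.finite_singleton i).subset fun l hl => ?_
  by_contra h
  exact hl (by rw [← hx.2.1, ← mul_assoc, he.ortho l i h, zero_mul])

/-- The form is `B a b = ∑ᶠ i, f i (a * b)`. The sum is finite since `e i * x ≠ 0` for only finitely
many `i`, and on `e_i A` only `f i` survives. -/
theorem hasGradedNakayamaForm_of_perfect (he : IsLocalFamily 𝒜 e) (ν : Equiv.Perm I) (d : I → H)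
    (f : I → A →ₗ[K] K) (hf : ∀ i, IsPerfect 𝒜 e i (ν i) (d i) (f i)) :
    HasGradedNakayamaForm 𝒜 e := by
  have hfin : ∀ x, {i | f i x ≠ 0}.Finite := fun x =>
    (finite_mul_ne_zero he.toIsDistinguishedFamily x).subset fun i hi h => hi (by
      rw [← (hf i).left, h, map_zero])
  let F : A →ₗ[K] K :=
    { toFun := fun x => ∑ᶠ i, f i x
      map_add' := fun x y => by
        simp only [map_add]
        exact finsum_add_distrib (hfin x) (hfin y)
      map_smul' := fun c x => by
        simp only [map_smul]
        exact (smul_finsum' c (hfin x)).symm }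
  have hF : ∀ i x, e i * x = x → F x = f i x := fun i x hx =>
    finsum_eq_single _ i fun l hl => by
      rw [← hx, ← (hf l).left, ← mul_assoc, he.ortho l i hl, zero_mul, map_zero]
  have hei : ∀ i x, e i * (e i * x) = e i * x := fun i x => by rw [← mul_assoc, (he.idem i).eq]
  let B : A →ₗ[K] A →ₗ[K] K := (LinearMap.mul K A).compr₂ F
  have hB : ∀ a b, B a b = F (a * b) := fun _ _ => rfl
  have hP := fun i j x => mem_Peirce he.toIsDistinguishedFamily (i := i) (j := j) (x := x)
  have hdeg : ∀ i j, ∀ s t, s + t ≠ d i → ∀ v ∈ Peirce K e i j ⊓ 𝒜 s,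
      ∀ w ∈ Peirce K e j (ν i) ⊓ 𝒜 t, B v w = 0 := by
    intro i j s t hst v hv w hw
    rw [hB, hF i _ (by rw [← mul_assoc, ((hP _ _ _).1 hv.1).1])]
    exact (hf i).deg _ hst _ (GradedAlgebraEI.mul_mem hv.2 hw.2)
  have hprj : ∀ i j, ∀ v ∈ Peirce K e i j, ∀ h, prj 𝒜 h v ∈ Peirce K e i j := by
    intro i j v hv h
    rw [hP] at hv ⊢
    rw [← prj_mul_left_zero (he.deg_zero i), ← prj_mul_right_zero (he.deg_zero j), hv.1, hv.2]
    exact ⟨rfl, rfl⟩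
  have hfd : ∀ i j h, FiniteDimensional K (Peirce K e i j ⊓ 𝒜 h : Submodule K A) := by
    intro i j h
    have := he.fd i j h
    exact Submodule.finiteDimensional_of_le (S₂ := peirce 𝒜 e i j h) fun x hx =>
      ⟨hx.2, (hP _ _ _).1 hx.1⟩
  have hl : ∀ i j, ∀ v ∈ Peirce K e i j, (∀ w ∈ Peirce K e j (ν i), B v w = 0) → v = 0 := by
    intro i j v hv h
    rw [hP] at hv
    refine (hf i).nondeg_right v hv.1 fun x => ?_
    have h1 := h (e j * x * e (ν i)) ((hP _ _ _).2 ⟨by rw [mul_assoc, hei],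
      by rw [mul_assoc, (he.idem _).eq]⟩)
    rw [hB, hF i _ (by rw [← mul_assoc, hv.1]), ← mul_assoc, (hf i).right, ← mul_assoc, hv.2] at h1
    exact h1
  have hr : ∀ i j, ∀ w ∈ Peirce K e j (ν i), (∀ v ∈ Peirce K e i j, B v w = 0) → w = 0 := by
    intro i j w hw h
    rw [hP] at hw
    refine (hf i).nondeg_left w hw.2 fun x => ?_
    have h1 := h (e i * x * e j) ((hP _ _ _).2 ⟨by rw [mul_assoc, hei],
      by rw [mul_assoc, (he.idem _).eq]⟩)
    rw [hB, hF i _ (by rw [mul_assoc, mul_assoc, hei]), mul_assoc, hw.1, mul_assoc,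
      (hf i).left] at h1
    exact h1
  refine ⟨B, ν, d, ⟨fun a b c => by rw [hB, hB, mul_assoc], fun i j => ⟨?_, ?_⟩, ?_, ?_⟩⟩
  · rintro ⟨a, b, hab⟩
    by_contra hj
    refine hab ?_
    rw [hB, hF i _ (by rw [← mul_assoc, hei]), ← mul_assoc, ← (hf i).right, mul_assoc,
      he.ortho _ _ hj, mul_zero, map_zero]
  · rintro rfl
    by_contra! h
    refine he.ne_zero (ν i) ((hf i).nondeg_left _ (he.idem _).eq fun x => ?_)
    have h1 := h x (e (ν i))
    rwa [(he.idem _).eq, hB, hF i _ (by rw [← mul_assoc, hei]), mul_assoc, (hf i).left] at h1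
  · intro i j s t a ha b hb hab
    by_contra hst
    exact hab (hdeg i j s t hst a ha b hb)
  · intro i j
    refine ⟨bijOn_gradedDual (hprj i j) (hprj j (ν i)) (hfd j (ν i)) (hdeg i j) (hl i j) (hr i j),
      ?_⟩
    exact bijOn_gradedDual (B := B.flip) (d := d i) (hprj j (ν i)) (hprj i j) (hfd i j)
      (fun s t hst v hv w hw => hdeg i j t s (by rwa [add_comm]) w hw v hv) (hr i j) (hl i j)

/-- The form is `x ↦ B (e i * x) (e (ν i))`. By associativity it takes `x * b` to `B (e i * x) b`
when `b * e (ν i) = b`, so nondegeneracy can be tested on the Peirce components one at a time. -/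
theorem IsGradedNakayamaForm.isPerfect {B : A →ₗ[K] A →ₗ[K] K} {ν : Equiv.Perm I} {d : I → H}
    (he : IsDistinguishedFamily 𝒜 e) (hB : IsGradedNakayamaForm 𝒜 e B ν d) (i : I) :
    IsPerfect 𝒜 e i (ν i) (d i) (B.flip (e (ν i)) ∘ₗ LinearMap.mulLeft K (e i)) where
  left x := by
    change B (e i * (e i * x)) _ = B (e i * x) _
    rw [← mul_assoc, (he.idem i).eq]
  right x := by
    change B (e i * (x * e (ν i))) _ = B (e i * x) _
    rw [← mul_assoc, hB.assoc, (he.idem _).eq]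
  deg t ht x hx := by
    change B (e i * x) _ = 0
    by_contra hne
    rw [← (he.idem (ν i)).eq, ← hB.assoc, ← prj_same hx] at hne
    have h1 := he.comp_mem i (ν i) t x
    have := hB.degree i (ν i) t 0 _ ⟨(mem_Peirce he).2 h1.2, h1.1⟩ (e (ν i))
      ⟨(mem_Peirce he).2 (he.idem_mem _).2, he.deg_zero _⟩ hne
    rw [add_zero] at this
    exact ht this
  nondeg_left b hb h := by
    refine he.eq_zero_of_left fun l => ?_
    have h1 := (hB.nondeg i l).1.injOn (x₁ := ⟨e l * b, (mem_Peirce he).2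
      ⟨by rw [← mul_assoc, (he.idem l).eq], by rw [mul_assoc, hb]⟩⟩) (x₂ := 0) trivial trivial
      (LinearMap.ext fun ⟨v, hv⟩ => ?_)
    · exact congrArg Subtype.val h1
    · have hv := (mem_Peirce he).1 hv
      change B v (e l * b) = B v 0
      rw [map_zero, ← hB.assoc, hv.2]
      have h2 : B (e i * (v * b)) (e (ν i)) = 0 := h v
      rwa [← mul_assoc, hB.assoc, hb, hv.1] at h2
  nondeg_right a ha h := by
    refine he.eq_zero_of_right fun l => ?_
    have h1 := (hB.nondeg i l).2.injOn (x₁ := ⟨a * e l, (mem_Peirce he).2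
      ⟨by rw [← mul_assoc, ha], by rw [mul_assoc, (he.idem l).eq]⟩⟩) (x₂ := 0) trivial trivial
      (LinearMap.ext fun ⟨v, hv⟩ => ?_)
    · exact congrArg Subtype.val h1
    · have hv := (mem_Peirce he).1 hv
      change B (a * e l) v = B 0 v
      rw [map_zero, LinearMap.zero_apply, hB.assoc, hv.1]
      have h2 : B (e i * (a * v)) (e (ν i)) = 0 := h v
      rwa [← mul_assoc, hB.assoc, hv.2, ha] at h2

end Perfect

/-! ### Socles, and the perfect pairings they provide -/

section Socle

variable {K H A I : Type u} [Field K] [AddCommGroup H] [NonUnitalRing A] [Module K A]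
  [IsScalarTower K A A] [SMulCommClass K A A] {𝒜 : H → Submodule K A} {e : I → A}

namespace GrMod

theorem eq_of_sub {M : GrMod 𝒜} {S S' : Submodule (OpRing K H A) M.carrier}
    (h : S.restrictScalars K = S'.restrictScalars K) : S = S' :=
  Submodule.restrictScalars_injective K _ _ h

theorem sub_of_eq {M : GrMod 𝒜} {S S' : Submodule (OpRing K H A) M.carrier}
    (h : S = S') : S.restrictScalars K = S'.restrictScalars K := congrArg _ h

theorem isGrSimple_iff (M : GrMod 𝒜) : M.IsGrSimple ↔ IsSimpleModule (OpRing K H A) M.carrier := by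
  rw [isSimpleModule_iff]
  constructor
  · rintro ⟨h1, h2⟩
    refine { toNontrivial := inferInstance, eq_bot_or_eq_top := fun N => ?_ }
    rcases h2 (M.subEquiv.symm N) with h | h
    · exact Or.inl (eq_of_sub (M := M) h)
    · exact Or.inr (eq_of_sub (M := M) h)
  · intro h
    refine ⟨?_, fun N => ?_⟩
    · rw [← Submodule.nontrivial_iff (OpRing K H A)]
      exact h.toNontrivial
    · rcases h.eq_bot_or_eq_top (M.subEquiv N) with h | h
      · exact Or.inl (sub_of_eq (M := M) h)
      · exact Or.inr (sub_of_eq (M := M) h)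

theorem subEquiv_eq_bot {M : GrMod 𝒜} {N : GrSub M} : M.subEquiv N = ⊥ ↔ N.sub = ⊥ :=
  ⟨fun h => sub_of_eq (M := M) h, fun h => eq_of_sub (M := M) h⟩

variable [GradedAlgebraEI 𝒜]

/-- The two ways of regarding a graded submodule as a module agree. -/
noncomputable def subLinEquiv {M : GrMod 𝒜} (N : GrSub M) :
    N.toGrMod.carrier ≃ₗ[OpRing K H A] M.subEquiv N :=
  LinearEquiv.ofBijective (N.incl.codRestrict (M.subEquiv N) fun x => x.2)
    ⟨fun _ _ h => N.incl_injective (congrArg Subtype.val h), fun x => ⟨⟨x.1, x.2⟩, rfl⟩⟩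

theorem toGrMod_isGrSimple_iff {M : GrMod 𝒜} (N : GrSub M) :
    N.toGrMod.IsGrSimple ↔ IsSimpleModule (OpRing K H A) (M.subEquiv N) := by
  rw [isGrSimple_iff]
  exact (subLinEquiv N).isSimpleModule_iff

theorem le_socle {M : GrMod 𝒜} (S : Submodule (OpRing K H A) M.carrier)
    [hS : IsSimpleModule (OpRing K H A) S] : S ≤ M.subEquiv M.socle := by
  intro x hx
  have h : (M.subEquiv.symm S).toGrMod.IsGrSimple := by
    rw [toGrMod_isGrSimple_iff, OrderIso.apply_symm_apply]
    exact hS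
  exact Submodule.mem_iSup_of_mem
    (p := fun S : {S : GrSub M // S.toGrMod.IsGrSimple} => S.1.sub) ⟨_, h⟩ hx

theorem socle_eq (M : GrMod 𝒜) : M.subEquiv M.socle =
    sSup {S : Submodule (OpRing K H A) M.carrier | IsSimpleModule (OpRing K H A) S} := by
  refine le_antisymm (fun x hx => ?_) (sSup_le fun S hS => ?_)
  · have : (⨆ S : {S : GrSub M // S.toGrMod.IsGrSimple}, S.1.sub) ≤
        (sSup {S : Submodule (OpRing K H A) M.carrier |
          IsSimpleModule (OpRing K H A) S}).restrictScalars K := by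
      refine iSup_le fun S y hy => ?_
      have h : M.subEquiv S.1 ≤ sSup {S : Submodule (OpRing K H A) M.carrier |
          IsSimpleModule (OpRing K H A) S} := le_sSup ((toGrMod_isGrSimple_iff _).1 S.2)
      exact h hy
    exact this hx
  · have : IsSimpleModule (OpRing K H A) S := hS
    exact le_socle S

theorem isEssential_iff {M : GrMod 𝒜} (N : GrSub M) : N.IsEssential ↔
    ∀ L : Submodule (OpRing K H A) M.carrier, L ≠ ⊥ → L ⊓ M.subEquiv N ≠ ⊥ := by
  constructor
  · intro h L hL h'
    refine h (M.subEquiv.symm L) (fun h0 => hL ?_) ?_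
    · exact eq_of_sub (M := M) (S := L) (S' := ⊥) h0
    · exact sub_of_eq (M := M) (S := L ⊓ M.subEquiv N) (S' := ⊥) h'
  · intro h L hL h'
    refine h (M.subEquiv L) (fun h0 => hL (subEquiv_eq_bot.1 h0)) ?_
    exact eq_of_sub (M := M) (S := M.subEquiv L ⊓ M.subEquiv N) (S' := ⊥) h'

/-- A nonzero element contained in all nonzero graded submodules generates the socle. -/
theorem socle_of_min {M : GrMod 𝒜} {z : M.carrier} (hz0 : z ≠ 0)
    (hz : ∀ N : Submodule (OpRing K H A) M.carrier, N ≠ ⊥ → z ∈ N) :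
    M.subEquiv M.socle = Submodule.span (OpRing K H A) {z} ∧ M.socle.toGrMod.IsGrSimple ∧
      M.socle.IsEssential := by
  have hle : ∀ N : Submodule (OpRing K H A) M.carrier, N ≠ ⊥ →
      Submodule.span (OpRing K H A) {z} ≤ N := fun N hN =>
    Submodule.span_le.2 (Set.singleton_subset_iff.2 (hz N hN))
  have hne : Submodule.span (OpRing K H A) {z} ≠ ⊥ := by
    rwa [Ne, Submodule.span_singleton_eq_bot]
  have hatom : IsAtom (Submodule.span (OpRing K H A) {z}) :=
    ⟨hne, fun N hN => by
      by_contra h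
      exact hN.not_ge (hle N h)⟩
  have hs := isSimpleModule_iff_isAtom.2 hatom
  have hsoc : M.subEquiv M.socle = Submodule.span (OpRing K H A) {z} := by
    refine le_antisymm ?_ (le_socle _)
    rw [socle_eq]
    refine sSup_le fun S hS => ?_
    have hS : IsAtom S := isSimpleModule_iff_isAtom.1 hS
    have := hle S hS.1
    rcases hS.le_iff.1 this with h | h
    · exact absurd h hne
    · exact h.ge
  refine ⟨hsoc, ?_, ?_⟩
  · rw [toGrMod_isGrSimple_iff, hsoc]
    exact hs
  · rw [isEssential_iff, hsoc]
    intro L hL h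
    exact hne (eq_bot_iff.2 ((le_inf (hle L hL) le_rfl).trans h.le))

end GrMod

variable [GradedAlgebraEI 𝒜]

/-- The annihilator of `z` in `A e_i` is a graded submodule, as the kernel of `b ↦ b z`. An element
outside `maxIdeal` would put `e i` into it, contradicting `e_i z = z ≠ 0`. -/
theorem Ps.maxIdeal_of_act_eq_zero (he : IsDistinguishedFamily 𝒜 e) (hl : HasLocalCorners 𝒜 e)
    {M : GrMod 𝒜} {i : I} {h : H} {z : M.carrier} (hz : z ∈ M.pc e i h) (hz0 : z ≠ 0)
    {b : A} (hb : b * e i = b) (hbz : M.act b z = 0) : b ∈ ideal (hl.maxIdeal he i) := by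
  rw [HasLocalCorners.mem_maxIdeal]
  intro y
  by_contra hy
  obtain ⟨w, hw, hwe⟩ := HasLocalCorners.exists_inv_of_notMem he hl (he.comp_mem i i 0 _) hy
  obtain ⟨q, hq⟩ := Ps.exists_lift (he := he) (k := -h) (M := M) (m := z) (by rwa [neg_neg])
  obtain ⟨c, hc⟩ := Ps.exists_val (he := he) (k := -h) hb
  have hcq : c ∈ LinearMap.ker q := by
    rw [LinearMap.mem_ker, hq, hc, hbz]
  have h1 := Submodule.act_mem _ w (Submodule.act_mem _ (e i)
    (Submodule.proj_mem _ h (Submodule.act_mem _ y hcq)))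
  rw [LinearMap.mem_ker, hq, Ps.val_act, Ps.val_act, Ps.val_proj, neg_add_cancel, Ps.val_act, hc,
    ← hb, ← mul_assoc y, prj_mul_right_zero (he.deg_zero i), ← mul_assoc (e i), hwe, hz.2] at h1
  exact hz0 h1

/-- The projection of `A e_i` onto its simple top. -/
noncomputable def Ps.top (he : IsDistinguishedFamily 𝒜 e) (i : I) (s : H) :
    (Ps he i s).carrier →ₗ[OpRing K H A] (((Ae he i).quot (Je he i)).shift s).carrier :=
  GrMod.linOf (M := Ps he i s) (N := ((Ae he i).quot (Je he i)).shift s)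
    (Je he i).sub.mkQ (fun _ _ => rfl) fun _ m hm => ⟨m, hm, rfl⟩

theorem Ps.top_surjective (he : IsDistinguishedFamily 𝒜 e) (i : I) (s : H) :
    Function.Surjective (Ps.top he i s) := (Je he i).sub.mkQ_surjective

theorem Ps.top_eq_zero (he : IsDistinguishedFamily 𝒜 e) (hl : HasLocalCorners 𝒜 e) {i : I} {s : H}
    {b : (Ps he i s).carrier} :
    Ps.top he i s b = 0 ↔ Ps.val he i s b ∈ ideal (hl.maxIdeal he i) :=
  (Submodule.Quotient.mk_eq_zero (p := (Je he i).sub) (x := b)).trans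
    (HasLocalCorners.mem_Je he hl)

/-- The socle of a module with a suitable generator of its socle is a shift of the simple top of
`A e_i`. -/
theorem socle_iso (he : IsDistinguishedFamily 𝒜 e) (hl : HasLocalCorners 𝒜 e) {M : GrMod 𝒜}
    {i : I} {h : H} {z : M.carrier} (hz : z ∈ M.pc e i h) (hz0 : z ≠ 0)
    (hb : ∀ b ∈ ideal (hl.maxIdeal he i), M.act b z = 0)
    (hmin : ∀ N : Submodule (OpRing K H A) M.carrier, N ≠ ⊥ → z ∈ N) :
    Nonempty (M.socle.toGrMod ≅ ((Ae he i).quot (Je he i)).shift (-h)) := by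
  obtain ⟨q, hq⟩ := Ps.exists_lift (he := he) (k := -h) (M := M) (m := z) (by rwa [neg_neg])
  let r := Ps.top he i (-h)
  have hr : Function.Surjective r := Ps.top_surjective he i (-h)
  -- The annihilator of `z` in `A e_i` is exactly the maximal graded submodule, so `A z` is the top
  -- of `A e_i`.
  have hker : LinearMap.ker r = LinearMap.ker q := by
    ext b
    have h1 : b ∈ LinearMap.ker r ↔ Ps.val he i (-h) b ∈ ideal (hl.maxIdeal he i) :=
      Ps.top_eq_zero he hl
    rw [h1, LinearMap.mem_ker, hq]
    exact ⟨hb _, Ps.maxIdeal_of_act_eq_zero he hl hz hz0 (Ps.val_mul b)⟩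
  have hrange : LinearMap.range q = M.subEquiv M.socle := by
    rw [(GrMod.socle_of_min hz0 hmin).1]
    ext m
    rw [he.mem_span_singleton hz]
    constructor
    · rintro ⟨b, rfl⟩
      exact ⟨_, (hq b).symm⟩
    · rintro ⟨a, rfl⟩
      obtain ⟨c, hc⟩ := Ps.exists_val (he := he) (k := -h) (x := a * e i) (i := i) (by
        rw [mul_assoc, (he.idem i).eq])
      exact ⟨c, by rw [hq, hc, M.mul_act, hz.2]⟩
  exact ⟨GrMod.isoOf ((GrMod.subLinEquiv M.socle).trans <|
    (LinearEquiv.ofEq _ _ hrange.symm).trans <| q.quotKerEquivRange.symm.trans <|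
    (Submodule.quotEquivOfEq _ _ hker.symm).trans <| r.quotKerEquivOfSurjective hr)⟩

/-- `A e_i` and its trivial shift. -/
noncomputable def Ps.zeroEquiv (he : IsDistinguishedFamily 𝒜 e) (i : I) :
    (Ae he i).carrier ≃ₗ[OpRing K H A] (Ps he i 0).carrier :=
  LinearEquiv.ofBijective (GrMod.linOf (M := Ae he i) (N := Ps he i 0) LinearMap.id
    (fun _ _ => rfl) fun h m hm => by
      change m ∈ (Ae he i).gr (0 + h)
      rwa [zero_add]) Function.bijective_id

/-- The properties of the socle of `A e_j` in the presence of a perfect pairing. -/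
theorem IsPerfect.socle (he : IsLocalFamily 𝒜 e) {i j : I} {d : H} {f : A →ₗ[K] K}
    (hf : IsPerfect 𝒜 e i j d f) :
    (Ae he.toIsDistinguishedFamily j).socle.toGrMod.IsGrSimple ∧
    (Ae he.toIsDistinguishedFamily j).socle.IsEssential ∧
    ∃ h : H, Nonempty ((Ae he.toIsDistinguishedFamily j).socle.toGrMod ≅
      ((Ae he.toIsDistinguishedFamily i).quot (Je he.toIsDistinguishedFamily i)).shift h) := by
  have hd := he.toIsDistinguishedFamily
  -- The dual is shifted by `d` so that it matches `A e_j` with shift `d - d = 0`.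
  obtain ⟨z, hz, hz0, hzb, hmin⟩ := Dmod.exists_socle (he := hd) (k := d) he.loc (he.fd i i 0)
  obtain ⟨φ⟩ := hf.exists_equiv he d
  have hE : ∃ E : (Ae hd j).carrier ≃ₗ[OpRing K H A] (Dmod hd i d).carrier, True := by
    rw [sub_self] at φ
    exact ⟨(Ps.zeroEquiv hd j).trans φ, trivial⟩
  obtain ⟨E, -⟩ := hE
  set y := E.symm z with hy
  have hy0 : y ≠ 0 := by rwa [hy, Ne, LinearEquiv.map_eq_zero_iff]
  have hact : ∀ b, (Ae hd j).act b y = E.symm ((Dmod hd i d).act b z) := fun b =>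
    (GrMod.lin_act E.symm.toLinearMap b z).symm
  have hypc : y ∈ (Ae hd j).pc e i d :=
    ⟨GrMod.lin_gr E.symm.toLinearMap hz.1, by rw [hact, hz.2]⟩
  have hymin : ∀ N : Submodule (OpRing K H A) (Ae hd j).carrier, N ≠ ⊥ → y ∈ N := by
    intro N hN
    have h1 := hmin (N.map E.toLinearMap) (by
      rwa [Ne, Submodule.map_eq_bot_iff (e := E)])
    obtain ⟨n, hn, hnz⟩ := h1
    have : n = y := by rw [hy, ← hnz]; exact (E.symm_apply_apply n).symm
    exact this ▸ hn
  obtain ⟨-, h1, h2⟩ := GrMod.socle_of_min hy0 hymin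
  refine ⟨h1, h2, -d, socle_iso hd he.loc hypc hy0 (fun b hb => ?_) hymin⟩
  rw [hact, hzb b hb, map_zero]

/-- Elementwise description of `A e_j` having a simple essential socle isomorphic to a shift of
the top of `A e_i`. -/
theorem exists_socle_element (he : IsDistinguishedFamily 𝒜 e) (hl : HasLocalCorners 𝒜 e) {i j : I}
    {s : H} (h1 : (Ae he j).socle.toGrMod.IsGrSimple) (h2 : (Ae he j).socle.IsEssential)
    (φ : (Ae he j).socle.toGrMod ≅ ((Ae he i).quot (Je he i)).shift s) :
    ∃ h, ∃ z ∈ peirce 𝒜 e i j h, z ≠ 0 ∧ ∀ k t, ∀ y ∈ peirce 𝒜 e k j t, y ≠ 0 →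
      ∃ a ∈ peirce 𝒜 e i k (h - t), a * y = z := by
  obtain ⟨r, hr⟩ : ∃ r, r = Ps.top he i s := ⟨_, rfl⟩
  let q := (Ps.zeroEquiv he j).toLinearMap ∘ₗ (Ae he j).socle.incl ∘ₗ
    (GrMod.linEquivOf φ).symm.toLinearMap ∘ₗ r
  set z := q (Ps.gen he i s) with hz
  have hzpc : z ∈ (Ps he j 0).pc e i (-s) := Ps.lin_gen q
  have hz0 : z ≠ 0 := by
    intro h0
    have h3 := (Ps.zeroEquiv he j).injective (h0.trans (map_zero (Ps.zeroEquiv he j)).symm)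
    have h4 := (Ae he j).socle.incl_injective (h3.trans (map_zero _).symm)
    have h5 : r (Ps.gen he i s) = 0 := (GrMod.linEquivOf φ).symm.map_eq_zero_iff.1 h4
    rw [hr, Ps.top_eq_zero he hl, Ps.val_gen] at h5
    have h7 := (HasLocalCorners.mem_maxIdeal he hl).1 h5 (e i)
    rw [(he.idem i).eq, prj_same (he.deg_zero i), (he.idem i).eq, (he.idem i).eq] at h7
    exact HasLocalCorners.one_notMem_nonunits he hl i h7
  have hzv := Ps.mem_pc.1 hzpc
  rw [zero_add] at hzv
  refine ⟨-s, Ps.val he j 0 z, hzv, fun h => hz0 (Ps.val_injective (h.trans (map_zero _).symm)),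
    fun k t y hy hy0 => ?_⟩
  obtain ⟨y', hy'⟩ := Ps.exists_val (he := he) (k := 0) hy.2.2
  have hypc : y' ∈ (Ps he j 0).pc e k t := Ps.mem_pc.2 (by rwa [hy', zero_add])
  -- A simple essential socle is contained in every nonzero graded submodule, in particular in the
  -- one generated by `y'`.
  have hzy : z ∈ Submodule.span (OpRing K H A) {y'} := by
    rw [GrMod.toGrMod_isGrSimple_iff] at h1
    have hat := isSimpleModule_iff_isAtom.1 h1
    rw [GrMod.isEssential_iff] at h2
    let L := (Submodule.span (OpRing K H A) {y'}).map (Ps.zeroEquiv he j).symm.toLinearMap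
    have hL : L ≠ ⊥ := by
      rw [Ne, Submodule.map_eq_bot_iff (e := (Ps.zeroEquiv he j).symm),
        Submodule.span_singleton_eq_bot]
      rintro rfl
      exact hy0 (by rw [← hy', map_zero])
    have hle : (Ae he j).subEquiv (Ae he j).socle ≤ L := by
      rcases hat.le_iff.1 (inf_le_right : L ⊓ (Ae he j).subEquiv (Ae he j).socle ≤ _) with h | h
      · exact absurd h (h2 L hL)
      · exact h ▸ inf_le_left
    obtain ⟨w, hw, hwz⟩ := hle ((GrMod.subLinEquiv (Ae he j).socle
      ((GrMod.linEquivOf φ).symm (r (Ps.gen he i s)))).2)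
    have hw' : (Ps.zeroEquiv he j).symm w = (Ae he j).socle.incl
      ((GrMod.linEquivOf φ).symm (r (Ps.gen he i s))) := hwz
    rw [LinearEquiv.symm_apply_eq] at hw'
    have hwz' : w = z := hw'
    exact hwz' ▸ hw
  obtain ⟨a, ha⟩ := (he.mem_span_singleton hypc).1 hzy
  have ha' : a * y = Ps.val he j 0 z := by rw [← ha, Ps.val_act, hy']
  -- As `y` and `z` are homogeneous Peirce elements, the matching component of `a` already carries
  -- `y` to `z`.
  refine ⟨_, he.comp_mem i k (-s - t) a, ?_⟩
  rw [mul_assoc, hy.2.1, mul_assoc, ← prj_mul_right hy.1, sub_add_cancel, ha', prj_same hzv.1,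
    hzv.2.1]

/-- Perfect pairings from simple essential socles on both sides. -/
theorem exists_perfect_of_socles (he : IsLocalFamily 𝒜 e) {ν ν' : I → I}
    (hν : Function.Injective ν)
    (hz : ∀ j, ∃ h, ∃ z ∈ peirce 𝒜 e (ν' j) j h, z ≠ 0 ∧ ∀ k t, ∀ y ∈ peirce 𝒜 e k j t, y ≠ 0 →
      ∃ a ∈ peirce 𝒜 e (ν' j) k (h - t), a * y = z)
    (hw : ∀ i, ∃ h, ∃ w ∈ peirce 𝒜 e i (ν i) h, w ≠ 0 ∧ ∀ k t, ∀ y ∈ peirce 𝒜 e i k t, y ≠ 0 →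
      ∃ a ∈ peirce 𝒜 e k (ν i) (h - t), y * a = w) (i : I) :
    ∃ d f, IsPerfect 𝒜 e i (ν i) d f := by
  have hd := he.toIsDistinguishedFamily
  obtain ⟨s, w, hwm, hw0, hwa⟩ := hw i
  obtain ⟨h, z, hzm, hz0, hza⟩ := hz (ν i)
  -- If `w * c ≠ 0`, it can be multiplied back to `w = w * c * a`. Then `e (ν i) - c * a` is not
  -- invertible, for it is killed by `w ≠ 0`; so `c * a` is invertible.
  have hinv : ∀ m t, ∀ c ∈ peirce 𝒜 e (ν i) m t, w * c ≠ 0 →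
      ∃ a u, c * (a * u) = e (ν i) ∧ a * u ∈ peirce 𝒜 e m (ν i) (-t) := by
    intro m t c hc hwc
    obtain ⟨a, ha, hca⟩ := hwa m _ _ (peirce_mul hwm hc) hwc
    have hs : s - (s + t) = -t := by abel
    rw [hs] at ha
    have hp : c * a ∈ peirce 𝒜 e (ν i) (ν i) 0 := peirce_mul' hc ha (add_neg_cancel t)
    rcases he.loc _ _ hp with ⟨u, hu, -, h1⟩ | ⟨u, hu, -, h1⟩
    · exact ⟨a, u, by rw [← mul_assoc, h1], peirce_mul' ha hu (add_zero _)⟩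
    · refine absurd ?_ hw0
      rw [← hwm.2.2, ← h1, ← mul_assoc, mul_sub, hwm.2.2, ← mul_assoc, hca, sub_self, zero_mul]
  obtain ⟨a, ha, haw⟩ := hza i s w hwm hw0
  -- Choose `c` with `z * c = w'`. Since `z = a * w`, the product `w * c` is nonzero, so `c` has a
  -- right inverse; this identifies `ν (ν' (ν i))` with `ν i`, and `ν` is injective.
  have hk : ν' (ν i) = i := by
    obtain ⟨s', w', hwm', hw0', hwa'⟩ := hw (ν' (ν i))
    obtain ⟨c, hc, hzc⟩ := hwa' (ν i) _ z hzm hz0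
    refine hν ?_
    by_contra hne
    by_cases hwc : w * c = 0
    · rw [← haw, mul_assoc, hwc, mul_zero] at hzc
      exact hw0' hzc.symm
    · obtain ⟨a, u, h1, h2⟩ := hinv _ _ c hc hwc
      exact hne (he.eq_of_mul_eq hc h2 h1).symm
  rw [hk] at hzm ha hza
  -- Now the left socle element `z` and the right socle element `w` lie in the same `e_i A e_{ν i}`,
  -- and `z * c = w` with `c` right invertible. Hence `z` is also a right multiple of `w`, and can
  -- be reached from both sides.
  obtain ⟨c, hc, hzc⟩ := hwa (ν i) _ z hzm hz0
  have hwc : w * c ≠ 0 := fun h0 => hw0 (by rw [← hzc, ← haw, mul_assoc, h0, mul_zero])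
  obtain ⟨c', u, hcu, -⟩ := hinv _ _ c hc hwc
  have hzw : z = w * (c' * u) := by rw [← hzc, mul_assoc, hcu, hzm.2.2]
  -- Any linear form with value `1` at `z` works, since every nonzero homogeneous element of `A e_{ν
  -- i}` or `e_i A` lying in a Peirce component has `z` as a multiple.
  obtain ⟨g, hg, -⟩ := exists_form (K := K) (⊥ : Submodule K A) hz0
  let f : A →ₗ[K] K := g ∘ₗ LinearMap.mulRight K (e (ν i)) ∘ₗ LinearMap.mulLeft K (e i) ∘ₗ prj 𝒜 h
  have hf : ∀ x, f x = g (e i * prj 𝒜 h x * e (ν i)) := fun _ => rfl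
  refine ⟨h, f, ⟨fun x => ?_, fun x => ?_, fun t ht x hx => ?_, fun b hb h0 => ?_,
    fun b hb h0 => ?_⟩⟩
  · rw [hf, hf, prj_mul_left_zero (hd.deg_zero i), ← mul_assoc, (hd.idem i).eq]
  · rw [hf, hf, prj_mul_right_zero (hd.deg_zero _), ← mul_assoc, mul_assoc _ (e (ν i)),
      (hd.idem _).eq]
  · rw [hf, prj_ne ht hx]
    simp
  · by_contra hb0
    have : ∃ k t, e k * prj 𝒜 t b ≠ 0 := by
      by_contra! hc
      exact hb0 (hd.eq_zero_of_comp (M := regular 𝒜) fun k t => hc k t)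
    obtain ⟨k, t, hkt⟩ := this
    have hbt : prj 𝒜 t b * e (ν i) = prj 𝒜 t b := by
      rw [← prj_mul_right_zero (hd.deg_zero _), hb]
    have hy := hd.comp_mem k (ν i) t b
    rw [mul_assoc, hbt] at hy
    obtain ⟨a, ha, hay⟩ := hza k t _ hy hkt
    have h1 := prj_mul_left (k := t) ha.1 b
    rw [sub_add_cancel] at h1
    have h2 := h0 a
    rw [hf, h1, ← ha.2.2, mul_assoc a, hay, hzm.2.1, hzm.2.2, hg] at h2
    exact one_ne_zero h2
  · by_contra hb0
    have : ∃ k t, prj 𝒜 t b * e k ≠ 0 := by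
      by_contra! hc
      exact hb0 (eq_zero_of_proj (GradedAlgebraEI.internal (𝒜 := 𝒜)) fun t =>
        hd.eq_zero_of_right fun k => hc k t)
    obtain ⟨k, t, hkt⟩ := this
    have hbt : e i * prj 𝒜 t b = prj 𝒜 t b := by
      rw [← prj_mul_left_zero (hd.deg_zero _), hb]
    have hy := hd.comp_mem i k t b
    rw [hbt] at hy
    obtain ⟨a, ha, hay⟩ := hwa k t _ hy hkt
    have hz' : z = prj 𝒜 t b * e k * prj 𝒜 (h - t) (a * (c' * u)) := by
      have h1 := prj_mul_left (k := h - t) hy.1 (a * (c' * u))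
      rw [add_sub_cancel, ← mul_assoc, hay, ← hzw, prj_same hzm.1] at h1
      exact h1
    have hx : e k * prj 𝒜 (h - t) (a * (c' * u)) ∈ 𝒜 (h - t) := by
      have := GradedAlgebraEI.mul_mem (hd.deg_zero k)
        (prj_mem (𝒜 := 𝒜) (h - t) (a * (c' * u)))
      rwa [zero_add] at this
    have h1 := prj_mul_right (k := t) hx b
    rw [add_sub_cancel] at h1
    have h2 := h0 (e k * prj 𝒜 (h - t) (a * (c' * u)))
    rw [hf, h1, ← mul_assoc (prj 𝒜 t b), ← hz', hzm.2.1, hzm.2.2, hg] at h2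
    exact one_ne_zero h2

/-- If the graded dual of `e_i A` is projective, it is a shift of some `A e_j`. -/
theorem exists_perfect_of_projective (he : IsLocalFamily 𝒜 e) (i : I)
    (hP : Projective (Dmod he.toIsDistinguishedFamily i 0)) :
    ∃ j d f, IsPerfect 𝒜 e i j d f := by
  have hd := he.toIsDistinguishedFamily
  obtain ⟨z, hz, hz0, -, hmin⟩ := Dmod.exists_socle (he := hd) (k := 0) he.loc (he.fd i i 0)
  obtain ⟨Λ, j, k, g, hg⟩ := exists_cover hd (Dmod hd i 0)
  obtain ⟨s, hs⟩ := (GrMod.projective_iff _).1 hP _ _ g LinearMap.id hg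
  -- Some coordinate of the section `s` is nonzero on `z`. As `z` lies in every nonzero graded
  -- submodule, that coordinate is injective.
  obtain ⟨l, hl⟩ : ∃ l, GrMod.dsumπ _ l (s z) ≠ 0 := by
    by_contra! h
    refine hz0 ?_
    have := hs z
    rw [GrMod.dsum_ext (x := s z) (y := 0) (fun l => by rw [h, map_zero]), map_zero] at this
    exact this.symm
  obtain ⟨j', k', t, ht⟩ : ∃ j' k', ∃ t : (Dmod hd i 0).carrier →ₗ[OpRing K H A]
      (Ps hd j' k').carrier, Function.Injective t := by
    refine ⟨j l, k l, GrMod.dsumπ (fun l => Ps hd (j l) (k l)) l ∘ₗ s, ?_⟩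
    rw [← LinearMap.ker_eq_bot]
    by_contra h
    exact hl (hmin _ h)
  -- Injectivity of the dual splits `t`. The idempotent endomorphism `t ∘ r` of `A e_{j'}` is right
  -- multiplication by an idempotent of the local ring at `j'`; it is nonzero, so it is the identity
  -- and `t` is an isomorphism.
  obtain ⟨r, hr⟩ := (GrMod.injective_iff _).1 (Dmod.injective hd i 0) _ _ t LinearMap.id ht
  set c := t (r (Ps.gen hd j' k')) with hc
  have hcm := Ps.mem_pc.1 (Ps.lin_gen (t ∘ₗ r))
  rw [add_neg_cancel, LinearMap.comp_apply, ← hc] at hcm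
  have hact : ∀ b, t (r b) = (Ps hd j' k').act (Ps.val hd j' k' b) c := fun b =>
    Ps.lin_eq (t ∘ₗ r) b
  have hcc : Ps.val hd j' k' c * Ps.val hd j' k' c = Ps.val hd j' k' c := by
    have h1 : t (r c) = c := by rw [hc, hr]; rfl
    rw [hact] at h1
    conv_rhs => rw [← h1]
    rfl
  rcases HasLocalCorners.eq_zero_or_one hd he.loc hcm hcc with h0 | h1
  · refine absurd (ht ?_) hz0
    have h2 := hact (t z)
    rw [hr, Ps.val_injective (h0.trans (map_zero _).symm), map_zero] at h2
    rw [map_zero]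
    exact h2
  · have hcg : c = Ps.gen hd j' k' := Ps.val_injective h1
    have hrt : ∀ b, t (r b) = b := fun b => by rw [hact, hcg, Ps.act_gen]
    have hrinj : Function.Injective r := fun x y hxy => by rw [← hrt x, ← hrt y, hxy]
    -- The pairing is the form corresponding to the generator of `A e_{j'}`.
    set φ := r (Ps.gen hd j' k') with hφ
    have hφm := Ps.lin_gen r
    have hφm' := Dmod.mem_pc.1 hφm
    have hrv : ∀ b x, Dmod.val hd i 0 (r b) x = Dmod.val hd i 0 φ (x * Ps.val hd j' k' b) :=
      fun b x => by rw [Ps.lin_eq, Dmod.val_act, dact_apply]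
    refine ⟨j', k', Dmod.val hd i 0 φ, ⟨Dmod.val_left φ, fun x => ?_, ?_, fun b hb h => ?_,
      fun a ha h => ?_⟩⟩
    · have h2 := hrv (Ps.gen hd j' k') x
      rw [Ps.val_gen] at h2
      exact h2.symm
    · have := hφm'.2
      rwa [zero_sub, neg_neg] at this
    · obtain ⟨b', rfl⟩ := Ps.exists_val (he := hd) (k := k') hb
      have h2 : r b' = 0 := Dmod.val_injective (LinearMap.ext fun x => by
        rw [hrv, h, map_zero]; rfl)
      rw [hrinj (h2.trans (map_zero r).symm), map_zero]
    · refine Dmod.separates (he := hd) (k := 0) ha fun g => ?_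
      obtain ⟨b, rfl⟩ : ∃ b, r b = g := ⟨t g, hr g⟩
      rw [hrv, h]

/-- Each index determines its partner: `IsPerfect.unique` applied to `A` gives surjectivity of `ν`,
and applied to the opposite algebra gives injectivity. -/
theorem exists_perm (he : IsLocalFamily 𝒜 e) (h1 : ∀ i, ∃ j d f, IsPerfect 𝒜 e i j d f)
    (h2 : ∀ j, ∃ i d f, IsPerfect 𝒜 e i j d f) :
    ∃ (ν : Equiv.Perm I) (d : I → H) (f : I → A →ₗ[K] K),
      ∀ i, IsPerfect 𝒜 e i (ν i) (d i) (f i) := by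
  choose ν d f hf using h1
  have hb : Function.Bijective ν := by
    refine ⟨fun i i' h => ?_, fun j => ?_⟩
    · have h3 := (hf i').op
      rw [← h] at h3
      exact (hf i).op.unique he.op h3
    · obtain ⟨i, d', f', hf'⟩ := h2 j
      exact ⟨i, (hf i).unique he hf'⟩
  exact ⟨Equiv.ofBijective ν hb, d, f, hf⟩

end Socle

/-! ### Chain conditions, Baer's criterion and embeddings into sums of duals -/

section Chain

variable {K H A I : Type u} [Field K] [AddCommGroup H] [NonUnitalRing A] [Module K A]
  [IsScalarTower K A A] [SMulCommClass K A A] {𝒜 : H → Submodule K A} {e : I → A}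

namespace GrMod

/-- Generators over the ring of operations may use degree projections. The homogeneous components of
these generators generate over `A` alone. -/
theorem isFG_of_finite {M : GrMod 𝒜} [GradedAlgebraEI 𝒜]
    (h : Module.Finite (OpRing K H A) M.carrier) : M.IsFG := by
  classical
  obtain ⟨s, hs⟩ := h
  choose F hF using exists_eq_sum_proj M.internal
  refine ⟨s.biUnion fun m => (F m).image fun h => proj M.internal h m, fun N hN hsN => ?_⟩
  -- The submodule `N` need not be graded; `L` is its largest graded part, which still contains the
  -- homogeneous generators.
  let L : Submodule K M.carrier := ⨆ h, N ⊓ M.gr h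
  have hLN : L ≤ N := iSup_le fun h => inf_le_left
  have hL1 : ∀ (a : A), ∀ m ∈ L, M.act a m ∈ L := by
    intro a m hm
    have ha := mem_iSup_gr (GradedAlgebraEI.internal (𝒜 := 𝒜)) a
    induction ha using Submodule.iSup_induction' with
    | zero => rw [map_zero]; exact zero_mem _
    | add x y _ _ hx hy => rw [map_add]; exact add_mem hx hy
    | mem k a ha =>
      have : L ≤ L.comap (M.act a) := iSup_le fun h m hm =>
        Submodule.mem_iSup_of_mem (k + h) ⟨hN a m hm.1, M.act_mem ha hm.2⟩
      exact this hm
  have hL2 : ∀ m ∈ L, ∀ h : H, proj M.internal h m ∈ L := by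
    intro m hm h
    have : L ≤ L.comap (proj M.internal h) := iSup_le fun k m hm => by
      change proj M.internal h m ∈ L
      by_cases hk : k = h
      · subst hk
        rw [proj_same _ hm.2]
        exact Submodule.mem_iSup_of_mem k hm
      · rw [proj_ne _ hk hm.2]
        exact zero_mem _
    exact this hm
  have htop : M.opSubmodule L hL1 hL2 = ⊤ := by
    rw [eq_top_iff, ← hs, Submodule.span_le]
    intro m hm
    change m ∈ L
    rw [hF m]
    exact Submodule.sum_mem _ fun h hh => Submodule.mem_iSup_of_mem h
      ⟨hsN (Finset.mem_coe.2 (Finset.mem_biUnion.2 ⟨m, hm, Finset.mem_image.2 ⟨h, hh, rfl⟩⟩)),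
        proj_mem _ _ _⟩
  refine eq_top_iff.2 fun m _ => hLN ?_
  have : m ∈ M.opSubmodule L hL1 hL2 := htop ▸ Submodule.mem_top
  exact this

theorem isFG_iff {M : GrMod 𝒜} [GradedAlgebraEI 𝒜] :
    M.IsFG ↔ Module.Finite (OpRing K H A) M.carrier := by
  refine ⟨fun ⟨s, hs⟩ => ⟨s, ?_⟩, isFG_of_finite⟩
  refine Submodule.restrictScalars_injective K _ _ ?_
  exact hs _ (fun a m hm => Submodule.act_mem _ a hm) Submodule.subset_span

theorem extend_of_injective [GradedAlgebraEI 𝒜] {E : GrMod 𝒜} (hE : Injective E) {Y : GrMod 𝒜}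
    (N : Submodule (OpRing K H A) Y.carrier) (f : N →ₗ[OpRing K H A] E.carrier) :
    ∃ g : Y.carrier →ₗ[OpRing K H A] E.carrier, ∀ x : N, g x = f x := by
  let X := Y.subEquiv.symm N
  let φ : X.toGrMod.carrier ≃ₗ[OpRing K H A] N :=
    (subLinEquiv X).trans (LinearEquiv.ofEq _ _ (Y.subEquiv.apply_symm_apply N))
  obtain ⟨g, hg⟩ := (injective_iff E).1 hE _ _ X.incl (f ∘ₗ φ.toLinearMap) X.incl_injective
  refine ⟨g, fun x => ?_⟩
  have h1 := hg (φ.symm x)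
  have h2 : X.incl (φ.symm x) = x := congrArg Subtype.val (φ.apply_symm_apply x)
  rw [h2] at h1
  rw [h1]
  exact congrArg f (φ.apply_symm_apply x)

variable [GradedAlgebraEI 𝒜]

/-- Baer's criterion. -/
theorem injective_of_baer (he : IsDistinguishedFamily 𝒜 e) (E : GrMod 𝒜)
    (h : ∀ i k (N : Submodule (OpRing K H A) (Ps he i k).carrier)
      (f : N →ₗ[OpRing K H A] E.carrier),
      ∃ g : (Ps he i k).carrier →ₗ[OpRing K H A] E.carrier, ∀ x : N, g x = f x) :
    Injective E := by
  rw [injective_iff]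
  intro X Y f g hf
  have : Fact (Function.Injective f) := ⟨hf⟩
  obtain ⟨D, hD⟩ : ∃ D : Module.Baer.ExtensionOf f g, ∀ D', D ≤ D' → D' = D :=
    ⟨_, Module.Baer.extensionOfMax_is_max f g⟩
  have htop : D.domain = ⊤ := by
    refine eq_top_iff.2 fun y _ =>
      he.pc_induction (D.domain.restrictScalars K) (fun i d y hy => ?_) y
    change y ∈ D.domain
    obtain ⟨q, hq⟩ := Ps.exists_lift (he := he) (k := -d) (M := Y) (m := y) (by rwa [neg_neg])
    -- The modules `A e_i [k]` replace the ring in the classical argument: the preimage of the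
    -- domain under `b ↦ b y` plays the role of the left ideal.
    obtain ⟨G, hG⟩ := h i (-d) (D.domain.comap q)
      (D.toLinearPMap.toFun ∘ₗ q.restrict (q := D.domain) fun _ hx => hx)
    have hG' : ∀ w (hw : q w ∈ D.domain), G w = D.toLinearPMap ⟨q w, hw⟩ := fun w hw =>
      hG ⟨w, hw⟩
    have hker : LinearMap.ker q ≤ LinearMap.ker G := fun w hw => by
      have hw0 : q w = 0 := hw
      rw [LinearMap.mem_ker, hG' w (hw0 ▸ zero_mem _)]
      have : (⟨q w, hw0 ▸ zero_mem _⟩ : D.domain) = 0 := Subtype.ext hw0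
      rw [this, LinearPMap.map_zero]
    -- On the kernel of `q` the map `G` agrees with the extension at `0`, so it descends to `A y`;
    -- there it is compatible with `D` and can be glued to it.
    let T : Y.carrier →ₗ.[OpRing K H A] E.carrier :=
      ⟨LinearMap.range q, (LinearMap.ker q).liftQ G hker ∘ₗ q.quotKerEquivRange.symm.toLinearMap⟩
    have hT : ∀ w (hw : q w ∈ T.domain), T ⟨q w, hw⟩ = G w := fun w hw => by
      have h1 : q.quotKerEquivRange.symm ⟨q w, hw⟩ = Submodule.Quotient.mk w := by
        rw [LinearEquiv.symm_apply_eq]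
        rfl
      change (LinearMap.ker q).liftQ G hker (q.quotKerEquivRange.symm ⟨q w, hw⟩) = G w
      rw [h1]
      rfl
    have hDT : ∀ (x : D.domain) (y : T.domain), (x : Y.carrier) = y →
        D.toLinearPMap x = T y := by
      rintro ⟨x, hx⟩ ⟨_, w, rfl⟩ hxy
      obtain rfl : x = q w := hxy
      exact (hG' w hx).symm.trans (hT w _).symm
    have hle := LinearPMap.left_le_sup D.toLinearPMap T hDT
    let D' : Module.Baer.ExtensionOf f g :=
      { toLinearPMap := D.toLinearPMap.sup T hDT
        le := D.le.trans hle.1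
        is_extension := fun m => (D.is_extension m).trans (hle.2 rfl) }
    have hD' : D' = D := hD D' hle
    have h2 : LinearMap.range q ≤ D'.domain := le_sup_right
    rw [hD'] at h2
    refine h2 ⟨Ps.gen he i (-d), ?_⟩
    rw [hq, Ps.val_gen, hy.2]
  refine ⟨D.toLinearPMap.toFun ∘ₗ LinearMap.id.codRestrict D.domain fun y => htop ▸ trivial,
    fun x => ?_⟩
  exact (D.is_extension x).symm

/-- A map from a finitely generated module to a direct sum involves finitely many summands. -/
theorem finite_ne_zero {Λ : Type u} {M : Λ → GrMod 𝒜} {X : Type*} [AddCommGroup X]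
    [Module (OpRing K H A) X] [hX : Module.Finite (OpRing K H A) X]
    (f : X →ₗ[OpRing K H A] (dsum M).carrier) : {l | dsumπ M l ∘ₗ f ≠ 0}.Finite := by
  obtain ⟨s, hs⟩ := hX
  refine (s.finite_toSet.biUnion fun x _ => finite_dsumπ_ne_zero (f x)).subset fun l hl => ?_
  by_contra hc
  refine hl (LinearMap.ext_on hs fun x hx => ?_)
  by_contra hx0
  exact hc (Set.mem_biUnion hx hx0)

/-- By Baer's criterion the source is a finitely generated `N`, whose image involves finitely many
summands. Extending those coordinates and taking `0` for the others keeps the extension inside the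
direct sum. -/
theorem injective_dsum (he : IsDistinguishedFamily 𝒜 e)
    (hN : ∀ i k, IsNoetherian (OpRing K H A) (Ps he i k).carrier) {Λ : Type u} {M : Λ → GrMod 𝒜}
    (hM : ∀ l, Injective (M l)) : Injective (dsum M) := by
  classical
  refine injective_of_baer he _ fun i k N f => ?_
  have := hN i k
  have hfin := finite_ne_zero f
  choose g hg using fun l => extend_of_injective (hM l) N (dsumπ M l ∘ₗ f)
  obtain ⟨G, hG⟩ := exists_dsum_lift (M := M)
    (fun l => if dsumπ M l ∘ₗ f = 0 then 0 else g l) fun x => hfin.subset fun l hl h => by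
      simp [h] at hl
  refine ⟨G, fun x => dsum_ext fun l => ?_⟩
  rw [hG]
  split_ifs with h
  · exact (congrArg (fun q => q x) h).symm
  · exact hg l x

/-- A module with a finitely generated essential submodule which embeds into a direct sum of
Noetherian modules is Noetherian. -/
theorem isNoetherian_of_essential {Λ : Type u} {M : Λ → GrMod 𝒜}
    (hM : ∀ l, IsNoetherian (OpRing K H A) (M l).carrier) {X : Type*} [AddCommGroup X]
    [Module (OpRing K H A) X] (D : Submodule (OpRing K H A) X)
    (hD : Module.Finite (OpRing K H A) D)
    (hess : ∀ L : Submodule (OpRing K H A) X, L ≠ ⊥ → L ⊓ D ≠ ⊥)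
    (t : X →ₗ[OpRing K H A] (dsum M).carrier) (ht : Function.Injective t) :
    IsNoetherian (OpRing K H A) X := by
  have hfin := finite_ne_zero (t ∘ₗ D.subtype)
  have := hfin.to_subtype
  let p : X →ₗ[OpRing K H A]
      ∀ l : {l | dsumπ M l ∘ₗ t ∘ₗ D.subtype ≠ 0}, (M l).carrier :=
    LinearMap.pi fun l => dsumπ M l ∘ₗ t
  -- Only finitely many coordinates are nonzero on `D`. The kernel of the projection to these meets
  -- `D` trivially, so it vanishes by essentiality.
  refine isNoetherian_of_injective p ?_
  rw [← LinearMap.ker_eq_bot]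
  by_contra hne
  refine hess _ hne (eq_bot_iff.2 fun x hx => ht (dsum_ext fun l => ?_))
  rw [map_zero, map_zero]
  by_cases hl : dsumπ M l ∘ₗ t ∘ₗ D.subtype = 0
  · exact congrArg (fun q => q ⟨x, hx.2⟩) hl
  · exact congrFun (LinearMap.mem_ker.1 hx.1) ⟨l, hl⟩

/-- A nonzero graded submodule contains a nonzero image of some `A e_i [k]`; this image is Artinian
and so has a minimal nonzero submodule. -/
theorem exists_simple (he : IsDistinguishedFamily 𝒜 e)
    (hA : ∀ i k, IsArtinian (OpRing K H A) (Ps he i k).carrier) {M : GrMod 𝒜}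
    {N : Submodule (OpRing K H A) M.carrier} (hN : N ≠ ⊥) :
    ∃ S ≤ N, IsSimpleModule (OpRing K H A) S := by
  obtain ⟨i, h, m, hm, hmpc, hm0⟩ := he.exists_pc hN
  obtain ⟨q, hq⟩ := Ps.exists_lift (he := he) (k := -h) (M := M) (m := m) (by rwa [neg_neg])
  have := hA i (-h)
  have hat : IsAtomic (Submodule (OpRing K H A) (LinearMap.range q)) := inferInstance
  rcases hat.eq_bot_or_exists_atom_le ⊤ with h1 | ⟨S, hS, -⟩
  · refine absurd ?_ hm0
    have h2 : (⟨m, Ps.gen he i (-h), by rw [hq, Ps.val_gen, hmpc.2]⟩ : LinearMap.range q) ∈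
        (⊤ : Submodule (OpRing K H A) (LinearMap.range q)) := trivial
    rw [h1] at h2
    exact congrArg Subtype.val ((Submodule.mem_bot _).1 h2)
  · refine ⟨S.map (LinearMap.range q).subtype, ?_, ?_⟩
    · refine (Submodule.map_subtype_le _ _).trans ?_
      rintro _ ⟨b, rfl⟩
      rw [hq]
      exact N.act_mem _ hm
    · have := isSimpleModule_iff_isAtom.2 hS
      exact (Submodule.equivSubtypeMap _ S).symm.isSimpleModule_iff.2 this

/-- A linear form not vanishing on a homogeneous `m ∈ S` induces a map to a dual that is nonzero on
`S`, hence injective there by Schur's lemma. -/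
theorem exists_injective_on_simple (he : IsDistinguishedFamily 𝒜 e) {M : GrMod 𝒜}
    (S : Submodule (OpRing K H A) M.carrier) [hS : IsSimpleModule (OpRing K H A) S] :
    ∃ i k, ∃ g : M.carrier →ₗ[OpRing K H A] (Dmod he i k).carrier,
      Function.Injective (g ∘ₗ S.subtype) := by
  have hS0 : S ≠ ⊥ := (isSimpleModule_iff_isAtom.1 hS).1
  obtain ⟨i, h, m, hm, hmpc, hm0⟩ := he.exists_pc hS0
  obtain ⟨ψ, hψ, -⟩ := exists_form (K := K) (⊥ : Submodule K M.carrier) (v := m) hm0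
  obtain ⟨g, hg⟩ := Dmod.exists_lift he i h ψ
  refine ⟨i, h, g, (LinearMap.injective_or_eq_zero _).resolve_right fun h0 => ?_⟩
  have h1 : g m = 0 := congrArg (fun q => q ⟨m, hm⟩) h0
  have h2 := hg m (e i)
  rw [h1, hmpc.2, hmpc.2, proj_same _ hmpc.1, hψ, map_zero] at h2
  exact zero_ne_one h2

/-- Every graded module embeds into a direct sum of duals. -/
theorem exists_embedding (he : IsDistinguishedFamily 𝒜 e)
    (hN : ∀ i k, IsNoetherian (OpRing K H A) (Ps he i k).carrier)
    (hA : ∀ i k, IsArtinian (OpRing K H A) (Ps he i k).carrier) (M : GrMod 𝒜) :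
    ∃ (Λ : Type u) (i : Λ → I) (k : Λ → H)
      (g : M.carrier →ₗ[OpRing K H A] (dsum fun l => Dmod he (i l) (k l)).carrier),
      Function.Injective g := by
  classical
  -- The socle is a direct sum of simple modules, each of which embeds into a dual through a map
  -- defined on `M`.
  let D : Submodule (OpRing K H A) M.carrier :=
    sSup {S : Submodule (OpRing K H A) M.carrier | IsSimpleModule (OpRing K H A) S}
  have hss : IsSemisimpleModule (OpRing K H A) D := by
    have h1 := isSemisimpleModule_biSup_of_isSemisimpleModule_submodule
      (s := {S : Submodule (OpRing K H A) M.carrier | IsSimpleModule (OpRing K H A) S})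
      (p := fun S => S) fun S hS => by
        have : IsSimpleModule (OpRing K H A) S := hS
        infer_instance
    rwa [← sSup_eq_iSup] at h1
  obtain ⟨s, E, -, hs⟩ := IsSemisimpleModule.exists_linearEquiv_dfinsupp (OpRing K H A) D
  have hmap : ∀ S : s, ∃ i k, ∃ g : M.carrier →ₗ[OpRing K H A] (Dmod he i k).carrier,
      Function.Injective (g ∘ₗ D.subtype ∘ₗ S.1.subtype) := by
    intro S
    have h1 : IsSimpleModule (OpRing K H A) (S.1.map D.subtype) :=
      (Submodule.equivSubtypeMap _ S.1).symm.isSimpleModule_iff.2 (hs S)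
    obtain ⟨i, k, g, hg⟩ := exists_injective_on_simple he (S.1.map D.subtype)
    refine ⟨i, k, g, fun x y hxy => ?_⟩
    have h2 := @hg ⟨x, Submodule.mem_map_of_mem x.2⟩ ⟨y, Submodule.mem_map_of_mem y.2⟩ hxy
    have h3 := congrArg Subtype.val h2
    exact Subtype.ext (Subtype.ext h3)
  choose i k g hg using hmap
  obtain ⟨G, hG⟩ := exists_dsum_lift (M := fun S => Dmod he (i S) (k S)) (X := D)
    (fun S => (g S ∘ₗ D.subtype ∘ₗ S.1.subtype) ∘ₗ DFinsupp.lapply S ∘ₗ E.toLinearMap)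
    fun x => ((E x).support.finite_toSet).subset fun S hS => by
      rw [Finset.mem_coe, DFinsupp.mem_support_iff]
      intro h0
      exact hS ((congrArg (g S ∘ₗ D.subtype ∘ₗ S.1.subtype) h0).trans (map_zero _))
  obtain ⟨F, hF⟩ := extend_of_injective
    (injective_dsum he hN fun S => Dmod.injective he (i S) (k S)) D G
  refine ⟨s, i, k, F, ?_⟩
  -- A nonzero kernel would contain a simple submodule, which lies in the socle, where `F` is
  -- injective.
  rw [← LinearMap.ker_eq_bot]
  by_contra hne
  obtain ⟨S, hSle, hS⟩ := exists_simple he hA hne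
  have hSD : S ≤ D := le_sSup hS
  refine (isSimpleModule_iff_isAtom.1 hS).1 (eq_bot_iff.2 fun x hx => ?_)
  have h0 : G ⟨x, hSD hx⟩ = 0 := by
    rw [← hF]
    exact hSle hx
  have h1 : E ⟨x, hSD hx⟩ = 0 := DFinsupp.ext fun S => hg S (by
    have h2 := hG S ⟨x, hSD hx⟩
    rw [h0, map_zero] at h2
    rw [DFinsupp.zero_apply, map_zero]
    exact h2.symm)
  exact congrArg Subtype.val ((LinearEquiv.map_eq_zero_iff E).1 h1)

end GrMod

end Chain

/-! ### Frobenius and pseudo-Frobenius properties -/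

section Frobenius

variable {K H A I : Type u} [Field K] [AddCommGroup H] [NonUnitalRing A] [Module K A]
  [IsScalarTower K A A] [SMulCommClass K A A] {𝒜 : H → Submodule K A} {e : I → A}
  [GradedAlgebraEI 𝒜]

theorem isFCog_iff {M : GrMod 𝒜} : M.IsFCog ↔
    Module.Finite (OpRing K H A) (M.subEquiv M.socle) ∧
    ∀ L : Submodule (OpRing K H A) M.carrier, L ≠ ⊥ → L ⊓ M.subEquiv M.socle ≠ ⊥ := by
  rw [GrMod.IsFCog, GrMod.isEssential_iff, GrMod.isFG_iff]
  exact and_congr_left fun _ => Module.Finite.equiv_iff (GrMod.subLinEquiv M.socle)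

theorem Dmod.isFCog (he : IsDistinguishedFamily 𝒜 e) {i : I} {k : H} (hl : HasLocalCorners 𝒜 e)
    (hfd : FiniteDimensional K (peirce 𝒜 e i i 0)) : (Dmod he i k).IsFCog := by
  obtain ⟨z, hz, hz0, -, hmin⟩ := Dmod.exists_socle (he := he) (k := k) hl hfd
  obtain ⟨h1, -, h2⟩ := GrMod.socle_of_min hz0 hmin
  refine isFCog_iff.2 ⟨?_, (GrMod.isEssential_iff _).1 h2⟩
  rw [h1]
  infer_instance

/-- Direct sums of injectives are direct sums of projectives, hence injective. For an ascending
chain `N n` with union `U`, embed each `A e_i / N n` into an injective `E n`. An element of `U`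
vanishes in almost all of them, so `U` maps to the direct sum, and this map extends to `A e_i`. -/
theorem isLeftLocallyNoetherian_of_frobenius (he : IsDistinguishedFamily 𝒜 e)
    (h : IsFrobeniusCategory (GrMod 𝒜)) : IsLeftLocallyNoetherian he := by
  intro i
  have hds : ∀ (Λ : Type u) (M : Λ → GrMod 𝒜), (∀ l, Injective (M l)) →
      Injective (GrMod.dsum M) := fun Λ M hM =>
    (h.2.2 _).1 (GrMod.projective_dsum fun l => (h.2.2 _).2 (hM l))
  have hN : IsNoetherian (OpRing K H A) (Ps he i 0).carrier := by
    rw [← monotone_stabilizes_iff_noetherian]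
    intro N
    have hemb : ∀ l : ULift.{u} ℕ, ∃ E : GrMod 𝒜, Injective E ∧
        ∃ g : (Ps he i 0).carrier →ₗ[OpRing K H A] E.carrier,
          ∀ x, g x = 0 ↔ x ∈ N l.down := by
      intro l
      obtain ⟨J⟩ := h.2.1.presentation ((Ps he i 0).quot ((Ps he i 0).subEquiv.symm (N l.down)))
      have := J.mono
      refine ⟨J.J, J.injective, GrMod.Hom.lin J.f ∘ₗ GrMod.quotMk _ _, fun x => ?_⟩
      rw [LinearMap.comp_apply, (GrMod.injective_of_mono J.f).eq_iff' (map_zero _),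
        GrMod.quotMk_eq_zero]
      rfl
    choose E hE g hg using hemb
    let U : Submodule (OpRing K H A) (Ps he i 0).carrier := ⨆ n, N n
    have hU : ∀ x, x ∈ U ↔ ∃ n, x ∈ N n := fun x =>
      Submodule.mem_iSup_of_directed _ N.monotone.directed_le
    obtain ⟨f, hf⟩ := GrMod.exists_dsum_lift (M := E) (X := U) (fun l => g l ∘ₗ U.subtype) (by
      rintro ⟨x, hx⟩
      obtain ⟨n, hn⟩ := (hU x).1 hx
      refine Set.Finite.subset ((Set.finite_lt_nat n).preimage ULift.down_injective.injOn)
        fun l hl => ?_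
      by_contra hln
      exact hl ((hg l x).2 (N.monotone (not_lt.1 hln) hn)))
    obtain ⟨F, hF⟩ := GrMod.extend_of_injective (hds _ E hE) U f
    -- The image of the generator has finite support in an infinite index set, so some coordinate
    -- vanishes on all of `A e_i`; this means that `U` is contained in the corresponding term of the
    -- chain.
    obtain ⟨l, hl⟩ : ∃ l, GrMod.dsumπ E l (F (Ps.gen he i 0)) = 0 := by
      by_contra! hc
      have := GrMod.finite_dsumπ_ne_zero (F (Ps.gen he i 0))
      rw [Set.eq_univ_of_forall (s := {l | _}) hc] at this
      exact Set.infinite_univ this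
    have hle : U ≤ N l.down := fun x hx => by
      have h1 := Ps.lin_eq (GrMod.dsumπ E l ∘ₗ F) x
      rw [LinearMap.comp_apply, LinearMap.comp_apply, hl, map_zero, hF ⟨x, hx⟩, hf] at h1
      exact (hg l x).1 h1
    exact ⟨l.down, fun m hm => le_antisymm (N.monotone hm) ((le_iSup N m).trans hle)⟩
  have hN' : WellFoundedGT (Submodule (OpRing K H A) ((Ae he i).shift 0).carrier) :=
    isNoetherian_iff'.1 hN
  exact (((Ae he i).shiftSub 0).trans (GrMod.subEquiv _)).strictMono.wellFoundedGT

section Perfect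

variable (he : IsLocalFamily 𝒜 e) (h1 : ∀ i, ∃ j d f, IsPerfect 𝒜 e i j d f)
  (h2 : ∀ j, ∃ i d f, IsPerfect 𝒜 e i j d f)

include h2 in
theorem Ps.injective_of_perfect (j : I) (k : H) :
    Injective (Ps he.toIsDistinguishedFamily j k) := by
  obtain ⟨i, d, f, hf⟩ := h2 j
  obtain ⟨t, rfl⟩ : ∃ t, k = d - t := ⟨d - k, (sub_sub_cancel d k).symm⟩
  obtain ⟨φ⟩ := hf.exists_equiv he t
  exact GrMod.injective_of_retract (Dmod.injective _ i t) φ.toLinearMap φ.symm.toLinearMap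
    φ.symm_apply_apply

include h1 in
theorem Dmod.projective_of_perfect (i : I) (k : H) :
    Projective (Dmod he.toIsDistinguishedFamily i k) := by
  obtain ⟨j, d, f, hf⟩ := h1 i
  obtain ⟨φ⟩ := hf.exists_equiv he k
  exact GrMod.projective_of_retract (Ps.projective _ j (d - k)) φ.symm.toLinearMap φ.toLinearMap
    φ.apply_symm_apply

variable (hN : ∀ i k, IsNoetherian (OpRing K H A) (Ps he.toIsDistinguishedFamily i k).carrier)
  (hA : ∀ i k, IsArtinian (OpRing K H A) (Ps he.toIsDistinguishedFamily i k).carrier)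

include h1 hN hA in
-- An injective module is a direct summand of the sum of duals into which it embeds, and each of
-- these duals is a shift of some `A e_j`.
theorem projective_of_injective (M : GrMod 𝒜) (hM : Injective M) : Projective M := by
  obtain ⟨Λ, i, k, g, hg⟩ := GrMod.exists_embedding he.toIsDistinguishedFamily hN hA M
  obtain ⟨r, hr⟩ := (GrMod.injective_iff M).1 hM _ _ g LinearMap.id hg
  exact GrMod.projective_of_retract
    (GrMod.projective_dsum fun l => Dmod.projective_of_perfect he h1 (i l) (k l)) g r hr

include h2 hN in
theorem injective_of_projective (M : GrMod 𝒜) (hM : Projective M) : Injective M := by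
  obtain ⟨Λ, i, k, g, hg⟩ := exists_cover he.toIsDistinguishedFamily M
  obtain ⟨s, hs⟩ := (GrMod.projective_iff M).1 hM _ _ g LinearMap.id hg
  exact GrMod.injective_of_retract (GrMod.injective_dsum he.toIsDistinguishedFamily hN fun l =>
    Ps.injective_of_perfect he h2 (i l) (k l)) s g hs

include h1 h2 hN hA in
theorem isFrobeniusCategory_of_perfect : IsFrobeniusCategory (GrMod 𝒜) := by
  have hd := he.toIsDistinguishedFamily
  refine ⟨⟨fun M => ?_⟩, ⟨fun M => ?_⟩, fun M =>
    ⟨injective_of_projective he h2 hN M, projective_of_injective he h1 hN hA M⟩⟩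
  · obtain ⟨Λ, i, k, g, hg⟩ := exists_cover hd M
    exact ⟨{ p := _
             projective := GrMod.projective_dsum fun l => Ps.projective hd (i l) (k l)
             f := GrMod.homOf g
             epi := GrMod.epi_of_surjective _ hg }⟩
  · obtain ⟨Λ, i, k, g, hg⟩ := GrMod.exists_embedding hd hN hA M
    exact ⟨{ J := _
             injective := GrMod.injective_dsum hd hN fun l => Dmod.injective hd (i l) (k l)
             f := GrMod.homOf g
             mono := GrMod.mono_of_injective _ hg }⟩

include h1 h2 hN hA in
-- A projective module embeds into a direct sum of Noetherian modules `A e_i [k]`, so a finitely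
-- generated essential submodule makes it Noetherian. That submodule is the whole module in one
-- direction and the socle in the other.
theorem projective_and_isFG_iff_of_perfect (M : GrMod 𝒜) :
    (Projective M ∧ M.IsFG) ↔ (Injective M ∧ M.IsFCog) := by
  have hd := he.toIsDistinguishedFamily
  have hNoeth : Projective M → ∀ D : Submodule (OpRing K H A) M.carrier,
      Module.Finite (OpRing K H A) D →
      (∀ L : Submodule (OpRing K H A) M.carrier, L ≠ ⊥ → L ⊓ D ≠ ⊥) →
      IsNoetherian (OpRing K H A) M.carrier := by
    intro hM D hD hess
    obtain ⟨Λ, i, k, g, hg⟩ := exists_cover hd M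
    obtain ⟨s, hs⟩ := (GrMod.projective_iff M).1 hM _ _ g LinearMap.id hg
    exact GrMod.isNoetherian_of_essential (fun l => hN (i l) (k l)) D hD hess s
      (Function.LeftInverse.injective hs)
  rw [isFCog_iff, GrMod.isFG_iff]
  constructor
  · rintro ⟨hM, hfg⟩
    have := hNoeth hM ⊤ (Module.Finite.equiv Submodule.topEquiv.symm) fun L hL => by
      rwa [inf_top_eq]
    refine ⟨injective_of_projective he h2 hN M hM, inferInstance, fun L hL h0 => ?_⟩
    obtain ⟨S, hSL, hS⟩ := GrMod.exists_simple hd hA hL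
    exact (isSimpleModule_iff_isAtom.1 hS).1
      (eq_bot_iff.2 ((le_inf hSL (GrMod.le_socle S)).trans h0.le))
  · rintro ⟨hM, hfg, hess⟩
    have hP := projective_of_injective he h1 hN hA M hM
    have := hNoeth hP _ hfg hess
    exact ⟨hP, inferInstance⟩

end Perfect

end Frobenius

/-! ### Assembling both sides -/

section Main

variable {K H A I : Type u} [Field K] [AddCommGroup H] [NonUnitalRing A] [Module K A]
  [IsScalarTower K A A] [SMulCommClass K A A] {𝒜 : H → Submodule K A} {e : I → A}
  [GradedAlgebraEI 𝒜]

/-- Perfect pairings arise if the duals of all `e_i A` and `A e_i` are projective. -/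
theorem exists_perfect_perm (he : IsLocalFamily 𝒜 e)
    (hl : ∀ i, Projective (Dmod he.toIsDistinguishedFamily i 0))
    (hr : ∀ i, Projective (Dmod he.op.toIsDistinguishedFamily i 0)) :
    ∃ (ν : Equiv.Perm I) (d : I → H) (f : I → A →ₗ[K] K),
      ∀ i, IsPerfect 𝒜 e i (ν i) (d i) (f i) := by
  refine exists_perm he (fun i => exists_perfect_of_projective he i (hl i)) fun j => ?_
  obtain ⟨i, d, f, hf⟩ := exists_perfect_of_projective he.op j (hr j)
  exact ⟨i, d, _, hf.of_op⟩

/-- Locally Noetherian algebras with perfect pairings are Frobenius and pseudo-Frobenius. -/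
theorem frobenius_of_perm (he : IsLocalFamily 𝒜 e)
    (hN : IsLocallyNoetherian he.toIsDistinguishedFamily) {ν : Equiv.Perm I} {d : I → H}
    {f : I → A →ₗ[K] K} (hf : ∀ i, IsPerfect 𝒜 e i (ν i) (d i) (f i)) :
    (IsFrobeniusCategory (GrMod 𝒜) ∧
      ∀ M : GrMod 𝒜, (Projective M ∧ M.IsFG) ↔ (Injective M ∧ M.IsFCog)) ∧
    (IsFrobeniusCategory (GrMod (opGr 𝒜)) ∧
      ∀ M : GrMod (opGr 𝒜), (Projective M ∧ M.IsFG) ↔ (Injective M ∧ M.IsFCog)) := by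
  have hd := he.toIsDistinguishedFamily
  have h1 : ∀ i, ∃ j d f, IsPerfect 𝒜 e i j d f := fun i => ⟨_, _, _, hf i⟩
  have h2 : ∀ j, ∃ i d f, IsPerfect 𝒜 e i j d f := fun j =>
    ⟨ν.symm j, d (ν.symm j), f (ν.symm j), by simpa using hf (ν.symm j)⟩
  have h1' : ∀ i, ∃ j d f, IsPerfect (opGr 𝒜) (fun i => MulOpposite.op (e i)) i j d f := fun i => by
    obtain ⟨j, d, f, hf⟩ := h2 i
    exact ⟨j, d, _, hf.op⟩
  have h2' : ∀ j, ∃ i d f, IsPerfect (opGr 𝒜) (fun i => MulOpposite.op (e i)) i j d f := fun j => by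
    obtain ⟨i, d, f, hf⟩ := h1 j
    exact ⟨i, d, _, hf.op⟩
  have hNl : ∀ i k, IsNoetherian (OpRing K H A) (Ps hd i k).carrier := fun i k =>
    Ps.isNoetherian (hN.1 i)
  have hNr : ∀ i k, IsNoetherian (OpRing K H Aᵐᵒᵖ) (Ps hd.op i k).carrier := fun i k =>
    Ps.isNoetherian (hN.2 i)
  -- The chain conditions cross sides: right Noetherian gives left Artinian here, and left
  -- Noetherian gives right Artinian below.
  have hAl : ∀ i k, IsArtinian (OpRing K H A) (Ps hd i k).carrier := fun j k => by
    obtain ⟨i, d, f, hf⟩ := h2 j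
    exact hf.isArtinian he hd.op (MulOpposite.opLinearEquiv K) (fun _ _ => rfl)
      (fun h x hx => op_mem_opGr hx) (fun _ => rfl) (hNr i 0)
  have hAr : ∀ i k, IsArtinian (OpRing K H Aᵐᵒᵖ) (Ps hd.op i k).carrier := fun j k => by
    obtain ⟨i, d, f, hf⟩ := h2' j
    exact hf.isArtinian he.op hd (MulOpposite.opLinearEquiv K).symm (fun _ _ => rfl)
      (by rintro h _ ⟨x, hx, rfl⟩; exact hx) (fun _ => rfl) (hNl i 0)
  exact ⟨⟨isFrobeniusCategory_of_perfect he h1 h2 hNl hAl,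
      projective_and_isFG_iff_of_perfect he h1 h2 hNl hAl⟩,
    ⟨isFrobeniusCategory_of_perfect he.op h1' h2' hNr hAr,
      projective_and_isFG_iff_of_perfect he.op h1' h2' hNr hAr⟩⟩

/-- Perfect pairings from simple essential socles and socle permutations. -/
theorem exists_perfect_perm_of_socles (he : IsLocalFamily 𝒜 e)
    (hsl : HasSimpleEssentialSocles he.toIsDistinguishedFamily)
    (hsr : HasSimpleEssentialSocles he.toIsDistinguishedFamily.op)
    (hpl : HasSoclePermutation he.toIsDistinguishedFamily)
    (hpr : HasSoclePermutation he.toIsDistinguishedFamily.op) :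
    ∃ (ν : Equiv.Perm I) (d : I → H) (f : I → A →ₗ[K] K),
      ∀ i, IsPerfect 𝒜 e i (ν i) (d i) (f i) := by
  obtain ⟨ν, hν⟩ := hpr
  obtain ⟨ν', hν'⟩ := hpl
  have h := exists_perfect_of_socles he ν.injective (ν' := ν') (fun j => by
    obtain ⟨s, ⟨φ⟩⟩ := hν' j
    exact exists_socle_element he.toIsDistinguishedFamily he.loc (hsl j).1 (hsl j).2 φ) fun i => by
    obtain ⟨s, ⟨φ⟩⟩ := hν i
    obtain ⟨h, w, hw, hw0, hy⟩ :=
      exists_socle_element he.toIsDistinguishedFamily.op he.op.loc (hsr i).1 (hsr i).2 φ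
    refine ⟨h, w.unop, mem_peirce_op.1 hw, fun h0 => hw0 (MulOpposite.unop_injective h0),
      fun k t y hyk hy0 => ?_⟩
    obtain ⟨a, ha, haw⟩ := hy k t (MulOpposite.op y) (mem_peirce_op.2 hyk)
      fun h0 => hy0 (MulOpposite.op_injective h0)
    exact ⟨a.unop, mem_peirce_op.1 ha, congrArg MulOpposite.unop haw⟩
  choose d f hf using h
  exact ⟨ν, d, f, hf⟩

end Main

end GrAlg

open GrAlg in
theorem mainTheorem4 {K H A I : Type u} [Field K] [AddCommGroup H] [NonUnitalRing A] [Module K A]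
    [IsScalarTower K A A] [SMulCommClass K A A] (𝒜 : H → Submodule K A) [GradedAlgebraEI 𝒜]
    (e : I → A) (he : IsWeaklyBasicFamily 𝒜 e) :
    List.TFAE [
      IsLocallyNoetherian he.toIsDistinguishedFamily ∧
        (HasSimpleEssentialSocles he.toIsDistinguishedFamily ∧
          HasSimpleEssentialSocles he.toIsDistinguishedFamily.op) ∧
        (HasSoclePermutation he.toIsDistinguishedFamily.op ∧
          HasSoclePermutation he.toIsDistinguishedFamily),
      IsLocallyNoetherian he.toIsDistinguishedFamily ∧ IsGradedPseudoFrobenius 𝒜,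
      IsLocallyNoetherian he.toIsDistinguishedFamily ∧ HasGradedNakayamaForm 𝒜 e,
      IsGradedQuasiFrobenius 𝒜] := by
  have hl := he.isLocalFamily
  have hd := he.toIsDistinguishedFamily
  tfae_have 1 → 3 := by
    rintro ⟨hN, ⟨hsl, hsr⟩, hpr, hpl⟩
    obtain ⟨ν, d, f, hf⟩ := exists_perfect_perm_of_socles hl hsl hsr hpl hpr
    exact ⟨hN, hasGradedNakayamaForm_of_perfect hl ν d f hf⟩
  tfae_have 2 → 3 := by
    rintro ⟨hN, hpl, hpr⟩
    obtain ⟨ν, d, f, hf⟩ := exists_perfect_perm hl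
      -- The duals are finitely cogenerated injectives, so the hypothesis makes them projective.
      (fun i => ((hpl _).2 ⟨Dmod.injective hd i 0, Dmod.isFCog hd hl.loc (hl.fd i i 0)⟩).1)
      (fun i => ((hpr _).2
        ⟨Dmod.injective hd.op i 0, Dmod.isFCog hd.op hl.op.loc (hl.op.fd i i 0)⟩).1)
    exact ⟨hN, hasGradedNakayamaForm_of_perfect hl ν d f hf⟩
  tfae_have 4 → 3 := by
    rintro ⟨hFl, hFr⟩
    obtain ⟨ν, d, f, hf⟩ := exists_perfect_perm hl
      (fun i => (hFl.2.2 _).2 (Dmod.injective hd i 0))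
      (fun i => (hFr.2.2 _).2 (Dmod.injective hd.op i 0))
    exact ⟨⟨isLeftLocallyNoetherian_of_frobenius hd hFl,
      isLeftLocallyNoetherian_of_frobenius hd.op hFr⟩, hasGradedNakayamaForm_of_perfect hl ν d f hf⟩
  tfae_have 3 → 4 := by
    rintro ⟨hN, B, ν, d, hB⟩
    have h := frobenius_of_perm hl hN (hB.isPerfect hd)
    exact ⟨h.1.1, h.2.1⟩
  tfae_have 3 → 2 := by
    rintro ⟨hN, B, ν, d, hB⟩
    have h := frobenius_of_perm hl hN (hB.isPerfect hd)
    exact ⟨hN, h.1.2, h.2.2⟩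
  tfae_have 3 → 1 := by
    rintro ⟨hN, B, ν, d, hB⟩
    have hsr := fun i => (hB.isPerfect hd i).op.socle hl.op
    -- The module `A e_j` is paired with `e_i A` for `i = ν.symm j`, so the left socle permutation
    -- is the inverse of the right one.
    have hsl := fun j => by
      have h := hB.isPerfect hd (ν.symm j)
      rw [ν.apply_symm_apply] at h
      exact h.socle hl
    exact ⟨hN, ⟨fun i => ⟨(hsl i).1, (hsl i).2.1⟩, fun i => ⟨(hsr i).1, (hsr i).2.1⟩⟩,
      ⟨ν, fun i => (hsr i).2.2⟩, ⟨ν.symm, fun i => (hsl i).2.2⟩⟩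
  tfae_finish
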